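/- **Model.** There are types $m\in\{1,\dots,M\}$ with $n\ge 1$ agents of each type, states in $\mathbb R^{d_x}$ and controls in $\mathbb R^{d_u}$. Agent $i$ of type $m$ evolves, for $t\ge1$, by $$x^i_{t+1}=A^m x^i_t+B^m u^i_t+D^m\bar x_t+E^m\bar u_t+w^i_t+v^m_t+v^0_t ,$$ where $\bar x_t=(\bar x^m_t)_m$, $\bar u_t=(\bar u^m_t)_m$ collect the empirical means over the agents of each type, $x^i_1\sim\mathcal N(0,X^i_1)$, $w^i_t\sim\mathcal N(0,\sigma_w^2I)$, $v^m_t\sim\mathcal N(0,\sigma_v^2I)$, $v^0_t\sim\mathcal N(0,\sigma_{v^0}^2I)$ are all mutually independent and independent of the random parameters $A^m,B^m,D^m,E^m$, and $\sigma_w>0$. Put $\breve x^i_t=x^i_t-\bar x^m_t$, $\breve u^i_t=u^i_t-\bar u^m_t$, $\breve z^i_t=(\breve x^i_t,\breve u^i_t)$, $\breve\sigma^2=(1-\frac1n)\sigma_w^2$, $\bar\sigma^2=\frac{\sigma_w^2}{n}+\sigma_v^2+\sigma_{v^0}^2$, $(\breve\theta^m)^\top=[A^m,B^m]$, and $\bar\theta^\top=[\bar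 A,\bar B]$ with $\bar A=\mathrm{diag}(A^m)_m+\mathrm{rows}(D^m)_m$, $\bar B=\mathrm{diag}(B^m)_m+\mathrm{rows}(E^m)_m$. For a parameter $\theta^\top=[A,B]$ and costs $Q,R$ let $S(\theta)$ be the positive semidefinite solution of $S=A^\top SA-A^\top SB(R+B^\top SB)^{-1}B^\top SA+Q$ and $L(\theta)=-(B^\top SB+R)^{-1}B^\top SA$. Write $\breve S^m,\breve L^m$ for the costs $Q^m,R^m$, and $\bar L$ for the costs $\mathrm{diag}(Q^m)_m+\bar Q$, $\mathrm{diag}(R^m)_m+\bar R$; let $\breve J^m(\theta)=\breve\sigma^2\,\mathrm{tr}\,\breve S^m(\theta)$ and $\breve c^m(x,u)=x^\top Q^mx+u^\top R^mu$. **Assumptions.** All these cost matrices are positive definite. $\breve\theta^m$ has the law of a matrix with independent columns $\mathcal N(\breve\mu^m_1(\ell),\breve\Sigma^m_1)$, conditioned to lie in a compact set $\breve\Theta^m$; likewise $\bar\theta$ with means $\bar\mu_1(\ell)$, covariance $\bar\Sigma_1$ and a compact set $\bar\Theta$; $\breve\Sigma_1^m$ and $\bar\Sigma_1$ are positive definite.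 All $[A,B]$ in these sets are stabilizable, and for some $\delta\in(0,1)$ we have $\|A_\theta+B_\theta L(\phi)\|\le\delta$ (induced norm) for all $\theta,\phi\in\breve\Theta^m$ with $L=\breve L^m$, and for all $\theta,\phi\in\bar\Theta$ with $L=\bar L$. **Algorithm (TSDE-MF).** Relative actor $m$ selects $j_t\in\arg\max_i(\breve z^i_t)^\top\breve\Sigma^m_t\breve z^i_t$ among the agents of type $m$ (ties broken by a fixed measurable function of the scores) and updates $(\breve\Sigma^m_{t+1})^{-1}=(\breve\Sigma^m_t)^{-1}+\breve\sigma^{-2}\breve z^{j_t}_t(\breve z^{j_t}_t)^\top$ (for $n=1$, where $\breve\sigma=0$ and all $\breve z^i_t=0$, the covariance is left unchanged). Its posterior at time $t$ is the conditional law of $\breve\theta^m$ given $\{\breve x^{j_s}_s,\breve u^{j_s}_s,\breve x^{j_s}_{s+1}\}_{1\le s<t}$. Set $t_0=0$, $T_{-1}=0$; a new episode $k+1$ starts at the first $t>t_k$ with $t-t_k>T_{k-1}$ or $\det\breve\Sigma^m_t<\frac12\det\breve\Sigma^m_{t_k}$, where $T_k=t_{k+1}-t_k$ (so $t_1=1$);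 at $t_k$ a sample $\breve\theta^m_k$ is drawn from the posterior with fresh randomness. The mean-field actor works in the same way, separately, with $\bar\Sigma_{t+1}^{-1}=\bar\Sigma_t^{-1}+\bar\sigma^{-2}\bar z_t\bar z_t^\top$, $\bar z_t=(\bar x_t,\bar u_t)$, the conditional law of $\bar\theta$ given $\bar x_{1:t},\bar u_{1:t-1}$, and samples $\bar\theta_k$. Agent $i$ of type $m$ applies $u^i_t=(\bar L(\bar\theta_k)\bar x_t)^m+\breve L^m(\breve\theta^m_k)\breve x^i_t$ with the samples currently in force. **Regret terms.** For a horizon $T\ge1$ let $K_T$ be the number of episodes of relative actor $m$ up to $T$, and for $k>K_T$ put $t_k=T+1$ (so that $T_{K_T}=T+1-t_{K_T}$). With $\breve S_k=\breve S^m(\breve\theta^m_k)$, $\breve R^{i,m}(T)=\mathbb E[\sum_{t=1}^T\breve c^m(\breve x^i_t,\breve u^i_t)-T\breve J^m(\breve\theta^m)]$ and $$\breve R^{i,m}_0(T)=\mathbb E\Bigl[\sum_{k=1}^{K_T}T_k\breve J^m(\breve\theta^m_k)-T\breve J^m(\breve\theta^m)\Bigr],\qquad \breve R^{i,m}_1(T)=\mathbb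 E\Bigl[\sum_{k=1}^{K_T}\sum_{t=t_k}^{t_{k+1}-1}\bigl[(\breve x^i_t)^\top\breve S_k\breve x^i_t-(\breve x^i_{t+1})^\top\breve S_k\breve x^i_{t+1}\bigr]\Bigr],$$ $$\breve R^{i,m}_2(T)=\mathbb E\Bigl[\sum_{k=1}^{K_T}\sum_{t=t_k}^{t_{k+1}-1}\bigl[((\breve\theta^m)^\top\breve z^i_t)^\top\breve S_k(\breve\theta^m)^\top\breve z^i_t-((\breve\theta^m_k)^\top\breve z^i_t)^\top\breve S_k(\breve\theta^m_k)^\top\breve z^i_t\bigr]\Bigr].$$ **Lemma.** All these expectations are of integrable random variables, and $\breve R^{i,m}(T)=\breve R^{i,m}_0(T)+\breve R^{i,m}_1(T)+\breve R^{i,m}_2(T)$ (sampling error, time-varying controller, model mismatch). Moreover $$\breve R^{i,m}_0(T)\le\tilde{\mathcal O}\bigl(\breve\sigma^2\sqrt{(d_x+d_u)T}\bigr),\quad \breve R^{i,m}_1(T)\le\tilde{\mathcal O}\bigl(\breve\sigma^2\sqrt{(d_x+d_u)T}\bigr),\quad \breve R^{i,m}_2(T)\le\tilde{\mathcal O}\bigl(\breve\sigma^2(d_x+d_u)\sqrt{d_xT}\bigr).$$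 Here $\tilde{\mathcal O}(f)$ means at most $C_\kappa\,(1+\log T+\log(1+\log n))^p f$, where $p$ is a universal constant and $C_\kappa$ depends only on a number $\kappa\ge1$ that satisfies $\|\theta\|,\|\breve S^m(\theta)\|,\mathrm{tr}\,\breve S^m(\theta),\|[I;\breve L^m(\theta)]\|\le\kappa$ for all $\theta\in\breve\Theta^m$, $\frac1{1-\delta}\le\kappa$, $Q^m\ge\kappa^{-1}I$, $\kappa^{-1}I\le\breve\Sigma^m_1\le\kappa I$, and $X^i_1\le\kappa\sigma_w^2I$ for all agents $i$ of type $m$; such a $\kappa$ always exists. -/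

import Mathlib

open MeasureTheory ProbabilityTheory Matrix

noncomputable section

namespace MeanFieldTeam

/-- Matrices carry the product sigma-algebra of their entries. -/
instance matrixMeasurableSpace {a b : Type*} : MeasurableSpace (Matrix a b ℝ) :=
  inferInstanceAs (MeasurableSpace (a → b → ℝ))

/-! ### Single linear quadratic systems -/

section LQ

variable {ι υ : Type} [Fintype ι] [DecidableEq ι] [Fintype υ] [DecidableEq υ]

/-- A parameter `θ` of a linear system `(A, B)`: `θᵀ = [A, B]`, so that `x⁺ = θᵀ z` for
`z = (x, u)`. -/
abbrev Param (ι υ : Type) := Matrix (ι ⊕ υ) ι ℝ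

/-- The parameter `θ` with `θᵀ = [A, B]`. -/
def mkParam (A : Matrix ι ι ℝ) (B : Matrix ι υ ℝ) : Param ι υ := (Matrix.fromCols A B)ᵀ

/-- The matrix `A` of `θᵀ = [A, B]`. -/
def Param.A (θ : Param ι υ) : Matrix ι ι ℝ := (θᵀ).toCols₁

/-- The matrix `B` of `θᵀ = [A, B]`. -/
def Param.B (θ : Param ι υ) : Matrix ι υ ℝ := (θᵀ).toCols₂

/-- Some gain `L` puts all (complex) eigenvalues of `A + B L` strictly inside the unit circle. -/
def Stabilizable (A : Matrix ι ι ℝ) (B : Matrix ι υ ℝ) : Prop :=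
  ∃ L : Matrix υ ι ℝ, ∀ z ∈ spectrum ℂ ((A + B * L).map (algebraMap ℝ ℂ)), ‖z‖ < 1

/-- `S` is a positive semidefinite solution of the discrete-time algebraic Riccati equation. -/
def IsDARE (A : Matrix ι ι ℝ) (B : Matrix ι υ ℝ) (Q : Matrix ι ι ℝ) (R : Matrix υ υ ℝ)
    (S : Matrix ι ι ℝ) : Prop :=
  S.PosSemidef ∧
    S = Aᵀ * S * A - (Aᵀ * S * B) * (R + Bᵀ * S * B)⁻¹ * (Aᵀ * S * B)ᵀ + Q

open Classical in
/-- The positive semidefinite solution of the Riccati equation (it exists and is unique when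
`(A, B)` is stabilizable and `Q`, `R` are positive definite). -/
def dare (A : Matrix ι ι ℝ) (B : Matrix ι υ ℝ) (Q : Matrix ι ι ℝ) (R : Matrix υ υ ℝ) :
    Matrix ι ι ℝ :=
  if h : ∃ S, IsDARE A B Q R S then h.choose else 0

/-- The Riccati matrix `S(θ)`. -/
def riccati (Q : Matrix ι ι ℝ) (R : Matrix υ υ ℝ) (θ : Param ι υ) : Matrix ι ι ℝ :=
  dare θ.A θ.B Q R

/-- The optimal gain `L(θ) = -(Bᵀ S B + R)⁻¹ Bᵀ S A` with `S = S(θ)`. -/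
def gain (Q : Matrix ι ι ℝ) (R : Matrix υ υ ℝ) (θ : Param ι υ) : Matrix υ ι ℝ :=
  -((θ.Bᵀ * riccati Q R θ * θ.B + R)⁻¹ * (θ.Bᵀ * riccati Q R θ * θ.A))

/-- The quadratic form `vᵀ S v`. -/
def quad {α : Type} [Fintype α] (S : Matrix α α ℝ) (v : α → ℝ) : ℝ := v ⬝ᵥ (S *ᵥ v)

/-- The columns of `θ` are independent, the `ℓ`-th with law `𝒩(μ ℓ, Σ)`, and the resulting law of
`θ` is conditioned on (restricted to and renormalised on) `Θ`. -/
def truncGaussian (μ : ι → EuclideanSpace ℝ (ι ⊕ υ)) (cov : Matrix (ι ⊕ υ) (ι ⊕ υ) ℝ)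
    (Θ : Set (Param ι υ)) : Measure (Param ι υ) :=
  ProbabilityTheory.cond
    ((Measure.pi fun ℓ => multivariateGaussian (μ ℓ) cov).map
      fun c => (Matrix.of fun r ℓ => c ℓ r : Param ι υ)) Θ

open scoped Matrix.Norms.L2Operator in
/-- Every `θ ∈ Θ` is controlled by the optimal gain of every `φ ∈ Θ` with closed-loop induced
norm at most `δ`. -/
def UniformlyStable (Q : Matrix ι ι ℝ) (R : Matrix υ υ ℝ) (Θ : Set (Param ι υ)) (δ : ℝ) : Prop :=
  ∀ θ ∈ Θ, ∀ φ ∈ Θ, ‖θ.A + θ.B * gain Q R φ‖ ≤ δ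

end LQ

/-! ### Covariance recursion and episodes of an actor -/

/-- The covariance recursion `Σ_{t+1}⁻¹ = Σ_t⁻¹ + s⁻¹ z_t z_tᵀ`, `t ≥ 1`, started from `Σ_1`, where
the regressor `z_t` may be chosen in terms of `Σ_t` (the value at time `0` is not used). -/
def covSeq {α : Type} [Fintype α] [DecidableEq α] (cov₁ : Matrix α α ℝ) (s : ℝ)
    (z : ℕ → Matrix α α ℝ → α → ℝ) : ℕ → Matrix α α ℝ
  | 0 => cov₁
  | 1 => cov₁
  | t + 2 =>
    let S := covSeq cov₁ s z (t + 1)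
    (S⁻¹ + (1 / s) • Matrix.vecMulVec (z (t + 1) S) (z (t + 1) S))⁻¹

/-- The episode variables of an actor: the current episode number `k`, its starting time `t_k`,
and the length `T_{k-1}` of the previous episode. -/
structure Episode where
  k : ℕ
  start : ℕ
  prevLen : ℕ

open Classical in
/-- The episode variables in force at time `t` when `d t` is the determinant of the covariance at
time `t`. Initially `k = 0`, `t_0 = 0`, `T_{-1} = 0`; at each time `t ≥ 1` a new episode starts if
`t - t_k > T_{k-1}` or the determinant has fallen below half its value at time `t_k`. -/
def episode (d : ℕ → ℝ) : ℕ → Episode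
  | 0 => ⟨0, 0, 0⟩
  | t + 1 =>
    let e := episode d t
    if t + 1 - e.start > e.prevLen ∨ d (t + 1) < (1 / 2) * d e.start then
      ⟨e.k + 1, t + 1, t + 1 - e.start⟩
    else e

/-- The number `K_T` of episodes up to the horizon `T`. -/
def numEpisodes (d : ℕ → ℝ) (T : ℕ) : ℕ := (episode d T).k

/-- The starting time `t_k` of episode `k`, set to `T + 1` for `k > K_T`. -/
def epStart (d : ℕ → ℝ) (T k : ℕ) : ℕ :=
  if k ≤ numEpisodes d T then sInf {t | (episode d t).k = k} else T + 1

/-! ### The mean-field team -/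

/-- The data of a learning problem with `M` types, `n` agents of each type, state dimension `dx`
and control dimension `du`: costs, noise levels, initial covariances, parameter sets, priors, the
stability margin, and the rule that picks a maximiser from a vector of scores of agents. -/
structure Team (M n dx du : ℕ) where
  Q : Fin M → Matrix (Fin dx) (Fin dx) ℝ
  R : Fin M → Matrix (Fin du) (Fin du) ℝ
  Qbar : Matrix (Fin M × Fin dx) (Fin M × Fin dx) ℝ
  Rbar : Matrix (Fin M × Fin du) (Fin M × Fin du) ℝ
  σw : ℝ
  σv : ℝ
  σv0 : ℝ
  initCov : Fin M → Fin n → Matrix (Fin dx) (Fin dx) ℝ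
  relSet : Fin M → Set (Param (Fin dx) (Fin du))
  mfSet : Set (Param (Fin M × Fin dx) (Fin M × Fin du))
  relMean : Fin M → Fin dx → EuclideanSpace ℝ (Fin dx ⊕ Fin du)
  relCov : Fin M → Matrix (Fin dx ⊕ Fin du) (Fin dx ⊕ Fin du) ℝ
  mfMean : Fin M × Fin dx →
    EuclideanSpace ℝ ((Fin M × Fin dx) ⊕ (Fin M × Fin du))
  mfCov : Matrix ((Fin M × Fin dx) ⊕ (Fin M × Fin du)) ((Fin M × Fin dx) ⊕ (Fin M × Fin du)) ℝ
  δ : ℝ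
  argmax : (Fin n → ℝ) → Fin n

/-- The block matrix `diag(A¹, …, A^M) + rows(D¹, …, D^M)`. -/
def diagAddRows {M a b : ℕ} (A : Fin M → Matrix (Fin a) (Fin b) ℝ)
    (D : Fin M → Matrix (Fin a) (Fin M × Fin b) ℝ) : Matrix (Fin M × Fin a) (Fin M × Fin b) ℝ :=
  Matrix.of fun p q => (if p.1 = q.1 then A p.1 p.2 q.2 else 0) + D p.1 p.2 q

/-- The block-diagonal matrix `diag(A¹, …, A^M)`. -/
def blockDiag {M a : ℕ} (A : Fin M → Matrix (Fin a) (Fin a) ℝ) :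
    Matrix (Fin M × Fin a) (Fin M × Fin a) ℝ :=
  Matrix.of fun p q => if p.1 = q.1 then A p.1 p.2 q.2 else 0

namespace Team

variable {M n dx du : ℕ} (𝒯 : Team M n dx du)

/-- The state cost `diag(Q¹, …, Q^M) + Q̄` of the mean-field system. -/
def mfQ : Matrix (Fin M × Fin dx) (Fin M × Fin dx) ℝ := blockDiag 𝒯.Q + 𝒯.Qbar

/-- The control cost `diag(R¹, …, R^M) + R̄` of the mean-field system. -/
def mfR : Matrix (Fin M × Fin du) (Fin M × Fin du) ℝ := blockDiag 𝒯.R + 𝒯.Rbar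

/-- The noise variance `(1 - 1/n) σ_w²` of the relative systems. -/
def relVar : ℝ := (1 - 1 / (n : ℝ)) * 𝒯.σw ^ 2

/-- The noise variance `σ_w²/n + σ_v² + σ_{v⁰}²` of the mean-field system. -/
def mfVar : ℝ := 𝒯.σw ^ 2 / (n : ℝ) + 𝒯.σv ^ 2 + 𝒯.σv0 ^ 2

/-- `S^m(θ)` for the relative system of type `m`. -/
def relS (m : Fin M) (θ : Param (Fin dx) (Fin du)) : Matrix (Fin dx) (Fin dx) ℝ :=
  riccati (𝒯.Q m) (𝒯.R m) θ

/-- `L^m(θ)` for the relative system of type `m`. -/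
def relL (m : Fin M) (θ : Param (Fin dx) (Fin du)) : Matrix (Fin du) (Fin dx) ℝ :=
  gain (𝒯.Q m) (𝒯.R m) θ

/-- The gain of the mean-field system. -/
def mfL (θ : Param (Fin M × Fin dx) (Fin M × Fin du)) :
    Matrix (Fin M × Fin du) (Fin M × Fin dx) ℝ :=
  gain 𝒯.mfQ 𝒯.mfR θ

/-- The optimal performance of the relative system of type `m` with parameter `θ`. -/
def relJ (m : Fin M) (θ : Param (Fin dx) (Fin du)) : ℝ := 𝒯.relVar * (𝒯.relS m θ).trace

/-- The standing assumptions on the data. -/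
structure Assumptions : Prop where
  Q_posDef : ∀ m, (𝒯.Q m).PosDef
  R_posDef : ∀ m, (𝒯.R m).PosDef
  mfQ_posDef : 𝒯.mfQ.PosDef
  mfR_posDef : 𝒯.mfR.PosDef
  rel_stabilizable : ∀ m, ∀ θ ∈ 𝒯.relSet m, Stabilizable θ.A θ.B
  mf_stabilizable : ∀ θ ∈ 𝒯.mfSet, Stabilizable θ.A θ.B
  relSet_compact : ∀ m, IsCompact (𝒯.relSet m)
  mfSet_compact : IsCompact 𝒯.mfSet
  relCov_posDef : ∀ m, (𝒯.relCov m).PosDef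
  mfCov_posDef : 𝒯.mfCov.PosDef
  δ_pos : 0 < 𝒯.δ
  δ_lt_one : 𝒯.δ < 1
  rel_stable : ∀ m, UniformlyStable (𝒯.Q m) (𝒯.R m) (𝒯.relSet m) 𝒯.δ
  mf_stable : UniformlyStable 𝒯.mfQ 𝒯.mfR 𝒯.mfSet 𝒯.δ
  σw_pos : 0 < 𝒯.σw
  σv_nonneg : 0 ≤ 𝒯.σv
  σv0_nonneg : 0 ≤ 𝒯.σv0
  initCov_posSemidef : ∀ m i, (𝒯.initCov m i).PosSemidef
  argmax_spec : ∀ (s : Fin n → ℝ) (i : Fin n), s i ≤ s (𝒯.argmax s)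
  argmax_measurable : Measurable 𝒯.argmax

open scoped Matrix.Norms.L2Operator in
/-- The constants on which hidden factors may depend, for type `m`: `κ` bounds, uniformly over the
parameter set, the norms of `θ`, `S(θ)` and `[I; L(θ)]` and the trace of `S(θ)`; it also bounds
`1 / (1 - δ)`, the inverse of the state cost, the prior covariance and its inverse, and the initial
covariances of the agents relative to the variance of their noise. -/
structure BoundedBy (m : Fin M) (κ : ℝ) : Prop where
  one_le : 1 ≤ κ
  norm_param : ∀ θ ∈ 𝒯.relSet m, ‖θ‖ ≤ κ
  norm_S : ∀ θ ∈ 𝒯.relSet m, ‖𝒯.relS m θ‖ ≤ κ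
  trace_S : ∀ θ ∈ 𝒯.relSet m, (𝒯.relS m θ).trace ≤ κ
  norm_L : ∀ θ ∈ 𝒯.relSet m, ‖Matrix.fromRows (1 : Matrix (Fin dx) (Fin dx) ℝ) (𝒯.relL m θ)‖ ≤ κ
  margin : 1 / (1 - 𝒯.δ) ≤ κ
  Q_lower : (𝒯.Q m - κ⁻¹ • (1 : Matrix (Fin dx) (Fin dx) ℝ)).PosSemidef
  cov_lower : (𝒯.relCov m - κ⁻¹ • (1 : Matrix _ _ ℝ)).PosSemidef
  cov_upper : (κ • (1 : Matrix _ _ ℝ) - 𝒯.relCov m).PosSemidef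
  initCov_upper : ∀ i,
    ((κ * 𝒯.σw ^ 2) • (1 : Matrix (Fin dx) (Fin dx) ℝ) - 𝒯.initCov m i).PosSemidef

end Team

/-! ### Runs of the Thompson sampling algorithm -/

/-- The random variables of a run: true parameters, initial states, noises, posterior samples,
states and controls. The posterior samples `relSample m t` and `mfSample t` are those that would be
drawn at time `t`; they are used only if an episode of that actor starts at time `t`. Time starts
at `1`. -/
structure Run (M n dx du : ℕ) (Ω : Type*) where
  A : Fin M → Ω → Matrix (Fin dx) (Fin dx) ℝ
  B : Fin M → Ω → Matrix (Fin dx) (Fin du) ℝ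
  D : Fin M → Ω → Matrix (Fin dx) (Fin M × Fin dx) ℝ
  E : Fin M → Ω → Matrix (Fin dx) (Fin M × Fin du) ℝ
  x₁ : Fin M → Fin n → Ω → EuclideanSpace ℝ (Fin dx)
  w : Fin M → Fin n → ℕ → Ω → EuclideanSpace ℝ (Fin dx)
  v : Fin M → ℕ → Ω → EuclideanSpace ℝ (Fin dx)
  v0 : ℕ → Ω → EuclideanSpace ℝ (Fin dx)
  relSample : Fin M → ℕ → Ω → Param (Fin dx) (Fin du)
  mfSample : ℕ → Ω → Param (Fin M × Fin dx) (Fin M × Fin du)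
  x : Fin M → Fin n → ℕ → Ω → Fin dx → ℝ
  u : Fin M → Fin n → ℕ → Ω → Fin du → ℝ

namespace Run

variable {M n dx du : ℕ} {Ω : Type*} (r : Run M n dx du Ω) (𝒯 : Team M n dx du)

/-- The true parameter of the relative system of type `m`. -/
def relParam (m : Fin M) (ω : Ω) : Param (Fin dx) (Fin du) := mkParam (r.A m ω) (r.B m ω)

/-- The true parameter of the mean-field system. -/
def mfParam (ω : Ω) : Param (Fin M × Fin dx) (Fin M × Fin du) :=
  mkParam (diagAddRows (fun m => r.A m ω) (fun m => r.D m ω))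
    (diagAddRows (fun m => r.B m ω) (fun m => r.E m ω))

/-- The mean-field of the states. -/
def xbar (t : ℕ) (ω : Ω) : Fin M × Fin dx → ℝ :=
  fun p => (1 / (n : ℝ)) * ∑ i, r.x p.1 i t ω p.2

/-- The mean-field of the controls. -/
def ubar (t : ℕ) (ω : Ω) : Fin M × Fin du → ℝ :=
  fun p => (1 / (n : ℝ)) * ∑ i, r.u p.1 i t ω p.2

/-- The mean-field regressor. -/
def zbar (t : ℕ) (ω : Ω) : (Fin M × Fin dx) ⊕ (Fin M × Fin du) → ℝ :=
  Sum.elim (r.xbar t ω) (r.ubar t ω)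

/-- The relative state of agent `i` of type `m`. -/
def xrel (m : Fin M) (i : Fin n) (t : ℕ) (ω : Ω) : Fin dx → ℝ :=
  fun a => r.x m i t ω a - r.xbar t ω (m, a)

/-- The relative control of agent `i` of type `m`. -/
def urel (m : Fin M) (i : Fin n) (t : ℕ) (ω : Ω) : Fin du → ℝ :=
  fun a => r.u m i t ω a - r.ubar t ω (m, a)

/-- The relative regressor of agent `i` of type `m`. -/
def zrel (m : Fin M) (i : Fin n) (t : ℕ) (ω : Ω) : Fin dx ⊕ Fin du → ℝ :=
  Sum.elim (r.xrel m i t ω) (r.urel m i t ω)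

/-- The agent of type `m` selected at time `t` when the covariance is `S`: it maximises
`zᵀ S z` over the relative regressors `z` of the agents of type `m`. -/
def select (m : Fin M) (t : ℕ) (S : Matrix (Fin dx ⊕ Fin du) (Fin dx ⊕ Fin du) ℝ) (ω : Ω) : Fin n :=
  𝒯.argmax fun i => quad S (r.zrel m i t ω)

/-- The covariances of relative actor `m`, updated with the regressor of the selected agent. -/
def relCovAt (m : Fin M) (ω : Ω) (t : ℕ) : Matrix (Fin dx ⊕ Fin du) (Fin dx ⊕ Fin du) ℝ :=
  covSeq (𝒯.relCov m) 𝒯.relVar (fun s S => r.zrel m (r.select 𝒯 m s S ω) s ω) t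

/-- The selected agent `j_t` of type `m`. -/
def j (m : Fin M) (t : ℕ) (ω : Ω) : Fin n := r.select 𝒯 m t (r.relCovAt 𝒯 m ω t) ω

/-- The covariances of the mean-field actor. -/
def mfCovAt (ω : Ω) (t : ℕ) :
    Matrix ((Fin M × Fin dx) ⊕ (Fin M × Fin du)) ((Fin M × Fin dx) ⊕ (Fin M × Fin du)) ℝ :=
  covSeq 𝒯.mfCov 𝒯.mfVar (fun s _ => r.zbar s ω) t

/-- The determinants of the covariances of relative actor `m`. -/
def relDet (m : Fin M) (ω : Ω) (t : ℕ) : ℝ := (r.relCovAt 𝒯 m ω t).det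

/-- The determinants of the covariances of the mean-field actor. -/
def mfDet (ω : Ω) (t : ℕ) : ℝ := (r.mfCovAt 𝒯 ω t).det

/-- The data `{x̆_s^{j_s}, ŭ_s^{j_s}, x̆_{s+1}^{j_s}}_{1 ≤ s < t}` of relative actor `m`. -/
@[reducible] def relInfo (m : Fin M) (t : ℕ) : MeasurableSpace Ω :=
  ⨆ s ∈ Set.Ico 1 t,
    MeasurableSpace.comap (fun ω => (r.xrel m (r.j 𝒯 m s ω) s ω, r.urel m (r.j 𝒯 m s ω) s ω,
      r.xrel m (r.j 𝒯 m s ω) (s + 1) ω)) inferInstance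

/-- The data `x̄_{1:t}, ū_{1:t-1}` of the mean-field actor. -/
@[reducible] def mfInfo (t : ℕ) : MeasurableSpace Ω :=
  (⨆ s ∈ Set.Icc 1 t, MeasurableSpace.comap (r.xbar s) inferInstance) ⊔
    ⨆ s ∈ Set.Ico 1 t, MeasurableSpace.comap (r.ubar s) inferInstance

/-- All the true parameters. -/
def params (ω : Ω) :=
  ((fun m => r.A m ω), (fun m => r.B m ω), (fun m => r.D m ω), (fun m => r.E m ω))

/-- The initial states and all the noises, as one family of random vectors. -/
def noise : (Fin M × Fin n) ⊕ (Fin M × Fin n × ℕ) ⊕ (Fin M × ℕ) ⊕ ℕ → Ω →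
    EuclideanSpace ℝ (Fin dx)
  | .inl p => r.x₁ p.1 p.2
  | .inr (.inl p) => r.w p.1 p.2.1 p.2.2
  | .inr (.inr (.inl p)) => r.v p.1 p.2
  | .inr (.inr (.inr t)) => r.v0 t

/-- The parameters, the initial states and the noises of all times. -/
@[reducible] def primitives : MeasurableSpace Ω :=
  MeasurableSpace.comap r.params inferInstance ⊔
    ⨆ s, MeasurableSpace.comap (r.noise s) inferInstance

/-- Everything except the sample of relative actor `m` at time `t` and the samples after `t`. -/
@[reducible] def relPast (m : Fin M) (t : ℕ) : MeasurableSpace Ω :=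
  r.primitives ⊔
    (⨆ p ∈ {p : Fin M × ℕ | p.2 ≤ t ∧ p ≠ (m, t)},
      MeasurableSpace.comap (r.relSample p.1 p.2) inferInstance) ⊔
    ⨆ s ∈ Set.Iic t, MeasurableSpace.comap (r.mfSample s) inferInstance

/-- Everything except the sample of the mean-field actor at time `t` and the samples after `t`. -/
@[reducible] def mfPast (t : ℕ) : MeasurableSpace Ω :=
  r.primitives ⊔
    (⨆ p ∈ {p : Fin M × ℕ | p.2 ≤ t},
      MeasurableSpace.comap (r.relSample p.1 p.2) inferInstance) ⊔
    ⨆ s ∈ Set.Iio t, MeasurableSpace.comap (r.mfSample s) inferInstance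

/-- The sample of relative actor `m` in force at time `t`. -/
def relCurrent (m : Fin M) (t : ℕ) (ω : Ω) : Param (Fin dx) (Fin du) :=
  r.relSample m (episode (r.relDet 𝒯 m ω) t).start ω

/-- The sample of the mean-field actor in force at time `t`. -/
def mfCurrent (t : ℕ) (ω : Ω) : Param (Fin M × Fin dx) (Fin M × Fin du) :=
  r.mfSample (episode (r.mfDet 𝒯 ω) t).start ω

/-- `r` is a run of the mean-field team under the Thompson sampling algorithm with dynamic
episodes. -/
structure IsTSDEMF [MeasurableSpace Ω] (P : Measure Ω) : Prop where
  params_measurable : Measurable r.params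
  noise_measurable : ∀ s, Measurable (r.noise s)
  relSample_measurable : ∀ m t, Measurable (r.relSample m t)
  mfSample_measurable : ∀ t, Measurable (r.mfSample t)
  x_measurable : ∀ m i t, Measurable (r.x m i t)
  u_measurable : ∀ m i t, Measurable (r.u m i t)
  -- priors
  relPrior : ∀ m, P.map (r.relParam m) =
    truncGaussian (𝒯.relMean m) (𝒯.relCov m) (𝒯.relSet m)
  mfPrior : P.map r.mfParam = truncGaussian 𝒯.mfMean 𝒯.mfCov 𝒯.mfSet
  -- initial states and noises
  law_x₁ : ∀ m i, P.map (r.x₁ m i) = multivariateGaussian 0 (𝒯.initCov m i)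
  law_w : ∀ m i t, P.map (r.w m i t) = multivariateGaussian 0 (𝒯.σw ^ 2 • 1)
  law_v : ∀ m t, P.map (r.v m t) = multivariateGaussian 0 (𝒯.σv ^ 2 • 1)
  law_v0 : ∀ t, P.map (r.v0 t) = multivariateGaussian 0 (𝒯.σv0 ^ 2 • 1)
  noise_indep : iIndepFun r.noise P
  params_indep : IndepFun r.params (fun ω s => r.noise s ω) P
  -- dynamics
  init : ∀ m i ω, r.x m i 1 ω = (r.x₁ m i ω).ofLp
  dynamics : ∀ m i t ω, 1 ≤ t →
    r.x m i (t + 1) ω = r.A m ω *ᵥ r.x m i t ω + r.B m ω *ᵥ r.u m i t ω +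
      r.D m ω *ᵥ r.xbar t ω + r.E m ω *ᵥ r.ubar t ω +
      (r.w m i t ω).ofLp + (r.v m t ω).ofLp + (r.v0 t ω).ofLp
  -- controls: mean-field part plus relative part
  control : ∀ m i t ω, 1 ≤ t →
    r.u m i t ω = (fun a => (𝒯.mfL (r.mfCurrent 𝒯 t ω) *ᵥ r.xbar t ω) (m, a)) +
      𝒯.relL m (r.relCurrent 𝒯 m t ω) *ᵥ r.xrel m i t ω
  -- samples are drawn from the posteriors, with fresh randomness
  relSampling : ∀ m t, 1 ≤ t → ∀ S : Set (Param (Fin dx) (Fin du)), MeasurableSet S →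
    P⟦r.relSample m t ⁻¹' S | r.relPast m t⟧ =ᵐ[P] P⟦r.relParam m ⁻¹' S | r.relInfo 𝒯 m t⟧
  mfSampling : ∀ t, 1 ≤ t → ∀ S : Set (Param (Fin M × Fin dx) (Fin M × Fin du)),
    MeasurableSet S →
    P⟦r.mfSample t ⁻¹' S | r.mfPast t⟧ =ᵐ[P] P⟦r.mfParam ⁻¹' S | r.mfInfo t⟧

/-! ### Regret of a relative system -/

/-- The per-step cost of the relative system of agent `i` of type `m`. -/
def relCost (m : Fin M) (i : Fin n) (t : ℕ) (ω : Ω) : ℝ :=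
  quad (𝒯.Q m) (r.xrel m i t ω) + quad (𝒯.R m) (r.urel m i t ω)

/-- The starting time `t_k` of episode `k` of relative actor `m` (with horizon `T`). -/
def tk (m : Fin M) (T k : ℕ) (ω : Ω) : ℕ := epStart (r.relDet 𝒯 m ω) T k

/-- The number `K_T` of episodes of relative actor `m` up to the horizon. -/
def K (m : Fin M) (T : ℕ) (ω : Ω) : ℕ := numEpisodes (r.relDet 𝒯 m ω) T

/-- The sample `θ_k` of relative actor `m` drawn at the start of episode `k`. -/
def θk (m : Fin M) (T k : ℕ) (ω : Ω) : Param (Fin dx) (Fin du) :=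
  r.relSample m (r.tk 𝒯 m T k ω) ω

/-- The pathwise regret of the relative system of agent `i` of type `m`. -/
def regretPath (m : Fin M) (i : Fin n) (T : ℕ) (ω : Ω) : ℝ :=
  ∑ t ∈ Finset.Icc 1 T, r.relCost 𝒯 m i t ω - T * 𝒯.relJ m (r.relParam m ω)

/-- Pathwise sampling error. -/
def regretPath₀ (m : Fin M) (T : ℕ) (ω : Ω) : ℝ :=
  ∑ k ∈ Finset.Icc 1 (r.K 𝒯 m T ω),
      ((r.tk 𝒯 m T (k + 1) ω : ℝ) - r.tk 𝒯 m T k ω) * 𝒯.relJ m (r.θk 𝒯 m T k ω) -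
    T * 𝒯.relJ m (r.relParam m ω)

/-- Pathwise effect of the time-varying controller. -/
def regretPath₁ (m : Fin M) (i : Fin n) (T : ℕ) (ω : Ω) : ℝ :=
  ∑ k ∈ Finset.Icc 1 (r.K 𝒯 m T ω),
    ∑ t ∈ Finset.Ico (r.tk 𝒯 m T k ω) (r.tk 𝒯 m T (k + 1) ω),
      (quad (𝒯.relS m (r.θk 𝒯 m T k ω)) (r.xrel m i t ω) -
        quad (𝒯.relS m (r.θk 𝒯 m T k ω)) (r.xrel m i (t + 1) ω))

/-- Pathwise model mismatch. -/
def regretPath₂ (m : Fin M) (i : Fin n) (T : ℕ) (ω : Ω) : ℝ :=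
  ∑ k ∈ Finset.Icc 1 (r.K 𝒯 m T ω),
    ∑ t ∈ Finset.Ico (r.tk 𝒯 m T k ω) (r.tk 𝒯 m T (k + 1) ω),
      (quad (𝒯.relS m (r.θk 𝒯 m T k ω)) ((r.relParam m ω)ᵀ *ᵥ r.zrel m i t ω) -
        quad (𝒯.relS m (r.θk 𝒯 m T k ω)) ((r.θk 𝒯 m T k ω)ᵀ *ᵥ r.zrel m i t ω))

variable [MeasurableSpace Ω] (P : Measure Ω)

/-- The Bayesian regret of the relative system of agent `i` of type `m`. -/
def regret (m : Fin M) (i : Fin n) (T : ℕ) : ℝ := ∫ ω, r.regretPath 𝒯 m i T ω ∂P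

/-- Regret due to sampling error. -/
def regret₀ (m : Fin M) (T : ℕ) : ℝ := ∫ ω, r.regretPath₀ 𝒯 m T ω ∂P

/-- Regret due to the time-varying controller. -/
def regret₁ (m : Fin M) (i : Fin n) (T : ℕ) : ℝ := ∫ ω, r.regretPath₁ 𝒯 m i T ω ∂P

/-- Regret due to model mismatch. -/
def regret₂ (m : Fin M) (i : Fin n) (T : ℕ) : ℝ := ∫ ω, r.regretPath₂ 𝒯 m i T ω ∂P

end Run

/-- The logarithmic factor hidden by `Õ`, before it is raised to a power. -/
def logFactor (T n : ℕ) : ℝ := 1 + Real.log T + Real.log (1 + Real.log n)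

end MeanFieldTeam

end

/-!
Fix a type `m` of agents, write `s` for `𝒯.relVar`, and let `θ_t`, `S_t` denote the sample in force
at time `t` and its Riccati matrix. The relative systems of the agents of type `m` form closed
linear systems `x⁺ = θᵀ z + w` driven by centred Gaussian noises of variance `s`
(`IsTSDEMF.xrel_succ`, `IsTSDEMF.map_dotProduct_wrel`); the mean-field does not enter.

*Decomposition.* The Bellman equation of the sampled model (`IsDARE.quad_closedLoop`) writes the
cost of a step as `xᵀ S_t x - (θ_tᵀ z)ᵀ S_t (θ_tᵀ z)`. Adding and subtracting the predicted and the
actual next state gives the three regret terms and the remainder `2 wᵀ S_t θᵀ z + wᵀ S_t w - s tr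
S_t`, which has mean zero because the noise is independent of the past (`IsTSDEMF.regretPath_eq`,
`integral_noise_eq_zero`). Sums over episodes are turned into sums over time by `sum_episodes`.

*Episodes.* The length rule and the determinant rule together allow at most `3 √(T (1 + 2 D))`
episodes, where `D` is the logarithm of the total decrease of the determinant (`numEpisodes_le`).
The elliptical potential bounds `∑ min 1 (zᵀ Σ z / s)` by `2 D`, and `D` by `d_x + d_u` times a
logarithm (`IsCovSeq.sum_min_one_le`, `IsCovSeq.logDetGain_le`).

*Concentration.* All random fluctuations are controlled at once by a random level `b` whose third
moment is polylogarithmic (`IsTSDEMF.exists_pathBound`). It is made from exponential moments of the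
noises, which uniform stability carries over to the states, and from a self-normalised exponential
martingale (`expScore`) that measures the deviation of `θ` from the least squares estimate. No
posterior has to be computed: the prior on a compact set enters only through its support, and a
sample from the posterior has, jointly with the data, the same law as the true parameter
(`IsTSDEMF.map_prodMk_relSample`), so the exponential bound holds for the samples as well.

*The three terms.* The sampling error is, by the same exchange of the sample and the parameter, at
most the optimal performance times the number of episodes (`IsTSDEMF.regret₀_le`). The second sum
telescopes inside each episode and is at most the number of episodes times the largest cost-to-go.
In the third, the difference of the predictions under `θ` and `θ_t` is bounded by the
self-normalised errors times `zᵀ Σ z` at the start of the episode. This is at most twice its present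
value, which is dominated by the one of the selected agent; the elliptical potential and the
Cauchy–Schwarz inequality over time conclude (`PathBound.regretPath₂_le`).

For one agent, or in state dimension zero, all relative states vanish and so does everything else.
-/

set_option linter.unusedSectionVars false

namespace MeanFieldTeam

/-! ### Quadratic forms -/

section Quad

variable {α β : Type} [Fintype α] [Fintype β]

lemma quad_zero_vec (S : Matrix α α ℝ) : quad S 0 = 0 := by simp [quad]

lemma quad_zero_mat (v : α → ℝ) : quad (0 : Matrix α α ℝ) v = 0 := by simp [quad]

lemma quad_add_mat (S S' : Matrix α α ℝ) (v : α → ℝ) :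
    quad (S + S') v = quad S v + quad S' v := by
  simp [quad, add_mulVec, dotProduct_add]

lemma quad_sub_mat (S S' : Matrix α α ℝ) (v : α → ℝ) :
    quad (S - S') v = quad S v - quad S' v := by
  simp [quad, sub_mulVec, dotProduct_sub]

lemma quad_smul_mat (c : ℝ) (S : Matrix α α ℝ) (v : α → ℝ) :
    quad (c • S) v = c * quad S v := by
  simp [quad, smul_mulVec, dotProduct_smul]

lemma quad_one [DecidableEq α] (v : α → ℝ) : quad (1 : Matrix α α ℝ) v = v ⬝ᵥ v := by
  simp [quad]

lemma quad_smul_vec (c : ℝ) (S : Matrix α α ℝ) (v : α → ℝ) :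
    quad S (c • v) = c ^ 2 * quad S v := by
  simp [quad, mulVec_smul, dotProduct_smul]
  ring

lemma quad_vecMulVec (z v : α → ℝ) : quad (vecMulVec z z) v = (z ⬝ᵥ v) ^ 2 := by
  simp only [quad, vecMulVec_mulVec, dotProduct_smul]
  rw [dotProduct_comm v z]
  simp [sq]

lemma quad_congr (S : Matrix α α ℝ) (M : Matrix α β ℝ) (v : β → ℝ) :
    quad (Mᵀ * S * M) v = quad S (M *ᵥ v) := by
  simp only [quad, ← mulVec_mulVec, dotProduct_mulVec, vecMul_transpose]

lemma dotProduct_self_nonneg' (v : α → ℝ) : 0 ≤ v ⬝ᵥ v :=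
  Finset.sum_nonneg fun i _ => mul_self_nonneg (v i)

lemma quad_nonneg {S : Matrix α α ℝ} (hS : S.PosSemidef) (v : α → ℝ) : 0 ≤ quad S v := by
  simpa [quad] using hS.dotProduct_mulVec_nonneg v

lemma transpose_eq_of_posSemidef {S : Matrix α α ℝ} (hS : S.PosSemidef) : Sᵀ = S := by
  simpa [conjTranspose_eq_transpose_of_trivial] using hS.isHermitian.eq

lemma posSemidef_of_quad {S : Matrix α α ℝ} (hs : Sᵀ = S) (h : ∀ v, 0 ≤ quad S v) :
    S.PosSemidef := by
  refine Matrix.PosSemidef.of_dotProduct_mulVec_nonneg ?_ ?_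
  · rw [Matrix.IsHermitian, conjTranspose_eq_transpose_of_trivial, hs]
  · intro v; simpa [quad] using h v

lemma dotProduct_mulVec_comm {S : Matrix α α ℝ} (hs : Sᵀ = S) (v w : α → ℝ) :
    v ⬝ᵥ (S *ᵥ w) = w ⬝ᵥ (S *ᵥ v) := by
  rw [dotProduct_mulVec, ← mulVec_transpose, hs, dotProduct_comm]

lemma quad_add_vec {S : Matrix α α ℝ} (hs : Sᵀ = S) (v w : α → ℝ) :
    quad S (v + w) = quad S v + 2 * (v ⬝ᵥ (S *ᵥ w)) + quad S w := by
  simp only [quad, mulVec_add, dotProduct_add, add_dotProduct]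
  rw [dotProduct_mulVec_comm hs w v]
  ring

lemma quad_sub_vec {S : Matrix α α ℝ} (hs : Sᵀ = S) (v w : α → ℝ) :
    quad S (v - w) = quad S v - 2 * (v ⬝ᵥ (S *ᵥ w)) + quad S w := by
  simp only [quad, mulVec_sub, dotProduct_sub, sub_dotProduct]
  rw [dotProduct_mulVec_comm hs w v]
  ring

/-- Cauchy–Schwarz for the form of a positive semidefinite matrix. -/
lemma dotProduct_mulVec_sq_le {S : Matrix α α ℝ} (hS : S.PosSemidef) (v w : α → ℝ) :
    (v ⬝ᵥ (S *ᵥ w)) ^ 2 ≤ quad S v * quad S w := by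
  have hs := transpose_eq_of_posSemidef hS
  have key : ∀ t : ℝ, 0 ≤ quad S w * (t * t) + (2 * (v ⬝ᵥ (S *ᵥ w))) * t + quad S v := by
    intro t
    have h := quad_nonneg hS (v + t • w)
    rw [quad_add_vec hs, quad_smul_vec, mulVec_smul, dotProduct_smul, smul_eq_mul] at h
    nlinarith
  have h := discrim_le_zero key
  unfold discrim at h
  nlinarith

lemma dotProduct_sq_le (v w : α → ℝ) : (v ⬝ᵥ w) ^ 2 ≤ (v ⬝ᵥ v) * (w ⬝ᵥ w) := by
  classical
  simpa [quad] using dotProduct_mulVec_sq_le (S := (1 : Matrix α α ℝ)) Matrix.PosSemidef.one v w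

/-- A difference of values of a positive semidefinite form. -/
lemma quad_sub_quad_sq_le {S : Matrix α α ℝ} (hS : S.PosSemidef) (v w : α → ℝ) :
    (quad S v - quad S w) ^ 2 ≤ quad S (v - w) * quad S (v + w) := by
  have hs := transpose_eq_of_posSemidef hS
  have h : quad S v - quad S w = (v - w) ⬝ᵥ (S *ᵥ (v + w)) := by
    simp only [quad, mulVec_add, dotProduct_add, sub_dotProduct]
    rw [dotProduct_mulVec_comm hs w v]; ring
  rw [h]
  exact dotProduct_mulVec_sq_le hS _ _

/-- A matrix is determined by the values of its form if it is symmetric. -/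
lemma eq_of_quad_eq {S S' : Matrix α α ℝ} (hs : Sᵀ = S) (hs' : S'ᵀ = S')
    (h : ∀ v, quad S v = quad S' v) : S = S' := by
  classical
  ext i j
  have h1 := h (Pi.single i 1 + Pi.single j 1)
  rw [quad_add_vec hs, quad_add_vec hs', h, h] at h1
  have h2 : ∀ T : Matrix α α ℝ,
      (Pi.single i (1:ℝ) : α → ℝ) ⬝ᵥ (T *ᵥ Pi.single j 1) = T i j := by
    intro T; simp
  rw [h2, h2] at h1
  linarith

open scoped Matrix.Norms.L2Operator in
lemma dotProduct_mulVec_self_le_of_norm_le [DecidableEq β] (A : Matrix α β ℝ) {c : ℝ}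
    (h : ‖A‖ ≤ c) (v : β → ℝ) : (A *ᵥ v) ⬝ᵥ (A *ᵥ v) ≤ c ^ 2 * (v ⬝ᵥ v) := by
  have h1 := Matrix.l2_opNorm_mulVec A (WithLp.toLp 2 v)
  have hn : ∀ {γ : Type} [Fintype γ] (x : EuclideanSpace ℝ γ), x.ofLp ⬝ᵥ x.ofLp = ‖x‖ ^ 2 := by
    intro γ _ x
    rw [EuclideanSpace.norm_sq_eq]
    simp [dotProduct, sq]
  have h2 : (A *ᵥ v) ⬝ᵥ (A *ᵥ v) = ‖(EuclideanSpace.equiv α ℝ).symm (A *ᵥ v)‖ ^ 2 :=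
    hn ((EuclideanSpace.equiv α ℝ).symm (A *ᵥ v))
  have h3 : v ⬝ᵥ v = ‖WithLp.toLp 2 v‖ ^ 2 := hn (WithLp.toLp 2 v)
  rw [h2, h3, ← mul_pow]
  exact pow_le_pow_left₀ (norm_nonneg _)
    (h1.trans (mul_le_mul_of_nonneg_right h (norm_nonneg _))) 2

open scoped Matrix.Norms.L2Operator in
lemma quad_le_of_norm_le [DecidableEq α] (S : Matrix α α ℝ) {c : ℝ}
    (h : ‖S‖ ≤ c) (v : α → ℝ) : quad S v ≤ c * (v ⬝ᵥ v) := by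
  have hc : 0 ≤ c := (norm_nonneg _).trans h
  have h1 := dotProduct_mulVec_self_le_of_norm_le S h v
  have h2 := dotProduct_sq_le v (S *ᵥ v)
  have hv := dotProduct_self_nonneg' v
  have h3 : (quad S v) ^ 2 ≤ (c * (v ⬝ᵥ v)) ^ 2 :=
    calc (quad S v) ^ 2 ≤ (v ⬝ᵥ v) * ((S *ᵥ v) ⬝ᵥ (S *ᵥ v)) := h2
      _ ≤ (v ⬝ᵥ v) * (c ^ 2 * (v ⬝ᵥ v)) := by gcongr
      _ = (c * (v ⬝ᵥ v)) ^ 2 := by ring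
  exact (le_abs_self _).trans (abs_le_of_sq_le_sq h3 (by positivity))

lemma quad_le_of_sub_posSemidef {S S' : Matrix α α ℝ} (h : (S - S').PosSemidef) (v : α → ℝ) :
    quad S' v ≤ quad S v := by
  have := quad_nonneg h v
  rw [quad_sub_mat] at this
  linarith

lemma continuous_quad (v : α → ℝ) : Continuous fun S : Matrix α α ℝ => quad S v := by
  unfold quad
  exact continuous_const.dotProduct (continuous_id.matrix_mulVec continuous_const)

lemma trace_eq_sum_quad [DecidableEq α] (S : Matrix α α ℝ) :
    S.trace = ∑ a, quad S (Pi.single a 1) := by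
  simp [Matrix.trace, quad]

end Quad

/-! ### The Riccati equation -/

section Riccati

variable {ι υ : Type} [Fintype ι] [DecidableEq ι] [Fintype υ] [DecidableEq υ]

/-- The right-hand side of the Riccati equation: one step of value iteration from the value
`xᵀ P x`. -/
noncomputable def ricStep (A : Matrix ι ι ℝ) (B : Matrix ι υ ℝ) (Q : Matrix ι ι ℝ)
    (R : Matrix υ υ ℝ) (P : Matrix ι ι ℝ) : Matrix ι ι ℝ :=
  Aᵀ * P * A - (Aᵀ * P * B) * (R + Bᵀ * P * B)⁻¹ * (Aᵀ * P * B)ᵀ + Q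

/-- The gain that attains the minimum in one step of value iteration. -/
noncomputable def optGain (A : Matrix ι ι ℝ) (B : Matrix ι υ ℝ)
    (R : Matrix υ υ ℝ) (P : Matrix ι ι ℝ) : Matrix υ ι ℝ :=
  -((Bᵀ * P * B + R)⁻¹ * (Bᵀ * P * A))

variable {A : Matrix ι ι ℝ} {B : Matrix ι υ ℝ} {Q : Matrix ι ι ℝ} {R : Matrix υ υ ℝ}
  {P : Matrix ι ι ℝ}

lemma posDef_inputWeight (hR : R.PosDef) (hP : P.PosSemidef) : (R + Bᵀ * P * B).PosDef := by
  refine hR.add_posSemidef ?_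
  have := hP.conjTranspose_mul_mul_same B
  rwa [conjTranspose_eq_transpose_of_trivial] at this

/-- Completing the square in the one-step cost. -/
lemma cost_eq_quad_ricStep (hR : R.PosDef) (hP : P.PosSemidef) (x : ι → ℝ) (u : υ → ℝ) :
    quad Q x + quad R u + quad P (A *ᵥ x + B *ᵥ u) =
      quad (ricStep A B Q R P) x +
        quad (R + Bᵀ * P * B) (u - optGain A B R P *ᵥ x) := by
  have hs := transpose_eq_of_posSemidef hP
  have hG := posDef_inputWeight (B := B) hR hP
  set G := R + Bᵀ * P * B with hGdef
  have hGs : Gᵀ = G := transpose_eq_of_posSemidef hG.posSemidef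
  have hGis : (G⁻¹)ᵀ = G⁻¹ := by rw [transpose_nonsing_inv, hGs]
  have hdet : IsUnit G.det := hG.det_pos.ne'.isUnit
  set N := Bᵀ * P * A with hN
  have hNt : Aᵀ * P * B = Nᵀ := by
    rw [hN]; simp [transpose_mul, hs, Matrix.mul_assoc]
  have hL : optGain A B R P = -(G⁻¹ * N) := by
    rw [optGain, add_comm]
  have h1 : quad (ricStep A B Q R P) x = quad P (A *ᵥ x) - quad G⁻¹ (N *ᵥ x) + quad Q x := by
    unfold ricStep
    rw [quad_add_mat, quad_sub_mat, quad_congr, hNt, transpose_transpose, ← hGdef, quad_congr]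
  have h2 : quad G (u - optGain A B R P *ᵥ x) =
      quad G u + 2 * (u ⬝ᵥ (N *ᵥ x)) + quad G⁻¹ (N *ᵥ x) := by
    have e : u - optGain A B R P *ᵥ x = u + G⁻¹ *ᵥ (N *ᵥ x) := by
      rw [hL, neg_mulVec, sub_neg_eq_add, mulVec_mulVec]
    have e2 : G *ᵥ (G⁻¹ *ᵥ (N *ᵥ x)) = N *ᵥ x := by
      rw [mulVec_mulVec, mul_nonsing_inv _ hdet, one_mulVec]
    rw [e, quad_add_vec hGs, e2]
    congr 1
    simp only [quad]
    rw [e2, dotProduct_comm]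
  have h3 : quad P (A *ᵥ x + B *ᵥ u) = quad P (A *ᵥ x) + 2 * (u ⬝ᵥ (N *ᵥ x)) +
      quad (Bᵀ * P * B) u := by
    rw [quad_add_vec hs, quad_congr, dotProduct_mulVec_comm hs]
    congr 3
    rw [hN, ← mulVec_mulVec, ← mulVec_mulVec, dotProduct_mulVec u, vecMul_transpose]
  have h4 : quad G u = quad R u + quad (Bᵀ * P * B) u := quad_add_mat _ _ _
  rw [h1, h2, h3, h4]
  ring

lemma quad_ricStep_le (hR : R.PosDef) (hP : P.PosSemidef) (x : ι → ℝ) (u : υ → ℝ) :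
    quad (ricStep A B Q R P) x ≤ quad Q x + quad R u + quad P (A *ᵥ x + B *ᵥ u) := by
  rw [cost_eq_quad_ricStep hR hP]
  have := quad_nonneg (posDef_inputWeight (B := B) hR hP).posSemidef (u - optGain A B R P *ᵥ x)
  linarith

lemma quad_ricStep_eq (hR : R.PosDef) (hP : P.PosSemidef) (x : ι → ℝ) :
    quad (ricStep A B Q R P) x = quad Q x + quad R (optGain A B R P *ᵥ x) +
      quad P (A *ᵥ x + B *ᵥ (optGain A B R P *ᵥ x)) := by
  rw [cost_eq_quad_ricStep hR hP, sub_self, quad_zero_vec, add_zero]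

lemma transpose_ricStep (hQ : Qᵀ = Q) (hR : R.PosDef) (hP : P.PosSemidef) :
    (ricStep A B Q R P)ᵀ = ricStep A B Q R P := by
  have hs := transpose_eq_of_posSemidef hP
  have hG := transpose_eq_of_posSemidef (posDef_inputWeight (B := B) hR hP).posSemidef
  unfold ricStep
  simp only [transpose_add, transpose_sub, transpose_mul, transpose_transpose, hs, hQ,
    transpose_nonsing_inv, Matrix.mul_assoc]
  simp only [transpose_add, transpose_mul, transpose_transpose, hs, Matrix.mul_assoc] at hG
  rw [hG]

lemma posSemidef_ricStep (hQ : Q.PosSemidef) (hR : R.PosDef) (hP : P.PosSemidef) :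
    (ricStep A B Q R P).PosSemidef := by
  refine posSemidef_of_quad (transpose_ricStep (transpose_eq_of_posSemidef hQ) hR hP) fun x => ?_
  rw [quad_ricStep_eq hR hP]
  have := quad_nonneg hQ x
  have := quad_nonneg hR.posSemidef (optGain A B R P *ᵥ x)
  have := quad_nonneg hP (A *ᵥ x + B *ᵥ (optGain A B R P *ᵥ x))
  positivity

lemma quad_ricStep_mono (hR : R.PosDef) (hP : P.PosSemidef) {P' : Matrix ι ι ℝ}
    (hP' : P'.PosSemidef) (h : ∀ x, quad P x ≤ quad P' x) (x : ι → ℝ) :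
    quad (ricStep A B Q R P) x ≤ quad (ricStep A B Q R P') x := by
  rw [quad_ricStep_eq hR hP' x]
  refine (quad_ricStep_le hR hP x (optGain A B R P' *ᵥ x)).trans ?_
  gcongr
  exact h _

/-- The bound on the value of a policy with a contracting closed loop. -/
lemma quad_ricStep_le_of_contraction (hR : R.PosDef) (hP : P.PosSemidef) {L : Matrix υ ι ℝ}
    {δ c : ℝ} (hδ : δ ^ 2 < 1)
    (hL : ∀ x, ((A + B * L) *ᵥ x) ⬝ᵥ ((A + B * L) *ᵥ x) ≤ δ ^ 2 * (x ⬝ᵥ x))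
    (hc : 0 ≤ c) (hcost : ∀ x, quad Q x + quad R (L *ᵥ x) ≤ c * (x ⬝ᵥ x))
    (h : ∀ x, quad P x ≤ c / (1 - δ ^ 2) * (x ⬝ᵥ x)) (x : ι → ℝ) :
    quad (ricStep A B Q R P) x ≤ c / (1 - δ ^ 2) * (x ⬝ᵥ x) := by
  have h1 := quad_ricStep_le (Q := Q) (A := A) (B := B) hR hP x (L *ᵥ x)
  have e : A *ᵥ x + B *ᵥ (L *ᵥ x) = (A + B * L) *ᵥ x := by
    rw [add_mulVec, mulVec_mulVec]
  rw [e] at h1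
  have h0 : 0 < 1 - δ ^ 2 := by linarith
  have h2 := h ((A + B * L) *ᵥ x)
  have h3 := mul_le_mul_of_nonneg_left (hL x) (div_nonneg hc h0.le)
  have h4 := hcost x
  have h5 : c * (x ⬝ᵥ x) + c / (1 - δ ^ 2) * (δ ^ 2 * (x ⬝ᵥ x)) =
      c / (1 - δ ^ 2) * (x ⬝ᵥ x) := by
    field_simp; ring
  linarith

lemma isDARE_iff : IsDARE A B Q R P ↔ P.PosSemidef ∧ P = ricStep A B Q R P := Iff.rfl

/-- Along the closed loop of a solution of the Riccati equation, the value decreases by the state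
cost, hence geometrically when the state cost is definite. -/
lemma IsDARE.quad_closedLoop (hR : R.PosDef) (hP : IsDARE A B Q R P) (x : ι → ℝ) :
    quad P x = quad Q x + quad R (optGain A B R P *ᵥ x) +
      quad P ((A + B * optGain A B R P) *ᵥ x) := by
  have h := quad_ricStep_eq (A := A) (B := B) (Q := Q) hR hP.1 x
  rw [← (isDARE_iff.1 hP).2] at h
  rw [h, add_mulVec, mulVec_mulVec]

end Riccati

section Quad

variable {α : Type} [Fintype α] [DecidableEq α]

open scoped Matrix.Norms.L2Operator in
lemma exists_quad_le (S : Matrix α α ℝ) : ∃ c, 0 ≤ c ∧ ∀ v, quad S v ≤ c * (v ⬝ᵥ v) :=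
  ⟨‖S‖, norm_nonneg _, fun v => quad_le_of_norm_le S le_rfl v⟩

lemma quad_inv_mulVec {S : Matrix α α ℝ} (hS : S.PosDef) (v : α → ℝ) :
    quad S (S⁻¹ *ᵥ v) = quad S⁻¹ v := by
  have hdet : IsUnit S.det := hS.det_pos.ne'.isUnit
  simp only [quad, mulVec_mulVec]
  rw [mul_nonsing_inv _ hdet, one_mulVec, dotProduct_comm]

lemma exists_le_quad {S : Matrix α α ℝ} (hS : S.PosDef) :
    ∃ c, 0 ≤ c ∧ ∀ v, v ⬝ᵥ v ≤ c * quad S v := by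
  obtain ⟨c, hc, h⟩ := exists_quad_le S⁻¹
  have hdet : IsUnit S.det := hS.det_pos.ne'.isUnit
  refine ⟨c, hc, fun v => ?_⟩
  have h1 := dotProduct_mulVec_sq_le hS.posSemidef v (S⁻¹ *ᵥ v)
  rw [quad_inv_mulVec hS, mulVec_mulVec, mul_nonsing_inv _ hdet, one_mulVec] at h1
  have h2 := h v
  have h3 := quad_nonneg hS.posSemidef v
  rcases (dotProduct_self_nonneg' v).eq_or_lt with h0 | h0
  · rw [← h0]; positivity
  · have h4 : (v ⬝ᵥ v) * (v ⬝ᵥ v) ≤ (c * quad S v) * (v ⬝ᵥ v) := by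
      nlinarith
    exact le_of_mul_le_mul_right h4 h0

lemma tendsto_matrix_of_tendsto_quad {P : ℕ → Matrix α α ℝ} (hs : ∀ k, (P k)ᵀ = P k)
    (h : ∀ v, ∃ l, Filter.Tendsto (fun k => quad (P k) v) Filter.atTop (nhds l)) :
    ∃ S, Filter.Tendsto P Filter.atTop (nhds S) := by
  choose l hl using h
  let e : α → α → ℝ := fun i => Pi.single i 1
  refine ⟨Matrix.of fun i j => (l (e i + e j) - l (e i) - l (e j)) / 2, ?_⟩
  refine tendsto_pi_nhds.2 fun i => tendsto_pi_nhds.2 fun j => ?_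
  have h1 : ∀ k, P k i j =
      (quad (P k) (e i + e j) - quad (P k) (e i) - quad (P k) (e j)) / 2 := by
    intro k
    rw [quad_add_vec (hs k)]
    simp [e]
    ring
  simp only [h1, of_apply]
  exact (((hl _).sub (hl _)).sub (hl _)).div_const 2

end Quad

section Riccati

/-! ### Existence and uniqueness for the Riccati equation -/

variable {ι υ : Type} [Fintype ι] [DecidableEq ι] [Fintype υ] [DecidableEq υ]
variable {A : Matrix ι ι ℝ} {B : Matrix ι υ ℝ} {Q : Matrix ι ι ℝ} {R : Matrix υ υ ℝ}
  {P P' : Matrix ι ι ℝ}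

/-- The difference `P - P'` of two solutions does not decrease, as a form, along the optimal closed
loop of `P'`. The state cost along that loop is summable, so the difference tends to zero along it.
-/
lemma IsDARE.quad_le (hQ : Q.PosDef) (hR : R.PosDef) (hP : IsDARE A B Q R P)
    (hP' : IsDARE A B Q R P') (x : ι → ℝ) : quad P x ≤ quad P' x := by
  set L := optGain A B R P'
  set N := A + B * L with hN
  have hle : ∀ x, quad P x - quad P' x ≤ quad P (N *ᵥ x) - quad P' (N *ᵥ x) := by
    intro x
    have h1 := quad_ricStep_le (A := A) (B := B) (Q := Q) hR hP.1 x (L *ᵥ x)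
    rw [← (isDARE_iff.1 hP).2] at h1
    have h2 := hP'.quad_closedLoop hR x
    have e : A *ᵥ x + B *ᵥ (L *ᵥ x) = N *ᵥ x := by
      rw [hN, add_mulVec, mulVec_mulVec]
    rw [e] at h1
    linarith
  have hiter : ∀ (k : ℕ) x,
      quad P x - quad P' x ≤ quad P ((N ^ k) *ᵥ x) - quad P' ((N ^ k) *ᵥ x) := by
    intro k
    induction k with
    | zero => intro x; simp
    | succ k ih =>
      intro x
      rw [pow_succ, ← mulVec_mulVec]
      exact (hle x).trans (ih _)
  have hsum : ∀ (K : ℕ) x, ∑ k ∈ Finset.range K, quad Q ((N ^ k) *ᵥ x) ≤ quad P' x := by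
    intro K
    induction K with
    | zero => intro x; simpa using quad_nonneg hP'.1 x
    | succ K ih =>
      intro x
      rw [Finset.sum_range_succ']
      have h2 := hP'.quad_closedLoop hR x
      have h3 := quad_nonneg hR.posSemidef (L *ᵥ x)
      have h4 := ih (N *ᵥ x)
      simp only [mulVec_mulVec, ← pow_succ] at h4
      rw [pow_zero, one_mulVec]
      linarith
  have hlim : Filter.Tendsto (fun k => quad Q ((N ^ k) *ᵥ x)) Filter.atTop (nhds 0) :=
    (summable_of_sum_range_le (fun k => quad_nonneg hQ.posSemidef _)
      (fun K => hsum K x)).tendsto_atTop_zero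
  obtain ⟨c, hc, hPc⟩ := exists_quad_le P
  obtain ⟨c', hc', hQc⟩ := exists_le_quad hQ
  have hbound : ∀ k, quad P x - quad P' x ≤ c * c' * quad Q ((N ^ k) *ᵥ x) := by
    intro k
    have h1 := hiter k x
    have h2 := hPc ((N ^ k) *ᵥ x)
    have h3 := mul_le_mul_of_nonneg_left (hQc ((N ^ k) *ᵥ x)) hc
    have h4 := quad_nonneg hP'.1 ((N ^ k) *ᵥ x)
    linarith
  have := ge_of_tendsto' (hlim.const_mul (c * c')) hbound
  linarith

/-- With definite costs, a positive semidefinite solution of the Riccati equation is unique, since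
its closed loop is stable. -/
lemma IsDARE.unique (hQ : Q.PosDef) (hR : R.PosDef) (hP : IsDARE A B Q R P)
    (hP' : IsDARE A B Q R P') : P = P' :=
  eq_of_quad_eq (transpose_eq_of_posSemidef hP.1) (transpose_eq_of_posSemidef hP'.1)
    fun x => le_antisymm (hP.quad_le hQ hR hP' x) (hP'.quad_le hQ hR hP x)

lemma tendsto_inv_of_det_ne_zero {α : Type} [Fintype α] [DecidableEq α] {f : ℕ → Matrix α α ℝ}
    {S : Matrix α α ℝ} (hf : Filter.Tendsto f Filter.atTop (nhds S)) (hS : S.det ≠ 0) :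
    Filter.Tendsto (fun k => (f k)⁻¹) Filter.atTop (nhds S⁻¹) := by
  simp only [Matrix.inv_def, Ring.inverse_eq_inv']
  refine Filter.Tendsto.smul ?_ ?_
  · exact (((continuous_id.matrix_det).tendsto S).comp hf).inv₀ hS
  · exact ((continuous_id.matrix_adjugate).tendsto S).comp hf

/-- Value iteration converges to a solution of the Riccati equation when some gain makes the closed
loop a contraction. -/
lemma exists_isDARE (hQ : Q.PosDef) (hR : R.PosDef) {L : Matrix υ ι ℝ} {δ : ℝ} (hδ : δ ^ 2 < 1)
    (hL : ∀ x, ((A + B * L) *ᵥ x) ⬝ᵥ ((A + B * L) *ᵥ x) ≤ δ ^ 2 * (x ⬝ᵥ x)) :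
    ∃ S, IsDARE A B Q R S := by
  let P : ℕ → Matrix ι ι ℝ := fun k => (ricStep A B Q R)^[k] 0
  have hstep : ∀ k, P (k + 1) = ricStep A B Q R (P k) := fun k =>
    Function.iterate_succ_apply' _ _ _
  have hpsd : ∀ k, (P k).PosSemidef := by
    intro k
    induction k with
    | zero => exact Matrix.PosSemidef.zero
    | succ k ih => rw [hstep]; exact posSemidef_ricStep hQ.posSemidef hR ih
  have hmono : ∀ k x, quad (P k) x ≤ quad (P (k + 1)) x := by
    intro k
    induction k with
    | zero =>
      intro x
      change quad 0 x ≤ _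
      rw [quad_zero_mat]
      exact quad_nonneg (hpsd 1) x
    | succ k ih =>
      intro x
      rw [hstep, hstep (k + 1)]
      exact quad_ricStep_mono hR (hpsd k) (hpsd (k + 1)) ih x
  obtain ⟨c₁, hc₁, h₁⟩ := exists_quad_le Q
  obtain ⟨c₂, hc₂, h₂⟩ := exists_quad_le (Lᵀ * R * L)
  have hcost : ∀ x, quad Q x + quad R (L *ᵥ x) ≤ (c₁ + c₂) * (x ⬝ᵥ x) := by
    intro x
    have h1 := h₁ x
    have h2 := h₂ x
    rw [quad_congr] at h2
    linarith
  have hbdd : ∀ k x, quad (P k) x ≤ (c₁ + c₂) / (1 - δ ^ 2) * (x ⬝ᵥ x) := by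
    intro k
    induction k with
    | zero =>
      intro x
      change quad 0 x ≤ _
      rw [quad_zero_mat]
      have := dotProduct_self_nonneg' x
      have : 0 < 1 - δ ^ 2 := by linarith
      positivity
    | succ k ih =>
      intro x
      rw [hstep]
      exact quad_ricStep_le_of_contraction hR (hpsd k) hδ hL (by positivity) hcost ih x
  obtain ⟨S, hS⟩ := tendsto_matrix_of_tendsto_quad
    (fun k => transpose_eq_of_posSemidef (hpsd k)) fun v =>
      ⟨_, tendsto_atTop_ciSup (monotone_nat_of_le_succ fun k => hmono k v)
        ⟨_, by rintro _ ⟨k, rfl⟩; exact hbdd k v⟩⟩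
  have hSpsd : S.PosSemidef := by
    refine posSemidef_of_quad ?_ fun v => ?_
    · refine tendsto_nhds_unique ((continuous_id.matrix_transpose.tendsto S).comp hS) ?_
      exact hS.congr fun k => (transpose_eq_of_posSemidef (hpsd k)).symm
    · exact ge_of_tendsto' (((continuous_quad v).tendsto S).comp hS) fun k =>
        quad_nonneg (hpsd k) v
  refine ⟨S, hSpsd, ?_⟩
  have hlim : Filter.Tendsto (fun k => ricStep A B Q R (P k)) Filter.atTop
      (nhds (ricStep A B Q R S)) := by
    unfold ricStep
    have c1 : Filter.Tendsto (fun k => Aᵀ * P k * A) Filter.atTop (nhds (Aᵀ * S * A)) :=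
      (((continuous_const.matrix_mul continuous_id).matrix_mul continuous_const).tendsto S).comp hS
    have c2 : Filter.Tendsto (fun k => Aᵀ * P k * B) Filter.atTop (nhds (Aᵀ * S * B)) :=
      (((continuous_const.matrix_mul continuous_id).matrix_mul continuous_const).tendsto S).comp hS
    have c3 : Filter.Tendsto (fun k => R + Bᵀ * P k * B) Filter.atTop
        (nhds (R + Bᵀ * S * B)) :=
      ((continuous_const.add ((continuous_const.matrix_mul continuous_id).matrix_mul
        continuous_const)).tendsto S).comp hS
    have c4 := tendsto_inv_of_det_ne_zero c3 (posDef_inputWeight (B := B) hR hSpsd).det_pos.ne'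
    have mulT : ∀ {a b c : Type} [Fintype a] [Fintype b] [Fintype c]
        {f : ℕ → Matrix a b ℝ} {g : ℕ → Matrix b c ℝ} {F : Matrix a b ℝ} {G : Matrix b c ℝ},
        Filter.Tendsto f Filter.atTop (nhds F) → Filter.Tendsto g Filter.atTop (nhds G) →
        Filter.Tendsto (fun k => f k * g k) Filter.atTop (nhds (F * G)) := by
      intro a b c _ _ _ f g F G hf hg
      exact ((continuous_fst.matrix_mul continuous_snd).tendsto (F, G)).comp (hf.prodMk_nhds hg)
    have c5 : Filter.Tendsto (fun k => (Aᵀ * P k * B)ᵀ) Filter.atTop (nhds (Aᵀ * S * B)ᵀ) :=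
      (continuous_id.matrix_transpose.tendsto _).comp c2
    exact (c1.sub (mulT (mulT c2 c4) c5)).add tendsto_const_nhds
  refine tendsto_nhds_unique ?_ hlim
  exact ((Filter.tendsto_add_atTop_iff_nat 1).2 hS).congr fun k => hstep k

end Riccati

section Norm

/-! ### Operator norms and uniform stability -/

variable {α β : Type} [Fintype α] [Fintype β] [DecidableEq β]

open scoped Matrix.Norms.L2Operator in
lemma norm_le_of_dotProduct_mulVec_self_le (A : Matrix α β ℝ) {c : ℝ} (hc : 0 ≤ c)
    (h : ∀ v, (A *ᵥ v) ⬝ᵥ (A *ᵥ v) ≤ c ^ 2 * (v ⬝ᵥ v)) : ‖A‖ ≤ c := by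
  rw [Matrix.l2_opNorm_def]
  refine ContinuousLinearMap.opNorm_le_bound _ hc fun x => ?_
  have hn : ∀ {γ : Type} [Fintype γ] (x : EuclideanSpace ℝ γ), x.ofLp ⬝ᵥ x.ofLp = ‖x‖ ^ 2 := by
    intro γ _ x
    rw [EuclideanSpace.norm_sq_eq]
    simp [dotProduct, sq]
  have h1 := h x.ofLp
  rw [hn x] at h1
  have h2 := hn (WithLp.toLp 2 (A *ᵥ x.ofLp))
  change (A *ᵥ x.ofLp) ⬝ᵥ (A *ᵥ x.ofLp) = _ at h2
  rw [h2, ← mul_pow] at h1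
  exact (le_abs_self _).trans (abs_le_of_sq_le_sq h1 (by positivity))

open scoped Matrix.Norms.L2Operator in
lemma norm_le_of_quad_le {S : Matrix β β ℝ} (hS : S.PosSemidef) {c : ℝ} (hc : 0 ≤ c)
    (h : ∀ v, quad S v ≤ c * (v ⬝ᵥ v)) : ‖S‖ ≤ c := by
  refine norm_le_of_dotProduct_mulVec_self_le S hc fun v => ?_
  have h1 := dotProduct_mulVec_sq_le hS (S *ᵥ v) v
  have h2 := h (S *ᵥ v)
  have h3 := h v
  have h4 := quad_nonneg hS v
  have h5 := dotProduct_self_nonneg' (S *ᵥ v)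
  have h6 := dotProduct_self_nonneg' v
  rcases h5.eq_or_lt with h0 | h0
  · rw [← h0]; positivity
  · have : ((S *ᵥ v) ⬝ᵥ (S *ᵥ v)) * ((S *ᵥ v) ⬝ᵥ (S *ᵥ v)) ≤
        (c ^ 2 * (v ⬝ᵥ v)) * ((S *ᵥ v) ⬝ᵥ (S *ᵥ v)) := by
      calc _ = ((S *ᵥ v) ⬝ᵥ (S *ᵥ v)) ^ 2 := by ring
        _ ≤ quad S (S *ᵥ v) * quad S v := h1
        _ ≤ (c * ((S *ᵥ v) ⬝ᵥ (S *ᵥ v))) * (c * (v ⬝ᵥ v)) := by gcongr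
        _ = _ := by ring
    exact le_of_mul_le_mul_right this h0

lemma posSemidef_smul_one_sub {S : Matrix β β ℝ} (hs : Sᵀ = S) {c : ℝ}
    (h : ∀ v, quad S v ≤ c * (v ⬝ᵥ v)) : (c • (1 : Matrix β β ℝ) - S).PosSemidef := by
  refine posSemidef_of_quad (by simp [hs]) fun v => ?_
  rw [quad_sub_mat, quad_smul_mat, quad_one]
  linarith [h v]

lemma posSemidef_sub_smul_one {S : Matrix β β ℝ} (hs : Sᵀ = S) {c : ℝ}
    (h : ∀ v, c * (v ⬝ᵥ v) ≤ quad S v) : (S - c • (1 : Matrix β β ℝ)).PosSemidef := by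
  refine posSemidef_of_quad (by simp [hs]) fun v => ?_
  rw [quad_sub_mat, quad_smul_mat, quad_one]
  linarith [h v]

end Norm

section Riccati

variable {ι υ : Type} [Fintype ι] [DecidableEq ι] [Fintype υ] [DecidableEq υ]
variable {Q : Matrix ι ι ℝ} {R : Matrix υ υ ℝ} {Θ : Set (Param ι υ)} {δ : ℝ}

lemma posSemidef_riccati (θ : Param ι υ) : (riccati Q R θ).PosSemidef := by
  unfold riccati dare
  split_ifs with h
  · exact h.choose_spec.1
  · exact Matrix.PosSemidef.zero

lemma isDARE_riccati_of_exists {θ : Param ι υ} (h : ∃ S, IsDARE θ.A θ.B Q R S) :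
    IsDARE θ.A θ.B Q R (riccati Q R θ) := by
  unfold riccati dare
  rw [dif_pos h]
  exact h.choose_spec

lemma gain_eq_optGain (θ : Param ι υ) : gain Q R θ = optGain θ.A θ.B R (riccati Q R θ) := rfl

lemma UniformlyStable.contraction (h : UniformlyStable Q R Θ δ) {θ φ : Param ι υ}
    (hθ : θ ∈ Θ) (hφ : φ ∈ Θ) (x : ι → ℝ) :
    ((θ.A + θ.B * gain Q R φ) *ᵥ x) ⬝ᵥ ((θ.A + θ.B * gain Q R φ) *ᵥ x) ≤ δ ^ 2 * (x ⬝ᵥ x) :=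
  dotProduct_mulVec_self_le_of_norm_le _ (h θ hθ φ hφ) x

lemma UniformlyStable.isDARE (h : UniformlyStable Q R Θ δ) (hQ : Q.PosDef) (hR : R.PosDef)
    (h0 : 0 < δ) (h1 : δ < 1) {θ : Param ι υ} (hθ : θ ∈ Θ) :
    IsDARE θ.A θ.B Q R (riccati Q R θ) :=
  isDARE_riccati_of_exists (exists_isDARE hQ hR (by nlinarith) (h.contraction hθ hθ))

open scoped Matrix.Norms.L2Operator in
/-- On the parameter set the Riccati matrices are bounded, by the cost of one fixed gain. -/
lemma UniformlyStable.exists_norm_riccati_le (h : UniformlyStable Q R Θ δ) (hQ : Q.PosDef)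
    (hR : R.PosDef) (h0 : 0 < δ) (h1 : δ < 1) :
    ∃ c, 0 ≤ c ∧ ∀ θ ∈ Θ, ‖riccati Q R θ‖ ≤ c := by
  rcases Θ.eq_empty_or_nonempty with rfl | ⟨φ, hφ⟩
  · exact ⟨0, le_rfl, by simp⟩
  obtain ⟨c₁, hc₁, h₁⟩ := exists_quad_le Q
  obtain ⟨c₂, hc₂, h₂⟩ := exists_quad_le ((gain Q R φ)ᵀ * R * gain Q R φ)
  have hδ : 0 < 1 - δ ^ 2 := by nlinarith
  refine ⟨(c₁ + c₂) / (1 - δ ^ 2), by positivity, fun θ hθ => ?_⟩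
  have hS := h.isDARE hQ hR h0 h1 hθ
  set S := riccati Q R θ
  have key : ‖S‖ ≤ c₁ + c₂ + ‖S‖ * δ ^ 2 := by
    refine norm_le_of_quad_le hS.1 (by positivity) fun x => ?_
    have h3 := quad_ricStep_le (A := θ.A) (B := θ.B) (Q := Q) hR hS.1 x (gain Q R φ *ᵥ x)
    rw [← (isDARE_iff.1 hS).2, mulVec_mulVec, ← add_mulVec] at h3
    have h4 := h₁ x
    have h5 := h₂ x
    rw [quad_congr] at h5
    have h6 := quad_le_of_norm_le S le_rfl ((θ.A + θ.B * gain Q R φ) *ᵥ x)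
    have h7 := mul_le_mul_of_nonneg_left (h.contraction hθ hφ x) (norm_nonneg S)
    linarith
  rw [le_div_iff₀ hδ]
  linarith

open scoped Matrix.Norms.L2Operator in
lemma UniformlyStable.exists_norm_fromRows_gain_le (h : UniformlyStable Q R Θ δ) (hQ : Q.PosDef)
    (hR : R.PosDef) (h0 : 0 < δ) (h1 : δ < 1) :
    ∃ c, ∀ θ ∈ Θ, ‖Matrix.fromRows (1 : Matrix ι ι ℝ) (gain Q R θ)‖ ≤ c := by
  obtain ⟨c, hc, hS⟩ := h.exists_norm_riccati_le hQ hR h0 h1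
  obtain ⟨c', hc', hR'⟩ := exists_le_quad hR
  refine ⟨Real.sqrt (1 + c' * c), fun θ hθ =>
    norm_le_of_dotProduct_mulVec_self_le _ (Real.sqrt_nonneg _) fun x => ?_⟩
  rw [Real.sq_sqrt (by positivity), fromRows_mulVec, one_mulVec]
  have h2 := (h.isDARE hQ hR h0 h1 hθ).quad_closedLoop hR x
  rw [← gain_eq_optGain] at h2
  have h3 := quad_nonneg (posSemidef_riccati (Q := Q) (R := R) θ)
    ((θ.A + θ.B * gain Q R θ) *ᵥ x)
  have h4 := quad_nonneg hQ.posSemidef x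
  have h5 := quad_le_of_norm_le _ (hS θ hθ) x
  have h6 := hR' (gain Q R θ *ᵥ x)
  have h7 : Sum.elim x (gain Q R θ *ᵥ x) ⬝ᵥ Sum.elim x (gain Q R θ *ᵥ x) =
      x ⬝ᵥ x + (gain Q R θ *ᵥ x) ⬝ᵥ (gain Q R θ *ᵥ x) := by
    simp [dotProduct, Fintype.sum_sum_type]
  rw [h7]
  have h8 : c' * quad R (gain Q R θ *ᵥ x) ≤ c' * (c * (x ⬝ᵥ x)) :=
    mul_le_mul_of_nonneg_left (by linarith) hc'
  linarith

end Riccati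

/-! ### Existence of the constant bounding a type -/

namespace Team

variable {M n dx du : ℕ} {𝒯 : Team M n dx du}

open scoped Matrix.Norms.L2Operator in
/-- The constant is the sum of the bounds for the single quantities, which exist by compactness of
the support and uniform stability. -/
lemma Assumptions.exists_boundedBy (h𝒯 : 𝒯.Assumptions) (m : Fin M) : ∃ κ, 𝒯.BoundedBy m κ := by
  have hst := h𝒯.rel_stable m
  obtain ⟨c₁, hc₁⟩ := (h𝒯.relSet_compact m).exists_bound_of_continuousOn
    (f := fun θ => θ) continuous_id.continuousOn
  obtain ⟨c₂, hc₂0, hc₂⟩ := hst.exists_norm_riccati_le (h𝒯.Q_posDef m) (h𝒯.R_posDef m)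
    h𝒯.δ_pos h𝒯.δ_lt_one
  obtain ⟨c₃, hc₃⟩ := hst.exists_norm_fromRows_gain_le (h𝒯.Q_posDef m) (h𝒯.R_posDef m)
    h𝒯.δ_pos h𝒯.δ_lt_one
  obtain ⟨c₄, hc₄0, hc₄⟩ := exists_le_quad (h𝒯.Q_posDef m)
  obtain ⟨c₅, hc₅0, hc₅⟩ := exists_le_quad (h𝒯.relCov_posDef m)
  obtain ⟨c₆, hc₆0, hc₆⟩ := exists_quad_le (𝒯.relCov m)
  choose c₇ hc₇0 hc₇ using fun i => exists_quad_le (𝒯.initCov m i)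
  have hσ : 0 < 𝒯.σw ^ 2 := pow_pos h𝒯.σw_pos 2
  have hδ : 0 ≤ 1 / (1 - 𝒯.δ) := by
    have := h𝒯.δ_lt_one
    exact div_nonneg zero_le_one (by linarith)
  have hsum : 0 ≤ ∑ i, c₇ i / 𝒯.σw ^ 2 :=
    Finset.sum_nonneg fun i _ => div_nonneg (hc₇0 i) hσ.le
  have hdc : 0 ≤ dx * c₂ := by positivity
  set κ := 1 + |c₁| + c₂ + dx * c₂ + |c₃| + 1 / (1 - 𝒯.δ) + c₄ + c₅ + c₆ +
    ∑ i, c₇ i / 𝒯.σw ^ 2 with hκ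
  have ha₁ := le_abs_self c₁
  have ha₃ := le_abs_self c₃
  have hb₁ := abs_nonneg c₁
  have hb₃ := abs_nonneg c₃
  have hκ1 : 1 ≤ κ := by linarith
  have hκ0 : 0 < κ := by linarith
  have lower : ∀ {α : Type} [Fintype α] [DecidableEq α] (S : Matrix α α ℝ) (c : ℝ), S.PosDef →
      c ≤ κ → (∀ v, v ⬝ᵥ v ≤ c * quad S v) → (S - κ⁻¹ • (1 : Matrix α α ℝ)).PosSemidef := by
    intro α _ _ S c hS hc h
    refine posSemidef_sub_smul_one (transpose_eq_of_posSemidef hS.posSemidef) fun v => ?_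
    rw [inv_mul_le_iff₀ hκ0]
    exact (h v).trans (mul_le_mul_of_nonneg_right hc (quad_nonneg hS.posSemidef v))
  refine ⟨κ, hκ1, fun θ hθ => (hc₁ θ hθ).trans (by linarith),
    fun θ hθ => (hc₂ θ hθ).trans (by linarith), fun θ hθ => ?_,
    fun θ hθ => (hc₃ θ hθ).trans (by linarith), by linarith,
    lower _ c₄ (h𝒯.Q_posDef m) (by linarith) hc₄,
    lower _ c₅ (h𝒯.relCov_posDef m) (by linarith) hc₅, ?_, fun i => ?_⟩
  · rw [trace_eq_sum_quad]
    refine (Finset.sum_le_sum fun a _ => quad_le_of_norm_le _ (hc₂ θ hθ) _).trans ?_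
    simp
    linarith
  · refine posSemidef_smul_one_sub
      (transpose_eq_of_posSemidef (h𝒯.relCov_posDef m).posSemidef) fun v => ?_
    exact (hc₆ v).trans (mul_le_mul_of_nonneg_right (by linarith) (dotProduct_self_nonneg' v))
  · refine posSemidef_smul_one_sub
      (transpose_eq_of_posSemidef (h𝒯.initCov_posSemidef m i)) fun v => ?_
    refine (hc₇ i v).trans (mul_le_mul_of_nonneg_right ?_ (dotProduct_self_nonneg' v))
    have h2 : c₇ i / 𝒯.σw ^ 2 ≤ ∑ i, c₇ i / 𝒯.σw ^ 2 :=
      Finset.single_le_sum (f := fun i => c₇ i / 𝒯.σw ^ 2)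
        (fun i _ => div_nonneg (hc₇0 i) hσ.le) (Finset.mem_univ i)
    rw [← div_le_iff₀ hσ]
    linarith

end Team

/-! ### Measurability of the Riccati matrix -/

section Measurable

instance {a b : Type} [Fintype a] [Fintype b] : BorelSpace (Matrix a b ℝ) :=
  inferInstanceAs (BorelSpace (a → b → ℝ))

instance {a b : Type} [Fintype a] [Fintype b] : SecondCountableTopology (Matrix a b ℝ) :=
  inferInstanceAs (SecondCountableTopology (a → b → ℝ))

instance {a b : Type} [Fintype a] [Fintype b] : StandardBorelSpace (Matrix a b ℝ) :=
  inferInstanceAs (StandardBorelSpace (a → b → ℝ))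

variable {Ω : Type*} {_mΩ : MeasurableSpace Ω}
variable {α β γ : Type} [Fintype α] [Fintype β] [Fintype γ]

lemma measurable_matrix_mul {f : Ω → Matrix α β ℝ} {g : Ω → Matrix β γ ℝ} (hf : Measurable f)
    (hg : Measurable g) : Measurable fun ω => f ω * g ω :=
  (continuous_fst.matrix_mul continuous_snd).measurable.comp (hf.prodMk hg)

lemma measurable_mulVec {f : Ω → Matrix α β ℝ} {g : Ω → β → ℝ} (hf : Measurable f)
    (hg : Measurable g) : Measurable fun ω => f ω *ᵥ g ω :=
  (continuous_fst.matrix_mulVec continuous_snd).measurable.comp (hf.prodMk hg)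

lemma measurable_dotProduct {f g : Ω → α → ℝ} (hf : Measurable f) (hg : Measurable g) :
    Measurable fun ω => f ω ⬝ᵥ g ω :=
  (continuous_fst.dotProduct continuous_snd).measurable.comp (hf.prodMk hg)

lemma measurable_quad {f : Ω → Matrix α α ℝ} {g : Ω → α → ℝ} (hf : Measurable f)
    (hg : Measurable g) : Measurable fun ω => quad (f ω) (g ω) :=
  measurable_dotProduct hg (measurable_mulVec hf hg)

lemma measurable_matrix_transpose {f : Ω → Matrix α β ℝ} (hf : Measurable f) :
    Measurable fun ω => (f ω)ᵀ :=
  continuous_id.matrix_transpose.measurable.comp hf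

lemma measurable_vecMulVec {f : Ω → α → ℝ} {g : Ω → β → ℝ} (hf : Measurable f)
    (hg : Measurable g) : Measurable fun ω => vecMulVec (f ω) (g ω) :=
  (continuous_fst.matrix_vecMulVec continuous_snd).measurable.comp (hf.prodMk hg)

lemma measurable_matrix_add {f g : Ω → Matrix α β ℝ} (hf : Measurable f)
    (hg : Measurable g) : Measurable fun ω => f ω + g ω :=
  continuous_add.measurable.comp (hf.prodMk hg)

lemma measurable_matrix_sub {f g : Ω → Matrix α β ℝ} (hf : Measurable f)
    (hg : Measurable g) : Measurable fun ω => f ω - g ω :=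
  continuous_sub.measurable.comp (hf.prodMk hg)

variable [DecidableEq α]

lemma measurable_det {f : Ω → Matrix α α ℝ} (hf : Measurable f) :
    Measurable fun ω => (f ω).det :=
  continuous_id.matrix_det.measurable.comp hf

lemma measurable_matrix_inv {f : Ω → Matrix α α ℝ} (hf : Measurable f) :
    Measurable fun ω => (f ω)⁻¹ := by
  simp only [Matrix.inv_def, Ring.inverse_eq_inv']
  have h1 : Continuous fun p : ℝ × Matrix α α ℝ => p.1 • p.2 := continuous_smul
  exact h1.measurable.comp ((measurable_det hf).inv.prodMk
    (continuous_id.matrix_adjugate.measurable.comp hf))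

end Measurable

section MeasurableRiccati

variable {ι υ : Type} [Fintype ι] [DecidableEq ι] [Fintype υ] [DecidableEq υ]
variable {Q : Matrix ι ι ℝ} {R : Matrix υ υ ℝ}

lemma continuous_param_A : Continuous (Param.A : Param ι υ → Matrix ι ι ℝ) := by
  refine continuous_pi fun i => continuous_pi fun j => ?_
  exact continuous_apply_apply (Sum.inl j) i

lemma continuous_param_B : Continuous (Param.B : Param ι υ → Matrix ι υ ℝ) := by
  refine continuous_pi fun i => continuous_pi fun j => ?_
  exact continuous_apply_apply (Sum.inr j) i

lemma measurableSet_posSemidef : MeasurableSet {S : Matrix ι ι ℝ | S.PosSemidef} := by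
  have : {S : Matrix ι ι ℝ | S.PosSemidef} =
      {S | Sᵀ = S} ∩ ⋂ v : ι → ℝ, {S | 0 ≤ quad S v} := by
    ext S
    simp only [Set.mem_ofPred_eq, Set.mem_inter_iff, Set.mem_iInter]
    exact ⟨fun h => ⟨transpose_eq_of_posSemidef h, quad_nonneg h⟩,
      fun h => posSemidef_of_quad h.1 h.2⟩
  rw [this]
  refine IsClosed.measurableSet (IsClosed.inter ?_ (isClosed_iInter fun v => ?_))
  · exact isClosed_eq continuous_id.matrix_transpose continuous_id
  · exact isClosed_le continuous_const (continuous_quad v)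

/-- The Riccati matrix is a measurable function of the parameter: its graph over the solvable
parameters is a Borel set which projects injectively, by uniqueness of the solution. -/
lemma measurable_riccati (hQ : Q.PosDef) (hR : R.PosDef) :
    Measurable (riccati Q R : Param ι υ → Matrix ι ι ℝ) := by
  let G : Set (Param ι υ × Matrix ι ι ℝ) := {p | IsDARE p.1.A p.1.B Q R p.2}
  have hG : MeasurableSet G := by
    have hA : Measurable fun p : Param ι υ × Matrix ι ι ℝ => p.1.A :=
      continuous_param_A.measurable.comp measurable_fst
    have hB : Measurable fun p : Param ι υ × Matrix ι ι ℝ => p.1.B :=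
      continuous_param_B.measurable.comp measurable_fst
    have hS : Measurable fun p : Param ι υ × Matrix ι ι ℝ => p.2 := measurable_snd
    have h1 : MeasurableSet {p : Param ι υ × Matrix ι ι ℝ | p.2.PosSemidef} :=
      hS measurableSet_posSemidef
    have hASB := measurable_matrix_mul
      (measurable_matrix_mul (measurable_matrix_transpose hA) hS) hB
    refine h1.inter (measurableSet_eq_fun hS ?_)
    refine measurable_matrix_add (measurable_matrix_sub
      (measurable_matrix_mul (measurable_matrix_mul (measurable_matrix_transpose hA) hS) hA)
      (measurable_matrix_mul (measurable_matrix_mul hASB (measurable_matrix_inv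
        (measurable_matrix_add measurable_const ?_))) (measurable_matrix_transpose hASB)))
      measurable_const
    exact measurable_matrix_mul (measurable_matrix_mul (measurable_matrix_transpose hB) hS) hB
  have himg : ∀ C : Set (Matrix ι ι ℝ), MeasurableSet C →
      MeasurableSet (Prod.fst '' (G ∩ Prod.snd ⁻¹' C)) := by
    intro C hC
    refine (hG.inter (measurable_snd hC)).image_of_measurable_injOn measurable_fst ?_
    rintro ⟨θ, S⟩ h ⟨θ', S'⟩ h' (rfl : θ = θ')
    exact Prod.ext rfl (IsDARE.unique hQ hR h.1 h'.1)
  intro C hC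
  have hset : riccati Q R ⁻¹' C = (Prod.fst '' (G ∩ Prod.snd ⁻¹' C)) ∪
      ((Prod.fst '' (G ∩ Prod.snd ⁻¹' Set.univ))ᶜ ∩ {_θ | (0 : Matrix ι ι ℝ) ∈ C}) := by
    ext θ
    by_cases hθ : ∃ S, IsDARE θ.A θ.B Q R S
    · have h := isDARE_riccati_of_exists hθ
      constructor
      · intro hC'
        exact Or.inl ⟨(θ, riccati Q R θ), ⟨h, hC'⟩, rfl⟩
      · rintro (⟨⟨θ', S⟩, ⟨h1, h2⟩, rfl⟩ | h1)
        · have : riccati Q R θ' = S := IsDARE.unique hQ hR h h1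
          change riccati Q R θ' ∈ C
          rw [this]; exact h2
        · exact absurd ⟨(θ, riccati Q R θ), ⟨h, trivial⟩, rfl⟩ h1.1
    · have h0 : riccati Q R θ = 0 := by
        unfold riccati dare
        rw [dif_neg hθ]
      constructor
      · intro hC'
        refine Or.inr ⟨?_, ?_⟩
        · rintro ⟨⟨θ', S⟩, ⟨h1, -⟩, rfl⟩
          exact hθ ⟨S, h1⟩
        · have : riccati Q R θ ∈ C := hC'
          rwa [h0] at this
      · rintro (⟨⟨θ', S⟩, ⟨h1, h2⟩, rfl⟩ | h1)
        · exact absurd ⟨S, h1⟩ hθ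
        · change riccati Q R θ ∈ C
          rw [h0]; exact h1.2
  rw [hset]
  exact (himg C hC).union ((himg _ MeasurableSet.univ).compl.inter (MeasurableSet.const _))

lemma measurable_gain (hQ : Q.PosDef) (hR : R.PosDef) :
    Measurable (gain Q R : Param ι υ → Matrix υ ι ℝ) := by
  have hA : Measurable (Param.A : Param ι υ → Matrix ι ι ℝ) := continuous_param_A.measurable
  have hB : Measurable (Param.B : Param ι υ → Matrix ι υ ℝ) := continuous_param_B.measurable
  have hS := measurable_riccati (υ := υ) hQ hR
  have hBS := measurable_matrix_mul (measurable_matrix_transpose hB) hS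
  unfold gain
  exact continuous_neg.measurable.comp (measurable_matrix_mul (measurable_matrix_inv
    (measurable_matrix_add (measurable_matrix_mul hBS hB) measurable_const))
    (measurable_matrix_mul hBS hA))

end MeasurableRiccati

/-! ### The covariance recursion -/

section RankOne

variable {α : Type} [Fintype α] [DecidableEq α]

/-- The covariance after observing along the regressor `z` with noise variance `s`. -/
noncomputable def covUpdate (s : ℝ) (S : Matrix α α ℝ) (z : α → ℝ) : Matrix α α ℝ :=
  (S⁻¹ + (1 / s) • vecMulVec z z)⁻¹

variable {s : ℝ} {S : Matrix α α ℝ}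

lemma posDef_precision (hs : 0 < s) (hS : S.PosDef) (z : α → ℝ) :
    (S⁻¹ + (1 / s) • vecMulVec z z).PosDef := by
  refine hS.inv.add_posSemidef (Matrix.PosSemidef.smul ?_ (by positivity))
  simpa using posSemidef_vecMulVec_self_star z

lemma posDef_covUpdate (hs : 0 < s) (hS : S.PosDef) (z : α → ℝ) : (covUpdate s S z).PosDef :=
  (posDef_precision hs hS z).inv

/-- The Sherman–Morrison formula. -/
lemma covUpdate_eq (hs : 0 < s) (hS : S.PosDef) (z : α → ℝ) :
    covUpdate s S z = S - (1 / (s + quad S z)) • vecMulVec (S *ᵥ z) (S *ᵥ z) := by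
  have hdet : IsUnit S.det := hS.det_pos.ne'.isUnit
  have hh := quad_nonneg hS.posSemidef z
  have hsym := transpose_eq_of_posSemidef hS.posSemidef
  have hz : z ᵥ* S = S *ᵥ z := by rw [← mulVec_transpose, hsym]
  refine Matrix.inv_eq_right_inv ?_
  rw [Matrix.mul_sub, Matrix.add_mul, Matrix.mul_smul, Matrix.add_mul, nonsing_inv_mul _ hdet,
    Matrix.smul_mul, Matrix.smul_mul, vecMulVec_mul, hz, mul_vecMulVec, mulVec_mulVec,
    nonsing_inv_mul _ hdet, one_mulVec, vecMulVec_mul_vecMulVec]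
  have hq : z ⬝ᵥ (S *ᵥ z) = quad S z := rfl
  rw [hq]
  ext i j
  simp only [Matrix.add_apply, Matrix.sub_apply, Matrix.smul_apply, vecMulVec_apply, smul_eq_mul,
    Pi.smul_apply]
  field_simp
  ring

lemma quad_covUpdate (hs : 0 < s) (hS : S.PosDef) (z x : α → ℝ) :
    quad (covUpdate s S z) x = quad S x - (z ⬝ᵥ (S *ᵥ x)) ^ 2 / (s + quad S z) := by
  have hsym := transpose_eq_of_posSemidef hS.posSemidef
  rw [covUpdate_eq hs hS, quad_sub_mat, quad_smul_mat, quad_vecMulVec, dotProduct_comm,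
    dotProduct_mulVec_comm hsym]
  ring

lemma det_covUpdate (hs : 0 < s) (hS : S.PosDef) (z : α → ℝ) :
    (covUpdate s S z).det * (1 + quad S z / s) = S.det := by
  have hdet : IsUnit S.det := hS.det_pos.ne'.isUnit
  have hdet' : IsUnit (S⁻¹).det := hS.inv.det_pos.ne'.isUnit
  have hh := quad_nonneg hS.posSemidef z
  have h1 : (S⁻¹ + (1 / s) • vecMulVec z z).det = (S⁻¹).det * (1 + quad S z / s) := by
    have e : (1 / s) • vecMulVec z z =
        replicateCol Unit ((1 / s) • z) * replicateRow Unit z := by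
      rw [← vecMulVec_eq, smul_vecMulVec]
    rw [e, det_add_replicateCol_mul_replicateRow hdet', nonsing_inv_nonsing_inv _ hdet]
    congr 1
    rw [Matrix.det_unique]
    simp only [Matrix.add_apply, one_apply_eq, Matrix.mul_assoc]
    congr 1
    simp only [quad, mul_apply, replicateRow_apply, replicateCol_apply, dotProduct, mulVec,
      Pi.smul_apply, smul_eq_mul]
    rw [Finset.sum_div]
    refine Finset.sum_congr rfl fun i _ => ?_
    rw [mul_div_assoc, Finset.sum_div]
    congr 1
    refine Finset.sum_congr rfl fun j _ => by ring
  have hpos : 0 < 1 + quad S z / s := by positivity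
  rw [covUpdate, det_nonsing_inv, h1, det_nonsing_inv, Ring.inverse_eq_inv',
    mul_inv, inv_inv, mul_assoc, inv_mul_cancel₀ hpos.ne', mul_one]

lemma quad_covUpdate_le (hs : 0 < s) (hS : S.PosDef) (z x : α → ℝ) :
    quad (covUpdate s S z) x ≤ quad S x := by
  have hh := quad_nonneg hS.posSemidef z
  rw [quad_covUpdate hs hS]
  have : 0 ≤ (z ⬝ᵥ (S *ᵥ x)) ^ 2 / (s + quad S z) := by positivity
  linarith

/-- One observation shrinks the form of the covariance by at most the factor by which it shrinks
the determinant. -/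
lemma quad_le_mul_quad_covUpdate (hs : 0 < s) (hS : S.PosDef) (z x : α → ℝ) :
    quad S x ≤ (1 + quad S z / s) * quad (covUpdate s S z) x := by
  have hh := quad_nonneg hS.posSemidef z
  have hcs := dotProduct_mulVec_sq_le hS.posSemidef z x
  rw [quad_covUpdate hs hS]
  have h1 : (z ⬝ᵥ (S *ᵥ x)) ^ 2 / (s + quad S z) ≤ quad S z * quad S x / (s + quad S z) := by
    gcongr
  have h2 : quad S x = (1 + quad S z / s) * (quad S x - quad S z * quad S x / (s + quad S z)) := by
    field_simp
    ring
  calc quad S x = _ := h2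
    _ ≤ _ := by gcongr

/-- The self-normalised process after one observation with noise `w`. -/
lemma quad_covUpdate_add_smul (hs : 0 < s) (hS : S.PosDef) (z y : α → ℝ) (w : ℝ) :
    quad (covUpdate s S z) (y + (w / s) • z) =
      quad S y + w ^ 2 / s - (w - z ⬝ᵥ (S *ᵥ y)) ^ 2 / (s + quad S z) := by
  have hh := quad_nonneg hS.posSemidef z
  have hsym := transpose_eq_of_posSemidef hS.posSemidef
  rw [quad_covUpdate hs hS, quad_add_vec hsym, quad_smul_vec, mulVec_add, mulVec_smul,
    dotProduct_add, dotProduct_smul, dotProduct_smul, dotProduct_mulVec_comm hsym y z]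
  have hq : z ⬝ᵥ (S *ᵥ z) = quad S z := rfl
  simp only [smul_eq_mul, hq]
  field_simp
  ring

lemma inv_covUpdate_mulVec (hs : 0 < s) (hS : S.PosDef) (z θ : α → ℝ) :
    (covUpdate s S z)⁻¹ *ᵥ θ = S⁻¹ *ᵥ θ + ((z ⬝ᵥ θ) / s) • z := by
  rw [covUpdate, nonsing_inv_nonsing_inv _ (posDef_precision hs hS z).det_pos.ne'.isUnit,
    add_mulVec, smul_mulVec, vecMulVec_mulVec]
  congr 1
  ext i
  simp
  ring

lemma quad_inv_le_of_le_quad (hS : S.PosDef) {κ : ℝ}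
    (h : ∀ v, v ⬝ᵥ v ≤ κ * quad S v) (v : α → ℝ) : quad S⁻¹ v ≤ κ * (v ⬝ᵥ v) := by
  have h1 := h (S⁻¹ *ᵥ v)
  rw [quad_inv_mulVec hS] at h1
  have h2 := dotProduct_sq_le v (S⁻¹ *ᵥ v)
  have h3 := quad_nonneg hS.inv.posSemidef v
  have h4 := dotProduct_self_nonneg' v
  rcases h3.eq_or_lt with h0 | h0
  · have h5 := h v
    rcases h4.eq_or_lt with h6 | h6
    · rw [← h0, ← h6]; simp
    · have h7 := quad_nonneg hS.posSemidef v
      have : 0 ≤ κ := by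
        by_contra hκ
        push Not at hκ
        nlinarith
      rw [← h0]; positivity
  · have : quad S⁻¹ v * quad S⁻¹ v ≤ (κ * (v ⬝ᵥ v)) * quad S⁻¹ v := by
      change quad S⁻¹ v ^ 2 ≤ _ at h2
      calc _ = quad S⁻¹ v ^ 2 := by ring
        _ ≤ (v ⬝ᵥ v) * ((S⁻¹ *ᵥ v) ⬝ᵥ (S⁻¹ *ᵥ v)) := h2
        _ ≤ (v ⬝ᵥ v) * (κ * quad S⁻¹ v) := by gcongr
        _ = _ := by ring
    exact le_of_mul_le_mul_right this h0

lemma det_le_pow (hS : S.PosDef) {c : ℝ} (h : ∀ v, quad S v ≤ c * (v ⬝ᵥ v)) :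
    S.det ≤ c ^ Fintype.card α := by
  rw [hS.isHermitian.det_eq_prod_eigenvalues, ← Finset.card_univ, ← Finset.prod_const]
  refine Finset.prod_le_prod (fun i _ => (hS.eigenvalues_pos i).le) fun i _ => ?_
  have h1 := h (hS.isHermitian.eigenvectorBasis i).ofLp
  have h2 := hS.isHermitian.eigenvalues_eq i
  have h3 : (hS.isHermitian.eigenvectorBasis i).ofLp ⬝ᵥ
      (hS.isHermitian.eigenvectorBasis i).ofLp = 1 := by
    have h4 := hS.isHermitian.eigenvectorBasis.norm_eq_one i
    have h5 := EuclideanSpace.norm_sq_eq (hS.isHermitian.eigenvectorBasis i)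
    rw [h4] at h5
    simpa [dotProduct, ← sq] using h5.symm
  rw [h3, mul_one] at h1
  simp only [RCLike.ofReal_real_eq_id, id]
  rw [h2]
  simpa [quad] using h1

end RankOne

section CovSeq

variable {α : Type} [Fintype α] [DecidableEq α]

/-- `S` is a sequence of covariances, from time `1` on, for the regressors `z` and the noise
variance `s`. -/
structure IsCovSeq (s : ℝ) (z : ℕ → α → ℝ) (S : ℕ → Matrix α α ℝ) : Prop where
  pos : 0 < s
  posDef_one : (S 1).PosDef
  succ : ∀ t, 1 ≤ t → S (t + 1) = covUpdate s (S t) (z t)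

lemma isCovSeq_covSeq {cov₁ : Matrix α α ℝ} {s : ℝ} (hs : 0 < s) (h : cov₁.PosDef)
    (z : ℕ → Matrix α α ℝ → α → ℝ) :
    IsCovSeq s (fun t => z t (covSeq cov₁ s z t)) (covSeq cov₁ s z) where
  pos := hs
  posDef_one := h
  succ := by
    intro t ht
    obtain ⟨t, rfl⟩ := Nat.exists_eq_add_of_le' ht
    rfl

variable {s : ℝ} {z : ℕ → α → ℝ} {S : ℕ → Matrix α α ℝ}

/-- The logarithm of the factor by which the determinant has shrunk before time `t`. -/
noncomputable def logDetGain (S : ℕ → Matrix α α ℝ) (t : ℕ) : ℝ :=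
  Real.log ((S 1).det / (S t).det)

namespace IsCovSeq

lemma posDef (h : IsCovSeq s z S) {t : ℕ} (ht : 1 ≤ t) : (S t).PosDef := by
  induction t, ht using Nat.le_induction with
  | base => exact h.posDef_one
  | succ t ht ih => rw [h.succ t ht]; exact posDef_covUpdate h.pos ih _

lemma quad_div_nonneg (h : IsCovSeq s z S) {t : ℕ} (ht : 1 ≤ t) : 0 ≤ quad (S t) (z t) / s :=
  div_nonneg (quad_nonneg (h.posDef ht).posSemidef _) h.pos.le

lemma det_succ (h : IsCovSeq s z S) {t : ℕ} (ht : 1 ≤ t) :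
    (S (t + 1)).det * (1 + quad (S t) (z t) / s) = (S t).det := by
  rw [h.succ t ht]; exact det_covUpdate h.pos (h.posDef ht) _

lemma det_succ_le (h : IsCovSeq s z S) {t : ℕ} (ht : 1 ≤ t) :
    (S (t + 1)).det ≤ (S t).det := by
  rw [← h.det_succ ht]
  have := h.quad_div_nonneg ht
  have := (h.posDef (t := t + 1) (by omega)).det_pos
  nlinarith

lemma logDetGain_one (h : IsCovSeq s z S) : logDetGain S 1 = 0 := by
  rw [logDetGain, div_self h.posDef_one.det_pos.ne', Real.log_one]

lemma logDetGain_succ (h : IsCovSeq s z S) {t : ℕ} (ht : 1 ≤ t) :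
    logDetGain S (t + 1) = logDetGain S t + Real.log (1 + quad (S t) (z t) / s) := by
  have h0 := h.quad_div_nonneg ht
  have h1 := (h.posDef (t := t + 1) (by omega)).det_pos
  have h2 := (h.posDef ht).det_pos
  have h3 := h.posDef_one.det_pos
  unfold logDetGain
  rw [← Real.log_mul (by positivity) (by positivity), ← h.det_succ ht]
  congr 1
  field_simp

lemma logDetGain_le_succ (h : IsCovSeq s z S) {t : ℕ} (ht : 1 ≤ t) :
    logDetGain S t ≤ logDetGain S (t + 1) := by
  rw [h.logDetGain_succ ht]
  have := Real.log_nonneg ((le_add_iff_nonneg_right (1 : ℝ)).2 (h.quad_div_nonneg ht))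
  linarith

lemma logDetGain_mono (h : IsCovSeq s z S) {t t' : ℕ} (ht : 1 ≤ t) (htt' : t ≤ t') :
    logDetGain S t ≤ logDetGain S t' := by
  induction t', htt' using Nat.le_induction with
  | base => exact le_rfl
  | succ t' htt' ih => exact ih.trans (h.logDetGain_le_succ (ht.trans htt'))

lemma quad_mono (h : IsCovSeq s z S) {t t' : ℕ} (ht : 1 ≤ t) (htt' : t ≤ t') (x : α → ℝ) :
    quad (S t') x ≤ quad (S t) x := by
  induction t', htt' using Nat.le_induction with
  | base => exact le_rfl
  | succ t' htt' ih =>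
    rw [h.succ t' (ht.trans htt')]
    exact (quad_covUpdate_le h.pos (h.posDef (ht.trans htt')) _ x).trans ih

/-- The forms of two covariances differ at most by the ratio of their determinants. -/
lemma det_mul_quad_le (h : IsCovSeq s z S) {t t' : ℕ} (ht : 1 ≤ t) (htt' : t ≤ t') (x : α → ℝ) :
    (S t').det * quad (S t) x ≤ (S t).det * quad (S t') x := by
  induction t', htt' using Nat.le_induction with
  | base => exact le_rfl
  | succ t' htt' ih =>
    have ht' := ht.trans htt'
    have h0 := h.quad_div_nonneg ht'
    have h1 := quad_le_mul_quad_covUpdate h.pos (h.posDef ht') (z t') x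
    rw [← h.succ t' ht'] at h1
    have h2 := mul_le_mul_of_nonneg_left h1 (h.posDef ht).det_pos.le
    rw [← h.det_succ ht'] at ih
    have h3 : 0 < 1 + quad (S t') (z t') / s := by positivity
    refine le_of_mul_le_mul_right ?_ h3
    nlinarith

/-- The elliptical potential bound. -/
lemma sum_min_one_le (h : IsCovSeq s z S) (T : ℕ) :
    ∑ t ∈ Finset.Icc 1 T, min 1 (quad (S t) (z t) / s) ≤ 2 * logDetGain S (T + 1) := by
  induction T with
  | zero => simp [h.logDetGain_one]
  | succ T ih =>
    rw [Finset.sum_Icc_succ_top (by omega), h.logDetGain_succ (t := T + 1) (by omega)]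
    have h0 := h.quad_div_nonneg (t := T + 1) (by omega)
    set q := quad (S (T + 1)) (z (T + 1)) / s
    have key : min 1 q ≤ 2 * Real.log (1 + q) := by
      have h1 := Real.one_sub_inv_le_log_of_pos (show 0 < 1 + q by linarith)
      rcases le_total 1 q with h2 | h2
      · rw [min_eq_left h2]
        have h3 : (1 + q)⁻¹ ≤ 2⁻¹ := inv_anti₀ (by norm_num) (by linarith)
        linarith
      · rw [min_eq_right h2]
        have h3 : 1 - (1 + q)⁻¹ = q / (1 + q) := by field_simp; ring
        have h4 : q / 2 ≤ q / (1 + q) := div_le_div_of_nonneg_left h0 (by linarith) (by linarith)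
        linarith
    linarith

lemma quad_inv_le (h : IsCovSeq s z S) {κ : ℝ} (hκ : ∀ v, v ⬝ᵥ v ≤ κ * quad (S 1) v) {t : ℕ}
    (ht : 1 ≤ t) (v : α → ℝ) :
    quad (S t)⁻¹ v ≤ (κ + (∑ u ∈ Finset.Ico 1 t, z u ⬝ᵥ z u) / s) * (v ⬝ᵥ v) := by
  induction t, ht using Nat.le_induction with
  | base => simpa using quad_inv_le_of_le_quad h.posDef_one hκ v
  | succ t ht ih =>
    have h1 : quad (S (t + 1))⁻¹ v = quad (S t)⁻¹ v + (z t ⬝ᵥ v) ^ 2 / s := by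
      rw [h.succ t ht, covUpdate,
        nonsing_inv_nonsing_inv _ (posDef_precision h.pos (h.posDef ht) _).det_pos.ne'.isUnit,
        quad_add_mat, quad_smul_mat, quad_vecMulVec]
      ring
    rw [h1, Finset.sum_Ico_succ_top ht]
    have h2 : (z t ⬝ᵥ v) ^ 2 / s ≤ (z t ⬝ᵥ z t) * (v ⬝ᵥ v) / s :=
      div_le_div_of_nonneg_right (dotProduct_sq_le _ _) h.pos.le
    calc _ ≤ (κ + (∑ u ∈ Finset.Ico 1 t, z u ⬝ᵥ z u) / s) * (v ⬝ᵥ v) +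
          (z t ⬝ᵥ z t) * (v ⬝ᵥ v) / s := add_le_add ih h2
      _ = _ := by ring

/-- The determinant shrinks at most polynomially in the size of the regressors. -/
lemma logDetGain_le (h : IsCovSeq s z S) {κ : ℝ} (hκ1 : 1 ≤ κ)
    (hκ : ∀ v, v ⬝ᵥ v ≤ κ * quad (S 1) v)
    (hκ' : ∀ v, quad (S 1) v ≤ κ * (v ⬝ᵥ v)) {t : ℕ} (ht : 1 ≤ t) :
    logDetGain S t ≤ Fintype.card α *
      Real.log (κ * (κ + (∑ u ∈ Finset.Ico 1 t, z u ⬝ᵥ z u) / s)) := by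
  have h1 := det_le_pow h.posDef_one hκ'
  have h2 := det_le_pow (h.posDef ht).inv (h.quad_inv_le hκ ht)
  have h3 := h.posDef_one.det_pos
  have h4 := (h.posDef ht).inv.det_pos
  have h5 : 0 ≤ (∑ u ∈ Finset.Ico 1 t, z u ⬝ᵥ z u) / s :=
    div_nonneg (Finset.sum_nonneg fun u _ => dotProduct_self_nonneg' _) h.pos.le
  rw [det_nonsing_inv, Ring.inverse_eq_inv'] at h2 h4
  unfold logDetGain
  rw [← Real.log_pow, mul_pow, div_eq_mul_inv]
  exact Real.log_le_log (by positivity) (by gcongr)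

end IsCovSeq

end CovSeq

/-! ### Episodes -/

section Episodes

variable (d : ℕ → ℝ)

/-- The criterion by which a new episode starts at time `t + 1`. -/
def NewEpisode (t : ℕ) : Prop :=
  t + 1 - (episode d t).start > (episode d t).prevLen ∨
    d (t + 1) < (1 / 2) * d (episode d t).start

variable {d}

lemma episode_succ_of_new {t : ℕ} (h : NewEpisode d t) :
    episode d (t + 1) = ⟨(episode d t).k + 1, t + 1, t + 1 - (episode d t).start⟩ := by
  rw [episode]
  exact if_pos h

lemma episode_succ_of_not {t : ℕ} (h : ¬ NewEpisode d t) : episode d (t + 1) = episode d t := by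
  rw [episode]
  exact if_neg h

lemma newEpisode_zero : NewEpisode d 0 := Or.inl (by simp [episode])

lemma episode_one : episode d 1 = ⟨1, 1, 1⟩ := by
  rw [episode_succ_of_new newEpisode_zero]; rfl

lemma episode_start_le (t : ℕ) : (episode d t).start ≤ t := by
  induction t with
  | zero => simp [episode]
  | succ t ih =>
    by_cases h : NewEpisode d t
    · simp [episode_succ_of_new h]
    · rw [episode_succ_of_not h]; omega

lemma one_le_episode_start {t : ℕ} (ht : 1 ≤ t) : 1 ≤ (episode d t).start := by
  induction t, ht using Nat.le_induction with
  | base => simp [episode_one]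
  | succ t ht ih =>
    by_cases h : NewEpisode d t
    · simp [episode_succ_of_new h]
    · rwa [episode_succ_of_not h]

lemma episode_k_le (t : ℕ) : (episode d t).k ≤ t := by
  induction t with
  | zero => simp [episode]
  | succ t ih =>
    by_cases h : NewEpisode d t
    · simpa [episode_succ_of_new h] using ih
    · rw [episode_succ_of_not h]; omega

lemma episode_k_le_succ (t : ℕ) : (episode d t).k ≤ (episode d (t + 1)).k := by
  by_cases h : NewEpisode d t
  · simp [episode_succ_of_new h]
  · rw [episode_succ_of_not h]

lemma episode_k_mono : Monotone fun t => (episode d t).k :=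
  monotone_nat_of_le_succ episode_k_le_succ

lemma one_le_episode_k {t : ℕ} (ht : 1 ≤ t) : 1 ≤ (episode d t).k := by
  have := episode_k_mono (d := d) ht
  simpa [episode_one] using this

lemma episode_start_eq (t : ℕ) : episode d (episode d t).start = episode d t := by
  induction t with
  | zero => rfl
  | succ t ih =>
    by_cases h : NewEpisode d t
    · conv_lhs => rw [episode_succ_of_new h]
    · rwa [episode_succ_of_not h]

lemma le_start_add_prevLen (t : ℕ) : t ≤ (episode d t).start + (episode d t).prevLen := by
  induction t with
  | zero => simp
  | succ t ih =>
    by_cases h : NewEpisode d t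
    · simp [episode_succ_of_new h]
    · rw [episode_succ_of_not h]
      have := not_or.1 h
      omega

/-- Within an episode the determinant stays above half its initial value. -/
lemma half_mul_start_le (hd : ∀ t, 0 < d t) (t : ℕ) :
    (1 / 2) * d (episode d t).start ≤ d t := by
  have half_le : ∀ t, (1 / 2) * d t ≤ d t := fun t => by linarith [hd t]
  induction t with
  | zero => exact half_le 0
  | succ t ih =>
    by_cases h : NewEpisode d t
    · simpa [episode_succ_of_new h] using half_le (t + 1)
    · rw [episode_succ_of_not h]
      exact not_lt.1 (not_or.1 h).2

lemma episode_k_lt_of_lt_start {t t' : ℕ} (h : t' < (episode d t).start) :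
    (episode d t').k < (episode d t).k := by
  induction t with
  | zero => simp [episode] at h
  | succ t ih =>
    by_cases hn : NewEpisode d t
    · rw [episode_succ_of_new hn] at h ⊢
      have h1 : t' ≤ t := Nat.lt_succ_iff.1 h
      exact Nat.lt_succ_of_le (episode_k_mono (d := d) h1)
    · rw [episode_succ_of_not hn] at h ⊢
      exact ih h

lemma exists_episode_k_eq {T k : ℕ} (hk : k ≤ numEpisodes d T) :
    ∃ t, (episode d t).k = k := by
  unfold numEpisodes at hk
  induction T with
  | zero => exact ⟨0, by simp [episode] at hk ⊢; omega⟩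
  | succ T ih =>
    by_cases hn : NewEpisode d T
    · rw [episode_succ_of_new hn] at hk
      rcases Nat.lt_or_ge (episode d T).k k with h | h
      · exact ⟨T + 1, by
            rw [episode_succ_of_new hn]; change _ + 1 = _; change k ≤ _ + 1 at hk; omega⟩
      · exact ih h
    · rw [episode_succ_of_not hn] at hk; exact ih hk

/-- Up to the horizon, episode `k` has started by time `t` if and only if the episode number at
time `t` is at least `k`. -/
lemma epStart_le_iff {T k t : ℕ} (hk : k ≤ numEpisodes d T + 1) (ht : t ≤ T) :
    epStart d T k ≤ t ↔ k ≤ (episode d t).k := by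
  unfold epStart
  split_ifs with h
  · have hne : {t | (episode d t).k = k}.Nonempty := exists_episode_k_eq h
    have hmem : (episode d (sInf {t | (episode d t).k = k})).k = k := Nat.sInf_mem hne
    constructor
    · intro h1
      have h2 := episode_k_mono (d := d) h1
      simp only at h2
      rwa [hmem] at h2
    · intro h1
      by_contra h2
      push Not at h2
      have h3 := episode_k_mono (d := d) h2.le
      simp only at h3
      rw [hmem] at h3
      exact absurd (Nat.sInf_le (show t ∈ {t | (episode d t).k = k} from le_antisymm h3 h1))
        (not_le.2 h2)
  · have h1 : (episode d t).k ≤ numEpisodes d T := episode_k_mono (d := d) ht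
    constructor
    · intro h2; omega
    · intro h2; omega

lemma epStart_episode_k {T t : ℕ} (ht : t ≤ T) :
    epStart d T (episode d t).k = (episode d t).start := by
  have h1 : (episode d t).k ≤ numEpisodes d T := episode_k_mono (d := d) ht
  have hs := episode_start_le (d := d) t
  apply le_antisymm
  · rw [epStart_le_iff (by omega) (hs.trans ht), episode_start_eq]
  · by_contra h2
    push Not at h2
    have h3 := (epStart_le_iff (d := d) (k := (episode d t).k)
      (t := epStart d T (episode d t).k) (T := T) (by omega) (by omega)).1 le_rfl
    exact absurd (episode_k_lt_of_lt_start h2) (not_lt.2 h3)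

lemma epStart_le_succ {T k : ℕ} (hk : k ≤ numEpisodes d T) :
    epStart d T k ≤ epStart d T (k + 1) := by
  have hle : epStart d T k ≤ T := (epStart_le_iff (by omega) le_rfl).2 hk
  by_contra h
  push Not at h
  have h1 := (epStart_le_iff (d := d) (k := k + 1) (t := epStart d T (k + 1)) (T := T)
    (by omega) (by omega)).1 le_rfl
  have h2 := (epStart_le_iff (d := d) (k := k) (t := epStart d T (k + 1)) (T := T)
    (by omega) (by omega)).2 (by omega)
  omega

lemma mem_Ico_epStart_iff {T k t : ℕ} (hk : k ∈ Finset.Icc 1 (numEpisodes d T)) :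
    t ∈ Finset.Ico (epStart d T k) (epStart d T (k + 1)) ↔
      t ∈ Finset.Icc 1 T ∧ (episode d t).k = k := by
  rw [Finset.mem_Icc] at hk
  rw [Finset.mem_Ico, Finset.mem_Icc]
  have hT : epStart d T (k + 1) ≤ T + 1 := by
    rcases Nat.lt_or_ge k (numEpisodes d T) with h | h
    · exact ((epStart_le_iff (d := d) (k := k + 1) (T := T) (by omega) le_rfl).2 h).trans (by omega)
    · unfold epStart; rw [if_neg (by omega)]
  have h0 : ∀ t ≤ T, (epStart d T k ≤ t ↔ k ≤ (episode d t).k) := fun t ht =>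
    epStart_le_iff (by omega) ht
  have h1 : ∀ t ≤ T, (epStart d T (k + 1) ≤ t ↔ k + 1 ≤ (episode d t).k) := fun t ht =>
    epStart_le_iff (by omega) ht
  have hz : (episode d 0).k = 0 := rfl
  constructor
  · rintro ⟨h2, h3⟩
    have ht : t ≤ T := by omega
    have h4 := (h0 t ht).1 h2
    have h5 := mt (h1 t ht).2 (by omega)
    refine ⟨⟨?_, ht⟩, by omega⟩
    rcases Nat.eq_zero_or_pos t with rfl | h6
    · omega
    · exact h6
  · rintro ⟨⟨h2, ht⟩, h3⟩
    exact ⟨(h0 t ht).2 (by omega), not_le.1 (mt (h1 t ht).1 (by omega))⟩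

/-- A sum over episodes and their times is a sum over times. -/
lemma sum_episodes {E : Type*} [AddCommMonoid E] (T : ℕ) (f : ℕ → ℕ → E) :
    ∑ k ∈ Finset.Icc 1 (numEpisodes d T),
      ∑ t ∈ Finset.Ico (epStart d T k) (epStart d T (k + 1)), f (epStart d T k) t =
      ∑ t ∈ Finset.Icc 1 T, f (episode d t).start t := by
  have hmaps : ∀ t ∈ Finset.Icc 1 T, (episode d t).k ∈ Finset.Icc 1 (numEpisodes d T) := by
    intro t ht
    rw [Finset.mem_Icc] at ht ⊢
    exact ⟨one_le_episode_k ht.1, episode_k_mono (d := d) ht.2⟩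
  rw [← Finset.sum_fiberwise_of_maps_to hmaps]
  refine Finset.sum_congr rfl fun k hk => ?_
  have hset : Finset.Ico (epStart d T k) (epStart d T (k + 1)) =
      {t ∈ Finset.Icc 1 T | (episode d t).k = k} := by
    ext t
    rw [mem_Ico_epStart_iff hk, Finset.mem_filter]
  rw [hset]
  refine Finset.sum_congr rfl fun t ht => ?_
  obtain ⟨ht1, rfl⟩ := Finset.mem_filter.1 ht
  rw [epStart_episode_k (Finset.mem_Icc.1 ht1).2]

/-- A sum over episodes weighted by their lengths is a sum over time. -/
lemma sum_episodes_length (T : ℕ) (g : ℕ → ℝ) :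
    ∑ k ∈ Finset.Icc 1 (numEpisodes d T),
      ((epStart d T (k + 1) : ℝ) - epStart d T k) * g (epStart d T k) =
      ∑ t ∈ Finset.Icc 1 T, g (episode d t).start := by
  rw [← sum_episodes T fun s _ => g s]
  refine Finset.sum_congr rfl fun k hk => ?_
  rw [Finset.sum_const, Nat.card_Ico, nsmul_eq_mul,
    Nat.cast_sub (epStart_le_succ (Finset.mem_Icc.1 hk).2)]

open Classical in
/-- As an episode is at most one step longer than the previous one, the sum over times is bounded
by a sum over starting times whose weights are known when an episode starts. -/
lemma sum_start_le {T : ℕ} {g : ℕ → ℝ} (hg : ∀ t ∈ Finset.Icc 1 T, 0 ≤ g t) :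
    ∑ t ∈ Finset.Icc 1 T, g (episode d t).start ≤
      ∑ s ∈ Finset.Icc 1 T,
        if (episode d s).start = s then ((episode d s).prevLen + 1 : ℝ) * g s else 0 := by
  have hmaps : ∀ t ∈ Finset.Icc 1 T, (episode d t).start ∈ Finset.Icc 1 T := by
    intro t ht
    rw [Finset.mem_Icc] at ht ⊢
    exact ⟨one_le_episode_start ht.1, (episode_start_le t).trans ht.2⟩
  rw [← Finset.sum_fiberwise_of_maps_to hmaps]
  refine Finset.sum_le_sum fun s hs => ?_
  have h1 : ∑ t ∈ Finset.Icc 1 T with (episode d t).start = s, g (episode d t).start =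
      (Finset.card {t ∈ Finset.Icc 1 T | (episode d t).start = s} : ℝ) * g s := by
    rw [← nsmul_eq_mul, ← Finset.sum_const]
    refine Finset.sum_congr rfl fun t ht => ?_
    rw [(Finset.mem_filter.1 ht).2]
  rw [h1]
  split_ifs with hstart
  · refine mul_le_mul_of_nonneg_right ?_ (hg s hs)
    have hsub : {t ∈ Finset.Icc 1 T | (episode d t).start = s} ⊆
        Finset.Icc s (s + (episode d s).prevLen) := by
      intro t ht
      have h2 := (Finset.mem_filter.1 ht).2
      have h3 := episode_start_eq (d := d) t
      rw [h2] at h3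
      have h4 := le_start_add_prevLen (d := d) t
      have h5 := episode_start_le (d := d) t
      rw [Finset.mem_Icc, h3]
      omega
    have h6 := Finset.card_le_card hsub
    rw [Nat.card_Icc] at h6
    have h7 : s + (episode d s).prevLen + 1 - s = (episode d s).prevLen + 1 := by omega
    rw [h7] at h6
    exact_mod_cast h6
  · have : Finset.card {t ∈ Finset.Icc 1 T | (episode d t).start = s} = 0 := by
      rw [Finset.card_eq_zero, Finset.filter_eq_empty_iff]
      intro t _ ht
      apply hstart
      have h3 := episode_start_eq (d := d) t
      rw [ht] at h3
      rw [h3, ht]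
    simp [this]

open Classical in
/-- The lengths of the previous episodes telescope: at the start of an episode, `prevLen` is the
difference of the last two starting times. -/
lemma sum_prevLen_add_one (T : ℕ) :
    ∑ s ∈ Finset.Icc 1 T,
        (if (episode d s).start = s then (episode d s).prevLen + 1 else 0) =
      (episode d T).start + (episode d T).k := by
  induction T with
  | zero => simp [episode]
  | succ T ih =>
    rw [Finset.sum_Icc_succ_top (by omega), ih]
    have hle := episode_start_le (d := d) T
    by_cases hn : NewEpisode d T
    · rw [episode_succ_of_new hn]
      simp only [if_true]
      omega
    · rw [episode_succ_of_not hn, if_neg (by omega), add_zero]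

/-- Telescoping within episodes: each episode contributes at most its initial value. -/
lemma sum_telescope_le {g : ℕ → ℕ → ℝ} {c : ℝ} (h0 : ∀ s t, 0 ≤ g s t)
    {T : ℕ} (hT : 1 ≤ T) (hc : ∀ t, 1 ≤ t → t ≤ T → g t t ≤ c) :
    ∑ t ∈ Finset.Icc 1 T, (g (episode d t).start t - g (episode d t).start (t + 1)) ≤
      (episode d T).k * c := by
  suffices h : ∑ t ∈ Finset.Icc 1 T, (g (episode d t).start t - g (episode d t).start (t + 1)) ≤
      (episode d T).k * c - g (episode d T).start (T + 1) by
    linarith [h0 (episode d T).start (T + 1)]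
  induction T, hT using Nat.le_induction with
  | base =>
    simp only [Finset.Icc_self, Finset.sum_singleton, episode_one]
    have := hc 1 le_rfl le_rfl
    simpa using this
  | succ T hT ih =>
    have ih := ih fun t h1 h2 => hc t h1 (by omega)
    rw [Finset.sum_Icc_succ_top (by omega)]
    by_cases hn : NewEpisode d T
    · rw [episode_succ_of_new hn]
      have h1 := hc (T + 1) (by omega) le_rfl
      have h2 := h0 (episode d T).start (T + 1)
      push_cast
      linarith
    · rw [episode_succ_of_not hn]
      linarith

/-- Short episodes are bounded in number by the halvings of the determinant, long ones by the
horizon; `a` is the length that separates them. -/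
lemma exists_halvings (hd : Antitone d) {a : ℕ} (ha : 1 ≤ a) (t : ℕ) :
    ∃ M : ℕ, 2 ^ M * d (episode d t).start ≤ d 0 ∧
      a * (episode d t).k ≤
        (episode d t).start + a * (a * M + min a (episode d t).prevLen) := by
  induction t with
  | zero => exact ⟨0, by simp [episode], by simp [episode]⟩
  | succ t ih =>
    obtain ⟨M, h1, h2⟩ := ih
    have hle := episode_start_le (d := d) t
    by_cases hn : NewEpisode d t
    · rw [episode_succ_of_new hn]
      simp only
      set k := (episode d t).k
      set s := (episode d t).start
      set p := (episode d t).prevLen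
      by_cases hdet : d (t + 1) < (1 / 2) * d s
      · refine ⟨M + 1, ?_, ?_⟩
        · rw [pow_succ]
          have : (0 : ℝ) < 2 ^ M := by positivity
          nlinarith
        · have h3 : min a p ≤ a := min_le_left _ _
          have h4 : 1 ≤ min a (t + 1 - s) := le_min ha (by omega)
          nlinarith
      · have hlen : t + 1 - s > p := hn.resolve_right hdet
        refine ⟨M, ?_, ?_⟩
        · have : (0 : ℝ) < 2 ^ M := by positivity
          have := hd (show s ≤ t + 1 by omega)
          nlinarith
        · rcases Nat.lt_or_ge p a with hp | hp
          · have h3 : min a p = p := min_eq_right hp.le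
            have h4 : p + 1 ≤ min a (t + 1 - s) := le_min hp hlen
            rw [h3] at h2
            nlinarith
          · have h3 : min a p = a := min_eq_left hp
            have h4 : min a (t + 1 - s) = a := min_eq_left (by omega)
            have h5 : s + a ≤ t + 1 := by omega
            rw [h3] at h2
            rw [h4, Nat.mul_succ]
            omega
    · rw [episode_succ_of_not hn]
      exact ⟨M, h1, h2⟩

/-- The number of episodes is of the order of the square root of the horizon. -/
lemma numEpisodes_le (hd : Antitone d) (hpos : ∀ t, 0 < d t) {T : ℕ} (hT : 1 ≤ T) {D : ℝ}
    (hD : Real.log (d 0 / d T) ≤ D) :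
    (numEpisodes d T : ℝ) ≤ 3 * Real.sqrt (T * (1 + 2 * D)) := by
  have hT' : (1 : ℝ) ≤ T := by exact_mod_cast hT
  have hlog0 : 0 ≤ Real.log (d 0 / d T) :=
    Real.log_nonneg ((one_le_div (hpos T)).2 (hd (Nat.zero_le T)))
  set B := 1 + 2 * D with hB
  have hB1 : 1 ≤ B := by linarith
  have hKT : (numEpisodes d T : ℝ) ≤ T := by exact_mod_cast episode_k_le (d := d) T
  -- for a horizon below `B` the trivial bound `T` on the number of episodes suffices
  rcases le_total (T : ℝ) B with hTB | hBT
  · have : (T : ℝ) ≤ Real.sqrt (T * B) := Real.le_sqrt_of_sq_le (by nlinarith)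
    have := Real.sqrt_nonneg (T * B)
    linarith
  · set q := Real.sqrt (T / B) with hq
    have hq1 : 1 ≤ q := Real.one_le_sqrt.2 ((one_le_div (by linarith)).2 hBT)
    obtain ⟨M, h1, h2⟩ := exists_halvings hd (Nat.one_le_ceil_iff.2 (by linarith : 0 < q)) T
    -- for `a ≈ √(T / B)` the bounds on the numbers of long and short episodes are of one order
    set a := ⌈q⌉₊
    have ha1 : q ≤ a := Nat.le_ceil q
    have ha2 : (a : ℝ) < q + 1 := Nat.ceil_lt_add_one (by linarith)
    have hM : (M : ℝ) ≤ 2 * D := by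
      have h3 : 2 ^ M * d T ≤ d 0 :=
        (mul_le_mul_of_nonneg_left (hd (episode_start_le T)) (by positivity)).trans h1
      have h4 : (2 : ℝ) ^ M ≤ d 0 / d T := (le_div_iff₀ (hpos T)).2 h3
      have h5 := Real.log_le_log (by positivity) h4
      rw [Real.log_pow] at h5
      have h6 := Real.log_two_gt_d9
      have h7 : (0 : ℝ) ≤ M := Nat.cast_nonneg M
      nlinarith
    have hk : (a : ℝ) * numEpisodes d T ≤ T + a * (a * B) := by
      have h3 : a * (episode d T).k ≤ T + a * (a * M + a) := by
        refine h2.trans (add_le_add (episode_start_le T) (Nat.mul_le_mul_left _ ?_))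
        exact Nat.add_le_add_left (min_le_left _ _) _
      have h4 : (a : ℝ) * numEpisodes d T ≤ T + a * (a * M + a) := by exact_mod_cast h3
      refine h4.trans ?_
      have : (a : ℝ) * M + a ≤ a * B := by nlinarith
      gcongr
    have hqB : q * q * B = T := by
      rw [Real.mul_self_sqrt (by positivity)]
      field_simp
    have hr : Real.sqrt (T * B) = q * B := by
      rw [Real.sqrt_eq_iff_mul_self_eq (by positivity) (by positivity)]
      nlinarith
    rw [hr]
    have hapos : 0 < (a : ℝ) := by linarith
    have h5 : (a : ℝ) * numEpisodes d T ≤ a * (3 * (q * B)) := by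
      refine hk.trans ?_
      have e1 : (T : ℝ) ≤ a * (q * B) := by
        rw [← hqB]; nlinarith [mul_nonneg (by linarith : 0 ≤ q) (by linarith : 0 ≤ B)]
      have e2 : (a : ℝ) * B ≤ 2 * (q * B) := by nlinarith
      nlinarith
    exact le_of_mul_le_mul_left h5 hapos

end Episodes

/-! ### Gaussian integrals -/

section Gaussian

open scoped NNReal ENNReal

/-- The likelihood ratio of `𝒩(c, s + h)` and `𝒩(0, s)` integrates to one. -/
lemma lintegral_exp_gaussian {s : ℝ≥0} (hs : 0 < s) {h : ℝ} (hh : 0 ≤ h) (c : ℝ) :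
    ∫⁻ w, ENNReal.ofReal (Real.exp ((w ^ 2 / s - (w - c) ^ 2 / (s + h)) / 2)) ∂gaussianReal 0 s =
      ENNReal.ofReal (Real.sqrt (1 + h / s)) := by
  have hs' : (0 : ℝ) < s := hs
  lift h to ℝ≥0 using hh
  have hsh : (0 : ℝ) < s + h := add_pos_of_pos_of_nonneg hs' h.2
  have key : ∀ w : ℝ, gaussianPDFReal 0 s w *
      Real.exp ((w ^ 2 / s - (w - c) ^ 2 / (s + h)) / 2) =
      Real.sqrt (1 + h / s) * gaussianPDFReal c (s + h) w := by
    intro w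
    unfold gaussianPDFReal
    have h1 : Real.sqrt (2 * Real.pi * (s + h : ℝ≥0)) =
        Real.sqrt (1 + h / s) * Real.sqrt (2 * Real.pi * s) := by
      rw [← Real.sqrt_mul (by positivity)]
      congr 1
      push_cast
      field_simp
    rw [h1]
    have h2 : 0 < Real.sqrt (1 + h / s) := Real.sqrt_pos.2 (by positivity)
    have h3 : 0 < Real.sqrt (2 * Real.pi * s) := Real.sqrt_pos.2 (by positivity)
    have h4 : Real.exp (-(w - c) ^ 2 / (2 * (s + h : ℝ≥0))) =
        Real.exp (-(w - 0) ^ 2 / (2 * s)) *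
          Real.exp ((w ^ 2 / s - (w - c) ^ 2 / (s + h)) / 2) := by
      rw [← Real.exp_add]
      congr 1
      push_cast
      field_simp
      ring
    rw [h4]
    field_simp
  rw [gaussianReal_of_var_ne_zero _ hs.ne',
    lintegral_withDensity_eq_lintegral_mul _ (measurable_gaussianPDF 0 s) (by fun_prop)]
  have h5 : ∀ w : ℝ, (gaussianPDF 0 s * fun w => ENNReal.ofReal
      (Real.exp ((w ^ 2 / s - (w - c) ^ 2 / (s + h)) / 2))) w =
      ENNReal.ofReal (Real.sqrt (1 + h / s)) * gaussianPDF c (s + h) w := by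
    intro w
    rw [Pi.mul_apply, gaussianPDF, gaussianPDF, ← ENNReal.ofReal_mul (gaussianPDFReal_nonneg _ _ _),
      key, ENNReal.ofReal_mul (Real.sqrt_nonneg _)]
  rw [lintegral_congr h5, lintegral_const_mul _ (measurable_gaussianPDF c (s + h)),
    lintegral_gaussianPDF_eq_one c (by positivity), mul_one]

/-- The square of a Gaussian variable has an exponential moment, uniformly over the variances up to
`v`. For variance `v'` the integral is that of a multiple of the Gaussian density of variance
`2 v'`. -/
lemma lintegral_exp_sq_gaussian_le {v v' : ℝ≥0} (hv' : v' ≤ v) :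
    ∫⁻ w, ENNReal.ofReal (Real.exp (w ^ 2 / (4 * v))) ∂gaussianReal 0 v' ≤
      ENNReal.ofReal (Real.sqrt 2) := by
  rcases eq_or_ne v' 0 with rfl | h0
  · rw [gaussianReal_zero_var, lintegral_dirac' _ (by fun_prop)]
    refine ENNReal.ofReal_le_ofReal ?_
    simp
  · have hpos : 0 < v' := pos_iff_ne_zero.2 h0
    have hpos' : (0 : ℝ) < v' := hpos
    have hvv : (v' : ℝ) ≤ v := hv'
    have h1 := lintegral_exp_gaussian hpos (NNReal.coe_nonneg v') 0
    have h2 : (1 : ℝ) + v' / v' = 2 := by rw [div_self hpos'.ne']; norm_num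
    rw [h2] at h1
    rw [← h1]
    refine lintegral_mono fun w => ENNReal.ofReal_le_ofReal (Real.exp_le_exp.2 ?_)
    have h3 : (w ^ 2 / v' - (w - 0) ^ 2 / (v' + v')) / 2 = w ^ 2 / (4 * v') := by
      field_simp
      ring
    rw [h3]
    gcongr

variable {Ω : Type*} [MeasurableSpace Ω] {P : Measure Ω} [IsProbabilityMeasure P]

/-- A linear combination of independent centred Gaussian variables. -/
lemma map_sum_mul_gaussian {ι : Type*} [Fintype ι] {X : ι → Ω → ℝ} (hX : ∀ i, Measurable (X i))
    {v : ι → ℝ≥0} (hlaw : ∀ i, P.map (X i) = gaussianReal 0 (v i)) (hind : iIndepFun X P)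
    (a : ι → ℝ) :
    P.map (fun ω => ∑ i, a i * X i ω) = gaussianReal 0 (∑ i, (Real.toNNReal (a i ^ 2)) * v i) := by
  have hY : ∀ i, P.map (fun ω => a i * X i ω) =
      gaussianReal 0 (Real.toNNReal (a i ^ 2) * v i) := by
    intro i
    have h1 : (fun ω => a i * X i ω) = (fun x => a i * x) ∘ X i := rfl
    rw [h1, ← Measure.map_map (by fun_prop) (hX i), hlaw, gaussianReal_map_const_mul, mul_zero]
    congr 2
    ext
    simp [Real.coe_toNNReal _ (sq_nonneg (a i))]
  have hYm : ∀ i, Measurable fun ω => a i * X i ω := fun i => (hX i).const_mul _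
  have hgl : ∀ i, HasGaussianLaw (fun ω => a i * X i ω) P := fun i =>
    ⟨by rw [hY i]; infer_instance⟩
  have hind' : iIndepFun (fun i ω => a i * X i ω) P :=
    hind.comp (fun i x => a i * x) fun i => by fun_prop
  have hg := iIndepFun.hasGaussianLaw_fun_sum hgl hind'
  have hmean : ∀ i, ∫ ω, a i * X i ω ∂P = 0 := by
    intro i
    have h1 := integral_map (μ := P) (hYm i).aemeasurable (f := fun x : ℝ => x)
      (by fun_prop)
    rw [← h1, hY i, integral_id_gaussianReal]
  have hvar : ∀ i, Var[fun ω => a i * X i ω; P] = Real.toNNReal (a i ^ 2) * v i := by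
    intro i
    have h1 := variance_map (μ := P) (X := id) (Y := fun ω => a i * X i ω)
      (by fun_prop) (hYm i).aemeasurable
    rw [hY i, variance_id_gaussianReal] at h1
    simpa using h1.symm
  rw [hg.map_eq_gaussianReal, integral_finsetSum _ fun i _ => (hgl i).integrable]
  simp only [hmean, Finset.sum_const_zero]
  congr 1
  have h2 : (fun ω => ∑ i, a i * X i ω) = ∑ i, fun ω => a i * X i ω := by
    ext ω; simp
  rw [h2, IndepFun.variance_sum (fun i _ => (hgl i).memLp_two)
    (fun i _ j _ hij => hind'.indepFun hij)]
  simp only [hvar]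
  ext
  rw [Real.coe_toNNReal _ (Finset.sum_nonneg fun i _ => by positivity)]
  push_cast
  rfl

/-- Linear functionals of a centred Gaussian vector. -/
lemma map_dotProduct_multivariateGaussian {ι : Type} [Fintype ι] [DecidableEq ι]
    {S : Matrix ι ι ℝ} (hS : S.PosSemidef) {X : Ω → EuclideanSpace ℝ ι} (hX : Measurable X)
    (hlaw : P.map X = multivariateGaussian 0 S) (c : ι → ℝ) :
    P.map (fun ω => c ⬝ᵥ (X ω).ofLp) = gaussianReal 0 (Real.toNNReal (quad S c)) := by
  have hin : ∀ x : EuclideanSpace ℝ ι, c ⬝ᵥ x.ofLp = inner ℝ (WithLp.toLp 2 c) x := by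
    intro x
    simp [PiLp.inner_apply, dotProduct, mul_comm]
  have hmeas : Measurable fun x : EuclideanSpace ℝ ι => inner ℝ (WithLp.toLp 2 c) x := by
    fun_prop
  have h1 : (fun ω => c ⬝ᵥ (X ω).ofLp) =
      (fun x : EuclideanSpace ℝ ι => inner ℝ (WithLp.toLp 2 c) x) ∘ X := by
    ext ω; simp [hin]
  rw [h1, ← Measure.map_map hmeas hX, hlaw]
  have hg : HasGaussianLaw (fun x : EuclideanSpace ℝ ι => inner ℝ (WithLp.toLp 2 c) x)
      (multivariateGaussian 0 S) :=
    (IsGaussian.hasGaussianLaw_id (μ := multivariateGaussian (0 : EuclideanSpace ℝ ι) S)).map_fun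
      (innerSL ℝ (WithLp.toLp 2 c))
  have hid : HasGaussianLaw id (multivariateGaussian (0 : EuclideanSpace ℝ ι) S) :=
    IsGaussian.hasGaussianLaw_id
  rw [hg.map_eq_gaussianReal]
  congr 1
  · have h2 := integral_inner (𝕜 := ℝ) hid.integrable (WithLp.toLp 2 c)
    simp only [id] at h2
    rw [h2, integral_id_multivariateGaussian, inner_zero_right]
  · rw [← covarianceBilin_self hid.memLp_two, covarianceBilin_multivariateGaussian hS]
    rfl

end Gaussian

/-! ### Independence and posterior sampling -/

section Independence

open scoped ENNReal

-- The sub-σ-algebras precede the ambient one, so that the latter is found by instance search.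
variable {Ω : Type*} {m W H past info : MeasurableSpace Ω} [mΩ : MeasurableSpace Ω]
  {P : Measure Ω} [IsProbabilityMeasure P]
  {β γ : Type*} [MeasurableSpace β] [MeasurableSpace γ]

/-- An independent variable may be integrated out first. -/
lemma lintegral_of_indep (hm : m ≤ mΩ) {X : Ω → β}
    (hX : Measurable[m] X) {W : Ω → γ} (hW : Measurable W)
    (hind : Indep (MeasurableSpace.comap W inferInstance) m P) {φ : β × γ → ℝ≥0∞}
    (hφ : Measurable φ) :
    ∫⁻ ω, φ (X ω, W ω) ∂P = ∫⁻ ω, ∫⁻ w, φ (X ω, w) ∂(P.map W) ∂P := by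
  have hX' : Measurable X := hX.mono hm le_rfl
  have hXW : IndepFun X W P := by
    rw [IndepFun_iff_Indep]
    exact indep_of_indep_of_le_left hind.symm hX.comap_le
  have h1 := (indepFun_iff_map_prod_eq_prod_map_map hX'.aemeasurable hW.aemeasurable).1 hXW
  have h2 : ∫⁻ ω, φ (X ω, W ω) ∂P = ∫⁻ p, φ p ∂(P.map fun ω => (X ω, W ω)) :=
    (lintegral_map hφ (hX'.prodMk hW)).symm
  have : IsProbabilityMeasure (P.map W) := Measure.isProbabilityMeasure_map hW.aemeasurable
  rw [h2, h1, lintegral_prod _ hφ.aemeasurable,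
    lintegral_map (Measurable.lintegral_prod_right' hφ) hX']

/-- Choosing one of several equidistributed variables independently of their values does not
change the law. -/
lemma lintegral_select_of_indep {ι : Type*} [Fintype ι] [DecidableEq ι] [MeasurableSpace ι]
    [MeasurableSingletonClass ι] (hm : m ≤ mΩ) {X : Ω → β}
    (hX : Measurable[m] X) {j : Ω → ι} (hj : Measurable[m] j) {W : ι → Ω → γ}
    (hW : ∀ i, Measurable (W i)) {ν : Measure γ} (hlaw : ∀ i, P.map (W i) = ν)
    (hind : ∀ i, Indep (MeasurableSpace.comap (W i) inferInstance) m P) {φ : β × γ → ℝ≥0∞}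
    (hφ : Measurable φ) :
    ∫⁻ ω, φ (X ω, W (j ω) ω) ∂P = ∫⁻ ω, ∫⁻ w, φ (X ω, w) ∂ν ∂P := by
  let ψ : ι → (ι × β) × γ → ℝ≥0∞ := fun i p => if p.1.1 = i then φ (p.1.2, p.2) else 0
  have hψ : ∀ i, Measurable (ψ i) := fun i =>
    Measurable.ite ((measurable_fst.comp measurable_fst) (measurableSet_singleton i))
      (hφ.comp ((measurable_snd.comp measurable_fst).prodMk measurable_snd)) measurable_const
  have hjX : Measurable[m] fun ω => (j ω, X ω) := hj.prodMk hX
  have h1 : ∀ ω, φ (X ω, W (j ω) ω) = ∑ i, ψ i ((j ω, X ω), W i ω) := by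
    intro ω
    simp only [ψ]
    rw [Finset.sum_ite_eq]
    simp
  have hmeas : ∀ i, Measurable fun ω => ψ i ((j ω, X ω), W i ω) := fun i =>
    (hψ i).comp ((hjX.mono hm le_rfl).prodMk (hW i))
  rw [lintegral_congr h1, lintegral_finsetSum _ fun i _ => hmeas i]
  have h2 : ∀ i, ∫⁻ ω, ψ i ((j ω, X ω), W i ω) ∂P =
      ∫⁻ ω, ∫⁻ w, ψ i ((j ω, X ω), w) ∂ν ∂P := by
    intro i
    rw [lintegral_of_indep hm hjX (hW i) (hind i) (hψ i), hlaw]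
  simp only [h2]
  have hcases : Nonempty Ω ∨ IsEmpty Ω := (isEmpty_or_nonempty Ω).symm
  rcases hcases with ⟨⟨ω₀⟩⟩ | hemp
  · have hν : IsProbabilityMeasure ν := by
      rw [← hlaw (j ω₀)]; exact Measure.isProbabilityMeasure_map (hW _).aemeasurable
    rw [← lintegral_finsetSum]
    · refine lintegral_congr fun ω => ?_
      rw [← lintegral_finsetSum]
      · refine lintegral_congr fun w => ?_
        simp only [ψ]
        rw [Finset.sum_ite_eq]
        simp
      · exact fun i _ => (hψ i).comp measurable_prodMk_left
    · exact fun i _ => (Measurable.lintegral_prod_right' (hψ i)).comp (hjX.mono hm le_rfl)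
  · simp [lintegral_of_isEmpty]

variable {Y Z : Ω → β}

lemma setIntegral_condProb (hm : m ≤ mΩ) (hY : Measurable Y) {S : Set β} (hS : MeasurableSet S)
    {A : Set Ω} (hA : MeasurableSet[m] A) :
    ∫ ω in A, (P⟦Y ⁻¹' S | m⟧) ω ∂P = P.real (A ∩ Y ⁻¹' S) := by
  rw [setIntegral_condExp hm ((integrable_const (1 : ℝ)).indicator (hY hS)) hA,
    integral_indicator (hY hS), Measure.restrict_restrict (hY hS), Set.inter_comm]
  simp

/-- Sampling from a posterior: on events known to the posterior, the sample has the law of the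
parameter. -/
lemma measure_inter_sample (hpast : past ≤ mΩ) (hinfo : info ≤ past) (hY : Measurable Y)
    (hZ : Measurable Z) {S : Set β} (hS : MeasurableSet S)
    (hcond : P⟦Y ⁻¹' S | past⟧ =ᵐ[P] P⟦Z ⁻¹' S | info⟧) {A : Set Ω}
    (hA : MeasurableSet[info] A) : P (A ∩ Y ⁻¹' S) = P (A ∩ Z ⁻¹' S) := by
  have h2 := setIntegral_condProb hpast hY hS (hinfo A hA) (P := P)
  have h3 := setIntegral_condProb (hinfo.trans hpast) hZ hS hA (P := P)
  have h4 : P.real (A ∩ Y ⁻¹' S) = P.real (A ∩ Z ⁻¹' S) := by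
    rw [← h2, ← h3]
    exact setIntegral_congr_ae (hpast _ (hinfo _ hA)) (hcond.mono fun ω h _ => h)
  exact (measureReal_eq_measureReal_iff).1 h4

/-- A sample from a posterior has, jointly with anything the posterior knows, the law of the
parameter. -/
lemma map_prodMk_sample (hpast : past ≤ mΩ) (hinfo : info ≤ past) (hY : Measurable Y)
    (hZ : Measurable Z)
    (hcond : ∀ S, MeasurableSet S → P⟦Y ⁻¹' S | past⟧ =ᵐ[P] P⟦Z ⁻¹' S | info⟧)
    {I : Ω → γ} (hI : Measurable[info] I) :
    P.map (fun ω => (I ω, Y ω)) = P.map (fun ω => (I ω, Z ω)) := by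
  have hI' : Measurable I := hI.mono (hinfo.trans hpast) le_rfl
  have : IsProbabilityMeasure (P.map fun ω => (I ω, Y ω)) :=
    Measure.isProbabilityMeasure_map (hI'.prodMk hY).aemeasurable
  refine Measure.ext_prod fun {A S} hA hS => ?_
  rw [Measure.map_apply (hI'.prodMk hY) (hA.prod hS),
    Measure.map_apply (hI'.prodMk hZ) (hA.prod hS)]
  exact measure_inter_sample hpast hinfo hY hZ hS (hcond S hS) (hI hA)

/-- A sample drawn with fresh randomness from a posterior does not destroy independence from a
noise which the posterior does not know. -/
lemma indep_sup_comap_sample (hpast : past ≤ mΩ) (hW : W ≤ past) (hH : H ≤ past)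
    (hinfo : info ≤ H) (hWH : Indep W H P) (hY : Measurable Y)
    (hcond : ∀ S, MeasurableSet S → P⟦Y ⁻¹' S | past⟧ =ᵐ[P] P⟦Z ⁻¹' S | info⟧) :
    Indep W (H ⊔ MeasurableSpace.comap Y inferInstance) P := by
  let p₂ : Set (Set Ω) := {s | ∃ A S, MeasurableSet[H] A ∧ MeasurableSet S ∧ s = A ∩ Y ⁻¹' S}
  have hgen : H ⊔ MeasurableSpace.comap Y inferInstance = MeasurableSpace.generateFrom p₂ := by
    apply le_antisymm
    · refine sup_le (fun A hA => ?_) ?_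
      · exact MeasurableSpace.measurableSet_generateFrom
          ⟨A, Set.univ, hA, MeasurableSet.univ, by simp⟩
      · rintro _ ⟨S, hS, rfl⟩
        exact MeasurableSpace.measurableSet_generateFrom
          ⟨Set.univ, S, MeasurableSet.univ, hS, by simp⟩
    · refine MeasurableSpace.generateFrom_le ?_
      rintro _ ⟨A, S, hA, hS, rfl⟩
      exact MeasurableSet.inter ((le_sup_left : H ≤ _) _ hA)
        ((le_sup_right : MeasurableSpace.comap Y inferInstance ≤ _) _ ⟨S, hS, rfl⟩)
  have hpi : IsPiSystem p₂ := by
    rintro _ ⟨A, S, hA, hS, rfl⟩ _ ⟨A', S', hA', hS', rfl⟩ -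
    refine ⟨A ∩ A', S ∩ S', hA.inter hA', hS.inter hS', ?_⟩
    rw [Set.preimage_inter, Set.inter_inter_inter_comm]
  refine IndepSets.indep (p1 := {s | MeasurableSet[W] s}) (hW.trans hpast)
    (sup_le (hH.trans hpast) hY.comap_le) (@MeasurableSpace.isPiSystem_measurableSet Ω W) hpi
    (@MeasurableSpace.generateFrom_measurableSet Ω W).symm hgen ?_
  rw [IndepSets_iff]
  rintro B _ hB ⟨A, S, hA, hS, rfl⟩
  have hB0 : MeasurableSet B := hpast _ (hW _ hB)
  have hA0 : MeasurableSet A := hpast _ (hH _ hA)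
  set g := P⟦Z ⁻¹' S | info⟧ with hg
  have hgm : StronglyMeasurable[H] (A.indicator g) :=
    (stronglyMeasurable_condExp.mono hinfo).indicator hA
  have hint : ∀ C, MeasurableSet[past] C → P.real (C ∩ Y ⁻¹' S) = ∫ ω in C, g ω ∂P := by
    intro C hC
    rw [← setIntegral_condProb hpast hY hS hC]
    exact setIntegral_congr_ae (hpast _ hC) ((hcond S hS).mono fun ω h _ => h)
  have hgi : Integrable (A.indicator g) P := integrable_condExp.indicator hA0
  have h1 : P.real (B ∩ (A ∩ Y ⁻¹' S)) = ∫ ω in B, A.indicator g ω ∂P := by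
    rw [← Set.inter_assoc, hint _ ((hW _ hB).inter (hH _ hA)), setIntegral_indicator hA0]
  have h2 : P.real (A ∩ Y ⁻¹' S) = ∫ ω, A.indicator g ω ∂P := by
    rw [hint _ (hH _ hA), integral_indicator hA0]
  have h3 : ∫ ω in B, A.indicator g ω ∂P = P.real B * ∫ ω, A.indicator g ω ∂P := by
    rw [← setIntegral_condExp (hW.trans hpast) hgi hB,
      setIntegral_congr_ae hB0 ((condExp_indep_eq (hH.trans hpast) (hW.trans hpast) hgm
        hWH.symm).mono fun ω h _ => h), setIntegral_const, smul_eq_mul]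
  have h4 : P.real (B ∩ (A ∩ Y ⁻¹' S)) = P.real B * P.real (A ∩ Y ⁻¹' S) := by
    rw [h1, h3, h2]
  rw [← ENNReal.toReal_eq_toReal_iff' (measure_ne_top _ _)
    (ENNReal.mul_ne_top (measure_ne_top _ _) (measure_ne_top _ _)), ENNReal.toReal_mul]
  exact h4

end Independence

/-! ### Dynamics of the relative systems -/

lemma mkParam_transpose_mulVec {ι υ : Type} [Fintype ι] [Fintype υ] (A : Matrix ι ι ℝ)
    (B : Matrix ι υ ℝ) (x : ι → ℝ) (u : υ → ℝ) :
    (mkParam A B)ᵀ *ᵥ Sum.elim x u = A *ᵥ x + B *ᵥ u := by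
  rw [mkParam, transpose_transpose, fromCols_mulVec]
  rfl

lemma param_transpose_mulVec {ι υ : Type} [Fintype ι] [Fintype υ] (θ : Param ι υ)
    (x : ι → ℝ) (u : υ → ℝ) : θᵀ *ᵥ Sum.elim x u = θ.A *ᵥ x + θ.B *ᵥ u := by
  have h : θᵀ = fromCols θ.A θ.B := (fromCols_toCols θᵀ).symm
  rw [h, fromCols_mulVec]
  rfl

namespace Run

variable {M n dx du : ℕ} {Ω : Type*} {r : Run M n dx du Ω} {𝒯 : Team M n dx du}

/-- The noise of the relative system of agent `i` of type `m`. -/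
noncomputable def wrel (r : Run M n dx du Ω) (m : Fin M) (i : Fin n) (t : ℕ) (ω : Ω) : Fin dx → ℝ :=
  fun a => (r.w m i t ω).ofLp a - (1 / (n : ℝ)) * ∑ j, (r.w m j t ω).ofLp a

section Mean

variable [NeZero n]

lemma average_const (c : ℝ) : (1 / (n : ℝ)) * ∑ _j : Fin n, c = c := by
  have : (n : ℝ) ≠ 0 := Nat.cast_ne_zero.2 (NeZero.ne n)
  simp [this]

lemma sum_xrel (m : Fin M) (t : ℕ) (ω : Ω) : ∑ i, r.xrel m i t ω = 0 := by
  have hn : (n : ℝ) ≠ 0 := Nat.cast_ne_zero.2 (NeZero.ne n)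
  ext a
  rw [Finset.sum_apply]
  simp only [xrel, Finset.sum_sub_distrib, Finset.sum_const, Finset.card_univ, Fintype.card_fin,
    nsmul_eq_mul, xbar, Pi.zero_apply]
  field_simp
  ring

lemma average_mulVec {α : Type} [Fintype α] {β : Type} (A : Matrix β α ℝ) (f : Fin n → α → ℝ)
    (b : β) :
    (1 / (n : ℝ)) * ∑ j, (A *ᵥ f j) b = (A *ᵥ fun a => (1 / (n : ℝ)) * ∑ j, f j a) b := by
  simp only [mulVec, dotProduct, Finset.mul_sum]
  rw [Finset.sum_comm]
  refine Finset.sum_congr rfl fun a _ => Finset.sum_congr rfl fun j _ => by ring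

variable [MeasurableSpace Ω] {P : Measure Ω}

namespace IsTSDEMF

variable (hr : r.IsTSDEMF 𝒯 P)
include hr

lemma urel_eq (m : Fin M) (i : Fin n) {t : ℕ} (ht : 1 ≤ t) (ω : Ω) :
    r.urel m i t ω = 𝒯.relL m (r.relCurrent 𝒯 m t ω) *ᵥ r.xrel m i t ω := by
  set L := 𝒯.relL m (r.relCurrent 𝒯 m t ω) with hL
  set c : Fin du → ℝ := fun a => (𝒯.mfL (r.mfCurrent 𝒯 t ω) *ᵥ r.xbar t ω) (m, a)
  have hu : ∀ j, r.u m j t ω = c + L *ᵥ r.xrel m j t ω := fun j => hr.control m j t ω ht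
  have hsum : ∑ j, L *ᵥ r.xrel m j t ω = 0 := by
    rw [← mulVec_sum, sum_xrel, mulVec_zero]
  ext a
  have hbar : r.ubar t ω (m, a) = c a := by
    simp only [ubar, hu, Pi.add_apply, Finset.sum_add_distrib, mul_add]
    rw [average_const]
    have h0 := congrFun hsum a
    rw [Finset.sum_apply] at h0
    rw [h0]
    simp
  simp only [urel, hbar, hu, Pi.add_apply]
  ring

lemma zrel_eq (m : Fin M) (i : Fin n) {t : ℕ} (ht : 1 ≤ t) (ω : Ω) :
    r.zrel m i t ω =
      Matrix.fromRows 1 (𝒯.relL m (r.relCurrent 𝒯 m t ω)) *ᵥ r.xrel m i t ω := by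
  rw [fromRows_mulVec, one_mulVec, zrel, hr.urel_eq m i ht]

lemma xrel_succ (m : Fin M) (i : Fin n) {t : ℕ} (ht : 1 ≤ t) (ω : Ω) :
    r.xrel m i (t + 1) ω = (r.relParam m ω)ᵀ *ᵥ r.zrel m i t ω + r.wrel m i t ω := by
  rw [zrel, relParam, mkParam_transpose_mulVec]
  have hx : ∀ j, r.x m j (t + 1) ω = r.A m ω *ᵥ r.x m j t ω + r.B m ω *ᵥ r.u m j t ω +
      (r.D m ω *ᵥ r.xbar t ω + r.E m ω *ᵥ r.ubar t ω + (r.v m t ω).ofLp + (r.v0 t ω).ofLp) +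
      (r.w m j t ω).ofLp := by
    intro j
    rw [hr.dynamics m j t ω ht]
    abel
  set c := r.D m ω *ᵥ r.xbar t ω + r.E m ω *ᵥ r.ubar t ω + (r.v m t ω).ofLp + (r.v0 t ω).ofLp
  have e1 : r.xrel m i t ω = r.x m i t ω - fun a => (1 / (n : ℝ)) * ∑ j, r.x m j t ω a := rfl
  have e2 : r.urel m i t ω = r.u m i t ω - fun a => (1 / (n : ℝ)) * ∑ j, r.u m j t ω a := rfl
  rw [e1, e2, mulVec_sub, mulVec_sub]
  ext a
  simp only [xrel, xbar, hx, Pi.add_apply, Pi.sub_apply, Finset.sum_add_distrib, mul_add,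
    average_const, average_mulVec, wrel]
  ring

lemma xrel_one (m : Fin M) (i : Fin n) (ω : Ω) (a : Fin dx) :
    r.xrel m i 1 ω a =
      (r.x₁ m i ω).ofLp a - (1 / (n : ℝ)) * ∑ j, (r.x₁ m j ω).ofLp a := by
  simp only [xrel, xbar, hr.init]

end IsTSDEMF

end Mean

/-! ### The history of a relative actor -/

lemma relCovAt_one (m : Fin M) (ω : Ω) : r.relCovAt 𝒯 m ω 1 = 𝒯.relCov m := rfl

lemma relCovAt_succ (m : Fin M) (ω : Ω) {t : ℕ} (ht : 1 ≤ t) :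
    r.relCovAt 𝒯 m ω (t + 1) =
      covUpdate 𝒯.relVar (r.relCovAt 𝒯 m ω t) (r.zrel m (r.j 𝒯 m t ω) t ω) := by
  obtain ⟨t, rfl⟩ := Nat.exists_eq_add_of_le' ht
  rfl

/-- What relative actor `m` can depend on: the parameter, the initial states, the noise before
time `t`, and the samples at times `1 ≤ s < τ`. -/
@[reducible] def hist (r : Run M n dx du Ω) (m : Fin M) (t τ : ℕ) : MeasurableSpace Ω :=
  ((⨆ s ∈ {s | (∃ i, s = Sum.inl (m, i)) ∨ ∃ i, ∃ u < t, s = Sum.inr (Sum.inl (m, i, u))},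
    MeasurableSpace.comap (r.noise s) inferInstance) ⊔
  MeasurableSpace.comap (r.relParam m) inferInstance) ⊔
  ⨆ s ∈ Set.Ico 1 τ, MeasurableSpace.comap (r.relSample m s) inferInstance

lemma hist_mono (m : Fin M) {t t' τ τ' : ℕ} (ht : t ≤ t') (hτ : τ ≤ τ') :
    r.hist m t τ ≤ r.hist m t' τ' := by
  refine sup_le_sup (sup_le_sup ?_ le_rfl) ?_
  · refine biSup_mono ?_
    rintro s (h | ⟨i, u, hu, h⟩)
    · exact Or.inl h
    · exact Or.inr ⟨i, u, hu.trans_le ht, h⟩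
  · exact biSup_mono fun s hs => ⟨hs.1, hs.2.trans_le hτ⟩

lemma hist_succ (m : Fin M) (t : ℕ) {τ : ℕ} (hτ : 1 ≤ τ) :
    r.hist m t (τ + 1) =
      r.hist m t τ ⊔ MeasurableSpace.comap (r.relSample m τ) inferInstance := by
  unfold hist
  rw [sup_assoc _ (⨆ s ∈ Set.Ico 1 τ, _)]
  congr 1
  have : Set.Ico 1 (τ + 1) = Set.Ico 1 τ ∪ {τ} := by
    ext s; simp; omega
  rw [this, iSup_union, iSup_singleton]

lemma measurable_hist_param (m : Fin M) (t τ : ℕ) : Measurable[r.hist m t τ] (r.relParam m) :=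
  Measurable.of_comap_le (le_sup_of_le_left le_sup_right)

lemma measurable_hist_sample (m : Fin M) (t : ℕ) {τ s : ℕ} (h1 : 1 ≤ s) (h2 : s < τ) :
    Measurable[r.hist m t τ] (r.relSample m s) :=
  Measurable.of_comap_le (le_sup_of_le_right
    (le_iSup₂_of_le (f := fun s (_ : s ∈ Set.Ico 1 τ) =>
      MeasurableSpace.comap (r.relSample m s) inferInstance) s ⟨h1, h2⟩ le_rfl))

lemma measurable_hist_noise (m : Fin M) (t τ : ℕ)
    {s : (Fin M × Fin n) ⊕ (Fin M × Fin n × ℕ) ⊕ (Fin M × ℕ) ⊕ ℕ}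
    (hs : (∃ i, s = Sum.inl (m, i)) ∨ ∃ i, ∃ u < t, s = Sum.inr (Sum.inl (m, i, u))) :
    Measurable[r.hist m t τ] (r.noise s) := by
  refine Measurable.of_comap_le (le_sup_of_le_left (le_sup_of_le_left ?_))
  exact le_iSup₂_of_le (f := fun s (_ : s ∈ {s | (∃ i, s = Sum.inl (m, i)) ∨
    ∃ i, ∃ u < t, s = Sum.inr (Sum.inl (m, i, u))}) =>
      MeasurableSpace.comap (r.noise s) inferInstance) s hs le_rfl

end Run

/-! ### Measurability of the covariances and episodes -/

section MeasurableEpisode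

variable {Ω : Type*} {_mΩ : MeasurableSpace Ω} {β : Type*} [MeasurableSpace β]

/-- Evaluation of a process at a random time with values in `A`. -/
lemma measurable_eval_nat {N : Ω → ℕ} (hN : Measurable N) {A : Set ℕ} (hA : ∀ ω, N ω ∈ A)
    {f : ℕ → Ω → β} (hf : ∀ s ∈ A, Measurable (f s)) : Measurable fun ω => f (N ω) ω := by
  intro S hS
  have : (fun ω => f (N ω) ω) ⁻¹' S = ⋃ s ∈ A, (N ⁻¹' {s} ∩ f s ⁻¹' S) := by
    ext ω
    simp only [Set.mem_preimage, Set.mem_iUnion, Set.mem_inter_iff, Set.mem_singleton_iff]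
    constructor
    · exact fun h => ⟨N ω, hA ω, rfl, h⟩
    · rintro ⟨s, _, rfl, h⟩; exact h
  rw [this]
  exact MeasurableSet.biUnion (Set.to_countable A) fun s hs =>
    (hN (measurableSet_singleton s)).inter (hf s hs hS)

lemma measurable_eval_finite {ι : Type*} [Finite ι] [MeasurableSpace ι]
    [MeasurableSingletonClass ι] {j : Ω → ι} (hj : Measurable j)
    {f : ι → Ω → β} (hf : ∀ i, Measurable (f i)) : Measurable fun ω => f (j ω) ω := by
  intro S hS
  have : (fun ω => f (j ω) ω) ⁻¹' S = ⋃ i, (j ⁻¹' {i} ∩ f i ⁻¹' S) := by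
    ext ω
    simp
  rw [this]
  exact MeasurableSet.iUnion fun i => (hj (measurableSet_singleton i)).inter (hf i hS)

lemma measurable_episode {d : Ω → ℕ → ℝ} {t : ℕ} (hd : ∀ s ≤ t, Measurable fun ω => d ω s) :
    (Measurable fun ω => (episode (d ω) t).k) ∧ (Measurable fun ω => (episode (d ω) t).start) ∧
      Measurable fun ω => (episode (d ω) t).prevLen := by
  classical
  induction t with
  | zero => exact ⟨measurable_const, measurable_const, measurable_const⟩
  | succ t ih =>
    obtain ⟨h1, h2, h3⟩ := ih fun s hs => hd s (by omega)
    have hds : Measurable fun ω => d ω (episode (d ω) t).start :=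
      measurable_eval_nat (f := fun s ω => d ω s) h2 (A := Set.Iic t)
        (fun ω => episode_start_le t) fun s hs => hd s (by
          have : s ≤ t := hs
          omega)
    have hlen : Measurable fun ω => t + 1 - (episode (d ω) t).start :=
      (measurable_of_countable fun s : ℕ => t + 1 - s).comp h2
    have hnew : MeasurableSet {ω | NewEpisode (d ω) t} := by
      refine MeasurableSet.union (measurableSet_lt h3 hlen) ?_
      exact measurableSet_lt (hd (t + 1) le_rfl) (hds.const_mul _)
    have hite : ∀ {γ : Type} [MeasurableSpace γ] (g : Episode → γ),
        (Measurable fun ω => g (episode (d ω) t)) →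
        (Measurable fun ω => g ⟨(episode (d ω) t).k + 1, t + 1, t + 1 - (episode (d ω) t).start⟩) →
        Measurable fun ω => g (episode (d ω) (t + 1)) := by
      intro γ _ g hg hg'
      have : (fun ω => g (episode (d ω) (t + 1))) = fun ω => if NewEpisode (d ω) t then
          g ⟨(episode (d ω) t).k + 1, t + 1, t + 1 - (episode (d ω) t).start⟩
          else g (episode (d ω) t) := by
        ext ω
        split_ifs with h
        · rw [episode_succ_of_new h]
        · rw [episode_succ_of_not h]
      rw [this]
      exact Measurable.ite hnew hg' hg
    exact ⟨hite Episode.k h1 (h1.add_const 1), hite Episode.start h2 measurable_const,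
      hite Episode.prevLen h3 hlen⟩

lemma measurable_covUpdate {α : Type} [Fintype α] [DecidableEq α] {s : ℝ}
    {S : Ω → Matrix α α ℝ} {z : Ω → α → ℝ} (hS : Measurable S) (hz : Measurable z) :
    Measurable fun ω => covUpdate s (S ω) (z ω) := by
  refine measurable_matrix_inv (measurable_matrix_add (measurable_matrix_inv hS) ?_)
  exact (continuous_const_smul (1 / s)).measurable.comp (measurable_vecMulVec hz hz)

lemma measurable_of_eval {α : Type*} {f : Ω → α → β} (hf : ∀ a, Measurable fun ω => f ω a) :
    Measurable f := measurable_pi_lambda _ hf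

lemma measurable_sub_average {n : ℕ} (i : Fin n) {f : Fin n → Ω → ℝ} (hf : ∀ j, Measurable (f j)) :
    Measurable fun ω => f i ω - (1 / (n : ℝ)) * ∑ j, f j ω :=
  (hf i).sub ((Finset.measurable_fun_sum _ fun j _ => hf j).const_mul _)

lemma measurable_sumElim {α β : Type} {f : Ω → α → ℝ} {g : Ω → β → ℝ} (hf : Measurable f)
    (hg : Measurable g) : Measurable fun ω => Sum.elim (f ω) (g ω) := by
  refine measurable_pi_lambda _ fun x => ?_
  rcases x with a | b
  · exact (measurable_pi_apply a).comp hf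
  · exact (measurable_pi_apply b).comp hg

lemma measurable_fromRows {α β γ : Type} {f : Ω → Matrix α γ ℝ} {g : Ω → Matrix β γ ℝ}
    (hf : Measurable f) (hg : Measurable g) :
    Measurable fun ω => Matrix.fromRows (f ω) (g ω) := by
  refine measurable_pi_lambda _ fun x => ?_
  rcases x with a | b
  · exact (measurable_pi_apply a).comp hf
  · exact (measurable_pi_apply b).comp hg

end MeasurableEpisode

namespace Run

variable {M n dx du : ℕ} {Ω : Type*} {r : Run M n dx du Ω} {𝒯 : Team M n dx du}

lemma measurable_j {_mΩ : MeasurableSpace Ω} (h𝒯 : 𝒯.Assumptions) {m : Fin M} {t : ℕ}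
    (hS : Measurable fun ω => r.relCovAt 𝒯 m ω t) (hz : ∀ i, Measurable (r.zrel m i t)) :
    Measurable (r.j 𝒯 m t) :=
  h𝒯.argmax_measurable.comp (measurable_pi_lambda _ fun i => measurable_quad hS (hz i))

lemma measurable_wrel {_mΩ : MeasurableSpace Ω} {m : Fin M} {t : ℕ} (i : Fin n)
    (hw : ∀ i, Measurable (r.w m i t)) : Measurable (r.wrel m i t) := by
  refine measurable_pi_lambda _ fun a => ?_
  have h : ∀ j, Measurable fun ω => (r.w m j t ω).ofLp a := fun j =>
    (measurable_pi_apply a).comp ((WithLp.measurable_ofLp 2 _).comp (hw j))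
  exact measurable_sub_average i h

variable [mΩ : MeasurableSpace Ω] {P : Measure Ω} [NeZero n]

namespace IsTSDEMF

variable (hr : r.IsTSDEMF 𝒯 P) (h𝒯 : 𝒯.Assumptions)
include hr h𝒯

/-- States, covariances, regressors and samples in force are functions of the history. These are
proved together by induction: a state needs the last regressor, a covariance the selection among
regressors, and the sample in force the episodes, hence the covariances. -/
lemma measurable_hist_state (m : Fin M) {t : ℕ} (ht : 1 ≤ t) :
    ∀ s, 1 ≤ s → s ≤ t → (∀ i, Measurable[r.hist m s s] (r.xrel m i s)) ∧
      (Measurable[r.hist m s s] fun ω => r.relCovAt 𝒯 m ω s) ∧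
      (∀ i, Measurable[r.hist m s (s + 1)] (r.zrel m i s)) ∧
      (Measurable[r.hist m s (s + 1)] (r.relCurrent 𝒯 m s)) := by
  -- the regressor and the sample in force follow from the state and the past covariances
  have hz : ∀ t, 1 ≤ t → (∀ i, Measurable[r.hist m t t] (r.xrel m i t)) →
      (∀ s, 1 ≤ s → s ≤ t → Measurable[r.hist m s s] fun ω => r.relCovAt 𝒯 m ω s) →
      (∀ i, Measurable[r.hist m t (t + 1)] (r.zrel m i t)) ∧
      (Measurable[r.hist m t (t + 1)] (r.relCurrent 𝒯 m t)) := by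
    intro t ht hx hcov
    have hle := hist_mono (r := r) m le_rfl (Nat.le_succ t) (t := t)
    have hd : ∀ s ≤ t, Measurable[r.hist m t t] fun ω => r.relDet 𝒯 m ω s := by
      intro s hs
      rcases Nat.eq_zero_or_pos s with rfl | h0
      · exact (measurable_const : Measurable[r.hist m t t] fun _ => (𝒯.relCov m).det)
      · exact measurable_det ((hcov s h0 hs).mono (hist_mono m hs hs) le_rfl)
    have hstart := (measurable_episode hd).2.1
    have hcur : Measurable[r.hist m t (t + 1)] (r.relCurrent 𝒯 m t) :=
      measurable_eval_nat (f := r.relSample m) (hstart.mono hle le_rfl) (A := Set.Icc 1 t)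
        (fun ω => ⟨one_le_episode_start ht, episode_start_le t⟩)
        fun s hs => measurable_hist_sample m t hs.1 (Nat.lt_succ_of_le hs.2)
    refine ⟨fun i => ?_, hcur⟩
    have hL := (measurable_gain (h𝒯.Q_posDef m) (h𝒯.R_posDef m)).comp hcur
    have : r.zrel m i t = fun ω => Matrix.fromRows 1 (𝒯.relL m (r.relCurrent 𝒯 m t ω)) *ᵥ
        r.xrel m i t ω := by
      ext1 ω; exact hr.zrel_eq m i ht ω
    rw [this]
    exact measurable_mulVec (measurable_fromRows measurable_const hL) ((hx i).mono hle le_rfl)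
  induction t, ht using Nat.le_induction with
  | base =>
    intro s h1 h2
    obtain rfl : s = 1 := le_antisymm h2 h1
    have hx : ∀ i, Measurable[r.hist m 1 1] (r.xrel m i 1) := by
      intro i
      refine measurable_of_eval fun a => ?_
      have h : ∀ j, Measurable[r.hist m 1 1] fun ω => (r.x₁ m j ω).ofLp a := fun j =>
        (measurable_pi_apply a).comp ((WithLp.measurable_ofLp 2 _).comp
          (measurable_hist_noise (r := r) m 1 1 (s := Sum.inl (m, j)) (Or.inl ⟨j, rfl⟩)))
      simp only [hr.xrel_one]
      exact measurable_sub_average i h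
    have hcov : ∀ s, 1 ≤ s → s ≤ 1 → Measurable[r.hist m s s] fun ω => r.relCovAt 𝒯 m ω s := by
      intro s h1 h2
      obtain rfl : s = 1 := le_antisymm h2 h1
      exact measurable_const
    exact ⟨hx, hcov 1 le_rfl le_rfl, hz 1 le_rfl hx hcov⟩
  | succ t ht ih =>
    intro s h1 h2
    rcases Nat.lt_or_ge t s with h3 | h3
    · obtain rfl : s = t + 1 := by omega
      obtain ⟨ix, icov, iz, icur⟩ := ih t ht le_rfl
      have hle : r.hist m t (t + 1) ≤ r.hist m (t + 1) (t + 1) :=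
        hist_mono m (Nat.le_succ t) le_rfl
      have hle' : r.hist m t t ≤ r.hist m (t + 1) (t + 1) :=
        hist_mono m (Nat.le_succ t) (Nat.le_succ t)
      have iz' := fun i => (iz i).mono hle le_rfl
      have icov' := icov.mono hle' le_rfl
      have hx : ∀ i, Measurable[r.hist m (t + 1) (t + 1)] (r.xrel m i (t + 1)) := by
        intro i
        have : r.xrel m i (t + 1) = fun ω =>
            (r.relParam m ω)ᵀ *ᵥ r.zrel m i t ω + r.wrel m i t ω := by
          ext1 ω; exact hr.xrel_succ m i ht ω
        rw [this]
        exact (measurable_mulVec (measurable_matrix_transpose (measurable_hist_param m _ _))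
          (iz' i)).add (measurable_wrel i fun j => measurable_hist_noise (r := r) m (t + 1) (t + 1)
            (s := Sum.inr (Sum.inl (m, j, t))) (Or.inr ⟨j, t, Nat.lt_succ_self t, rfl⟩))
      have hcov : Measurable[r.hist m (t + 1) (t + 1)] fun ω => r.relCovAt 𝒯 m ω (t + 1) := by
        simp only [relCovAt_succ m _ ht]
        refine measurable_covUpdate icov' ?_
        exact measurable_eval_finite (f := fun i => r.zrel m i t) (measurable_j h𝒯 icov' iz') iz'
      refine ⟨hx, hcov, hz (t + 1) (by omega) hx fun s h4 h5 => ?_⟩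
      rcases Nat.lt_or_ge t s with h6 | h6
      · obtain rfl : s = t + 1 := by omega
        exact hcov
      · exact (ih s h4 h6).2.1
    · exact ih s h1 h3

lemma measurable_hist_xrel (m : Fin M) (i : Fin n) {t : ℕ} (ht : 1 ≤ t) :
    Measurable[r.hist m t t] (r.xrel m i t) :=
  (hr.measurable_hist_state h𝒯 m ht t ht le_rfl).1 i

lemma measurable_hist_relCovAt (m : Fin M) {t : ℕ} (ht : 1 ≤ t) :
    Measurable[r.hist m t t] fun ω => r.relCovAt 𝒯 m ω t :=
  (hr.measurable_hist_state h𝒯 m ht t ht le_rfl).2.1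

lemma measurable_hist_zrel (m : Fin M) (i : Fin n) {t : ℕ} (ht : 1 ≤ t) :
    Measurable[r.hist m t (t + 1)] (r.zrel m i t) :=
  (hr.measurable_hist_state h𝒯 m ht t ht le_rfl).2.2.1 i

lemma measurable_hist_relCurrent (m : Fin M) {t : ℕ} (ht : 1 ≤ t) :
    Measurable[r.hist m t (t + 1)] (r.relCurrent 𝒯 m t) :=
  (hr.measurable_hist_state h𝒯 m ht t ht le_rfl).2.2.2

lemma measurable_hist_j (m : Fin M) {t : ℕ} (ht : 1 ≤ t) :
    Measurable[r.hist m t (t + 1)] (r.j 𝒯 m t) :=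
  measurable_j h𝒯 ((hr.measurable_hist_relCovAt h𝒯 m ht).mono
    (hist_mono m le_rfl (Nat.le_succ t)) le_rfl) fun i => hr.measurable_hist_zrel h𝒯 m i ht

lemma relInfo_le_hist (m : Fin M) (t : ℕ) : r.relInfo 𝒯 m t ≤ r.hist m t t := by
  refine iSup₂_le fun s hs => ?_
  have h1 : 1 ≤ s := hs.1
  have h2 : s + 1 ≤ t := hs.2
  have hj := (hr.measurable_hist_j h𝒯 m h1).mono (hist_mono (t' := t) m (by omega) h2) le_rfl
  have hz := fun i => (hr.measurable_hist_zrel h𝒯 m i h1).mono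
    (hist_mono (t' := t) m (by omega) h2) le_rfl
  have hx := fun i => (hr.measurable_hist_xrel h𝒯 m i h1).mono
    (hist_mono (t' := t) (τ' := t) m (by omega) (by omega)) le_rfl
  have hu : ∀ i, Measurable[r.hist m t t] (r.urel m i s) := fun i =>
    measurable_of_eval fun a => (measurable_pi_apply (Sum.inr a)).comp (hz i)
  have hx' := fun i => (hr.measurable_hist_xrel h𝒯 m i (Nat.le_add_left 1 s)).mono
    (hist_mono (t' := t) (τ' := t) m h2 h2) le_rfl
  refine Measurable.comap_le (Measurable.prodMk ?_ (Measurable.prodMk ?_ ?_))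
  · exact measurable_eval_finite (f := fun i => r.xrel m i s) hj hx
  · exact measurable_eval_finite (f := fun i => r.urel m i s) hj hu
  · exact measurable_eval_finite (f := fun i => r.xrel m i (s + 1)) hj hx'

omit h𝒯 [NeZero n] in
lemma primitives_le : r.primitives ≤ mΩ :=
  sup_le hr.params_measurable.comap_le (iSup_le fun s => (hr.noise_measurable s).comap_le)

omit h𝒯 [NeZero n] in
lemma relPast_le (m : Fin M) (t : ℕ) : r.relPast m t ≤ mΩ :=
  sup_le (sup_le hr.primitives_le
    (iSup₂_le fun p _ => (hr.relSample_measurable p.1 p.2).comap_le))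
    (iSup₂_le fun s _ => (hr.mfSample_measurable s).comap_le)

end IsTSDEMF

omit [NeZero n] mΩ in
lemma relParam_comap_le (m : Fin M) :
    MeasurableSpace.comap (r.relParam m) inferInstance ≤
      MeasurableSpace.comap r.params inferInstance := by
  have hg : Measurable fun p : (Fin M → Matrix (Fin dx) (Fin dx) ℝ) ×
      (Fin M → Matrix (Fin dx) (Fin du) ℝ) × (Fin M → Matrix (Fin dx) (Fin M × Fin dx) ℝ) ×
      (Fin M → Matrix (Fin dx) (Fin M × Fin du) ℝ) => mkParam (p.1 m) (p.2.1 m) := by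
    have hA : Measurable fun p : (Fin M → Matrix (Fin dx) (Fin dx) ℝ) ×
      (Fin M → Matrix (Fin dx) (Fin du) ℝ) × (Fin M → Matrix (Fin dx) (Fin M × Fin dx) ℝ) ×
      (Fin M → Matrix (Fin dx) (Fin M × Fin du) ℝ) => p.1 m :=
      (measurable_pi_apply m).comp measurable_fst
    have hB : Measurable fun p : (Fin M → Matrix (Fin dx) (Fin dx) ℝ) ×
      (Fin M → Matrix (Fin dx) (Fin du) ℝ) × (Fin M → Matrix (Fin dx) (Fin M × Fin dx) ℝ) ×
      (Fin M → Matrix (Fin dx) (Fin M × Fin du) ℝ) => p.2.1 m :=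
      (measurable_pi_apply m).comp (measurable_fst.comp measurable_snd)
    have hc : Continuous fun q : Matrix (Fin dx) (Fin dx) ℝ × Matrix (Fin dx) (Fin du) ℝ =>
        mkParam q.1 q.2 := by
      refine Continuous.matrix_transpose (continuous_pi fun a => continuous_pi fun b => ?_)
      rcases b with b | b
      · exact (continuous_apply_apply a b).comp continuous_fst
      · exact (continuous_apply_apply a b).comp continuous_snd
    exact hc.measurable.comp (hA.prodMk hB)
  rintro _ ⟨S, hS, rfl⟩
  exact ⟨_, hg hS, rfl⟩

omit [NeZero n] mΩ in
lemma hist_le_relPast (m : Fin M) (t τ : ℕ) (s : ℕ) (hτ : τ ≤ s) :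
    r.hist m t τ ≤ r.relPast m s := by
  refine sup_le (sup_le ?_ ?_) ?_
  · exact le_sup_of_le_left (le_sup_of_le_left (le_sup_of_le_right
      (iSup₂_le fun s _ => le_iSup (fun s => MeasurableSpace.comap (r.noise s) inferInstance) s)))
  · exact le_sup_of_le_left (le_sup_of_le_left (le_sup_of_le_left (relParam_comap_le m)))
  · refine le_sup_of_le_left (le_sup_of_le_right (iSup₂_le fun u hu => ?_))
    have hu2 : u < s := lt_of_lt_of_le hu.2 hτ
    refine le_iSup₂_of_le (f := fun (p : Fin M × ℕ)
      (_ : p ∈ {p : Fin M × ℕ | p.2 ≤ s ∧ p ≠ (m, s)}) =>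
        MeasurableSpace.comap (r.relSample p.1 p.2) inferInstance) (m, u) ⟨hu2.le, ?_⟩ le_rfl
    intro h
    have := (Prod.mk.injEq _ _ _ _ ▸ h : _ ∧ _).2
    omega

/-- The noise of the agents of type `m` at time `t`. -/
@[reducible] def noiseAt (r : Run M n dx du Ω) (m : Fin M) (t : ℕ) : MeasurableSpace Ω :=
  ⨆ s ∈ {s | ∃ i, s = Sum.inr (Sum.inl (m, i, t))},
    MeasurableSpace.comap (r.noise s) inferInstance

namespace IsTSDEMF

variable [IsProbabilityMeasure P] (hr : r.IsTSDEMF 𝒯 P) (h𝒯 : 𝒯.Assumptions)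
include hr h𝒯

omit h𝒯 [NeZero n] in
lemma measurable_relParam (m : Fin M) : Measurable (r.relParam m) :=
  Measurable.of_comap_le ((relParam_comap_le m).trans hr.params_measurable.comap_le)

omit h𝒯 [NeZero n] in
/-- Before the first sample, the history consists of the parameter, the initial states and the
noises before `t`, all independent of the noises at `t`. -/
lemma indep_noiseAt_hist_one (m : Fin M) (t : ℕ) : Indep (r.noiseAt m t) (r.hist m t 1) P := by
  set A := {s : (Fin M × Fin n) ⊕ (Fin M × Fin n × ℕ) ⊕ (Fin M × ℕ) ⊕ ℕ |
    ∃ i, s = Sum.inr (Sum.inl (m, i, t))}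
  set B := {s : (Fin M × Fin n) ⊕ (Fin M × Fin n × ℕ) ⊕ (Fin M × ℕ) ⊕ ℕ |
    (∃ i, s = Sum.inl (m, i)) ∨ ∃ i, ∃ u < t, s = Sum.inr (Sum.inl (m, i, u))}
  have hdisj : Disjoint A B := by
    rw [Set.disjoint_left]
    rintro s ⟨i, rfl⟩ (⟨i', h⟩ | ⟨i', u, hu, h⟩)
    · simp at h
    · simp at h
      omega
  have h1 : Indep (⨆ s ∈ A, MeasurableSpace.comap (r.noise s) inferInstance)
      (⨆ s ∈ B, MeasurableSpace.comap (r.noise s) inferInstance) P :=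
    indep_iSup_of_disjoint (fun s => (hr.noise_measurable s).comap_le) hr.noise_indep hdisj
  have hle : (⨆ s, MeasurableSpace.comap (r.noise s) inferInstance) ≤ mΩ :=
    iSup_le fun s => (hr.noise_measurable s).comap_le
  have h2 : Indep (MeasurableSpace.comap (r.relParam m) inferInstance)
      (⨆ s, MeasurableSpace.comap (r.noise s) inferInstance) P := by
    refine indep_of_indep_of_le_left ?_ (relParam_comap_le m)
    have h3 := (IndepFun_iff_Indep _ _ _).1 hr.params_indep
    refine indep_of_indep_of_le_right h3 (iSup_le fun s => ?_)
    rintro _ ⟨S, hS, rfl⟩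
    exact ⟨(fun f => f s) ⁻¹' S, measurable_pi_apply s hS, rfl⟩
  have hbot : ∀ S : Set (Param (Fin dx) (Fin du)), MeasurableSet S →
      P⟦r.relParam m ⁻¹' S | ⨆ s, MeasurableSpace.comap (r.noise s) inferInstance⟧
        =ᵐ[P] P⟦r.relParam m ⁻¹' S | ⊥⟧ := by
    intro S hS
    rw [condExp_bot]
    refine condExp_indep_eq (hr.measurable_relParam m).comap_le hle ?_ h2
    exact StronglyMeasurable.indicator stronglyMeasurable_const ⟨S, hS, rfl⟩
  have h4 := indep_sup_comap_sample (past := ⨆ s, MeasurableSpace.comap (r.noise s) inferInstance)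
    hle (iSup₂_le fun s _ => le_iSup (fun s => MeasurableSpace.comap (r.noise s) inferInstance) s)
    (iSup₂_le fun s _ => le_iSup (fun s => MeasurableSpace.comap (r.noise s) inferInstance) s)
    bot_le h1 (hr.measurable_relParam m) hbot
  have h5 : r.hist m t 1 = (⨆ s ∈ B, MeasurableSpace.comap (r.noise s) inferInstance) ⊔
      MeasurableSpace.comap (r.relParam m) inferInstance := by
    unfold hist
    simp
    rfl
  rw [h5]
  exact h4

/-- The noise at time `t` is independent of the history up to and including the sample of
time `t`. -/
lemma indep_noiseAt_hist (m : Fin M) (t : ℕ) : Indep (r.noiseAt m t) (r.hist m t (t + 1)) P := by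
  suffices h : ∀ τ, 1 ≤ τ → τ ≤ t + 1 → Indep (r.noiseAt m t) (r.hist m t τ) P from
    h (t + 1) (by omega) le_rfl
  intro τ hτ
  induction τ, hτ using Nat.le_induction with
  | base => exact fun _ => hr.indep_noiseAt_hist_one m t
  | succ τ hτ ih =>
    intro h
    rw [hist_succ m t hτ]
    refine indep_sup_comap_sample (past := r.relPast m τ) (info := r.relInfo 𝒯 m τ)
      (hr.relPast_le m τ) ?_ (hist_le_relPast m t τ τ le_rfl)
      ((hr.relInfo_le_hist h𝒯 m τ).trans (hist_mono m (by omega) le_rfl)) (ih (by omega))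
      (hr.relSample_measurable m τ) (hr.relSampling m τ hτ)
    exact le_sup_of_le_left (le_sup_of_le_left (le_sup_of_le_right
      (iSup₂_le fun s _ => le_iSup (fun s => MeasurableSpace.comap (r.noise s) inferInstance) s)))

omit h𝒯 [NeZero n] in
lemma hist_le (m : Fin M) (t τ : ℕ) : r.hist m t τ ≤ mΩ :=
  (hist_le_relPast m t τ τ le_rfl).trans (hr.relPast_le m τ)

/-- The sample of time `t` and the parameter have the same joint law with the data of the actor. -/
lemma map_prodMk_relSample (m : Fin M) {t : ℕ} (ht : 1 ≤ t) {γ : Type*} [MeasurableSpace γ]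
    {I : Ω → γ} (hI : Measurable[r.relInfo 𝒯 m t] I) :
    P.map (fun ω => (I ω, r.relSample m t ω)) = P.map (fun ω => (I ω, r.relParam m ω)) :=
  map_prodMk_sample (hr.relPast_le m t)
    ((hr.relInfo_le_hist h𝒯 m t).trans (hist_le_relPast m t t t le_rfl))
    (hr.relSample_measurable m t) (hr.measurable_relParam m) (hr.relSampling m t ht) hI

end IsTSDEMF

end Run

/-! ### Laws of the noises of the relative systems -/

section Center

variable {n : ℕ} [NeZero n]

/-- The weight of agent `j` in the relative variable of agent `i`. -/
noncomputable def relWeight (i j : Fin n) : ℝ := (if j = i then 1 else 0) - 1 / (n : ℝ)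

lemma sum_relWeight_mul (i : Fin n) (f : Fin n → ℝ) :
    ∑ j, relWeight i j * f j = f i - (1 / (n : ℝ)) * ∑ j, f j := by
  simp [relWeight, sub_mul, Finset.sum_sub_distrib, Finset.mul_sum]

lemma sum_relWeight_sq (i : Fin n) : ∑ j, relWeight i j ^ 2 = 1 - 1 / (n : ℝ) := by
  have hn : (n : ℝ) ≠ 0 := Nat.cast_ne_zero.2 (NeZero.ne n)
  have h1 : ∀ j, relWeight i j ^ 2 = relWeight i j * relWeight i j := fun j => sq _
  simp only [h1]
  rw [sum_relWeight_mul]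
  have h2 : ∑ j, relWeight i j = 0 := by
    have := sum_relWeight_mul i (fun _ => (1 : ℝ))
    simp only [mul_one] at this
    rw [this]
    simp [hn]
  rw [h2]
  simp [relWeight]

end Center

lemma measurable_column {ι υ : Type} {Ω' : Type*} {_mΩ' : MeasurableSpace Ω'}
    {θ : Ω' → Param ι υ} (l : ι) (hθ : Measurable θ) : Measurable fun ω q => θ ω q l :=
  measurable_of_eval fun q => (measurable_pi_apply l).comp ((measurable_pi_apply q).comp hθ)

namespace Run

variable {M n dx du : ℕ} {Ω : Type*} {r : Run M n dx du Ω} {𝒯 : Team M n dx du}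
variable [mΩ : MeasurableSpace Ω] {P : Measure Ω} [NeZero n] [IsProbabilityMeasure P]

lemma relVar_nonneg : 0 ≤ 𝒯.relVar := by
  have hn : (1 : ℝ) ≤ n := by exact_mod_cast Nat.one_le_iff_ne_zero.2 (NeZero.ne n)
  have h : 0 ≤ 1 - 1 / (n : ℝ) := sub_nonneg.2 ((div_le_one (by linarith)).2 hn)
  exact mul_nonneg h (sq_nonneg _)

namespace IsTSDEMF

variable (hr : r.IsTSDEMF 𝒯 P)
include hr

/-- Relative combinations of independent centred Gaussian vectors. -/
lemma map_sum_relWeight_dotProduct {X : Fin n → Ω → EuclideanSpace ℝ (Fin dx)}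
    (hX : ∀ j, Measurable (X j)) (hind : iIndepFun X P) {S : Fin n → Matrix (Fin dx) (Fin dx) ℝ}
    (hS : ∀ j, (S j).PosSemidef) (hlaw : ∀ j, P.map (X j) = multivariateGaussian 0 (S j))
    (i : Fin n) (c : Fin dx → ℝ) :
    P.map (fun ω => c ⬝ᵥ fun a => (X i ω).ofLp a - (1 / (n : ℝ)) * ∑ j, (X j ω).ofLp a) =
      gaussianReal 0 (∑ j, Real.toNNReal (relWeight i j ^ 2) * Real.toNNReal (quad (S j) c)) := by
  have hm : Measurable fun x : EuclideanSpace ℝ (Fin dx) => c ⬝ᵥ x.ofLp := by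
    simp only [dotProduct]
    fun_prop
  rw [← map_sum_mul_gaussian (X := fun j ω => c ⬝ᵥ (X j ω).ofLp) (fun j => hm.comp (hX j))
    (fun j => map_dotProduct_multivariateGaussian (hS j) (hX j) (hlaw j) c)
    (hind.comp (fun _ x => c ⬝ᵥ x.ofLp) fun _ => hm)]
  congr 1
  ext ω
  rw [sum_relWeight_mul]
  have h : (fun a => (X i ω).ofLp a - (1 / (n : ℝ)) * ∑ j, (X j ω).ofLp a) =
      (X i ω).ofLp - (1 / (n : ℝ)) • ∑ j, (X j ω).ofLp := by
    ext a; simp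
  rw [h, dotProduct_sub, dotProduct_smul, dotProduct_sum, smul_eq_mul]

/-- The noise of agent `i` relative to the average has variance `(1 - 1 / n) σ_w²`. -/
lemma map_dotProduct_wrel (m : Fin M) (i : Fin n) (t : ℕ) (c : Fin dx → ℝ) :
    P.map (fun ω => c ⬝ᵥ r.wrel m i t ω) =
      gaussianReal 0 (Real.toNNReal (𝒯.relVar * (c ⬝ᵥ c))) := by
  have hinj : Function.Injective fun j : Fin n =>
      (Sum.inr (Sum.inl (m, j, t)) : (Fin M × Fin n) ⊕ (Fin M × Fin n × ℕ) ⊕ (Fin M × ℕ) ⊕ ℕ) := by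
    intro j j' h; simpa using h
  have hS : ((𝒯.σw ^ 2 • 1 : Matrix (Fin dx) (Fin dx) ℝ)).PosSemidef :=
    Matrix.PosSemidef.one.smul (sq_nonneg _)
  have h1 := hr.map_sum_relWeight_dotProduct (X := fun j => r.w m j t)
    (fun j => hr.noise_measurable (Sum.inr (Sum.inl (m, j, t))))
    (hr.noise_indep.precomp hinj) (fun _ => hS) (fun j => hr.law_w m j t) i c
  refine h1.trans ?_
  congr 1
  ext
  have hc := dotProduct_self_nonneg' c
  push_cast
  rw [quad_smul_mat, quad_one, ← Finset.sum_mul, Real.coe_toNNReal _ (by positivity),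
    Real.coe_toNNReal _ (mul_nonneg relVar_nonneg hc)]
  have h2 : ∑ j, ((relWeight i j ^ 2).toNNReal : ℝ) = ∑ j, relWeight i j ^ 2 :=
    Finset.sum_congr rfl fun j _ => Real.coe_toNNReal _ (sq_nonneg _)
  rw [h2, sum_relWeight_sq, Team.relVar]
  ring

/-- The initial covariances may differ between the agents, so the variance is only bounded. -/
lemma map_dotProduct_xrel_one (h𝒯 : 𝒯.Assumptions) {m : Fin M} {κ : ℝ}
    (hκ : 𝒯.BoundedBy m κ) (i : Fin n) (c : Fin dx → ℝ) :
    ∃ v ≤ Real.toNNReal (κ * 𝒯.relVar * (c ⬝ᵥ c)),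
      P.map (fun ω => c ⬝ᵥ r.xrel m i 1 ω) = gaussianReal 0 v := by
  have hinj : Function.Injective fun j : Fin n =>
      (Sum.inl (m, j) : (Fin M × Fin n) ⊕ (Fin M × Fin n × ℕ) ⊕ (Fin M × ℕ) ⊕ ℕ) := by
    intro j j' h; simpa using h
  have hi : iIndepFun (fun j => r.noise (Sum.inl (m, j))) P :=
    iIndepFun.precomp (g := fun j : Fin n => (Sum.inl (m, j) :
      (Fin M × Fin n) ⊕ (Fin M × Fin n × ℕ) ⊕ (Fin M × ℕ) ⊕ ℕ)) hinj hr.noise_indep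
  have h1 := hr.map_sum_relWeight_dotProduct (X := fun j => r.x₁ m j)
    (fun j => hr.noise_measurable (Sum.inl (m, j))) hi (h𝒯.initCov_posSemidef m)
    (fun j => hr.law_x₁ m j) i c
  have hx : (fun ω => c ⬝ᵥ r.xrel m i 1 ω) = fun ω =>
      c ⬝ᵥ fun a => (r.x₁ m i ω).ofLp a - (1 / (n : ℝ)) * ∑ j, (r.x₁ m j ω).ofLp a := by
    ext ω
    congr 1
    ext a
    exact hr.xrel_one m i ω a
  rw [hx]
  refine ⟨_, ?_, h1⟩
  have hc := dotProduct_self_nonneg' c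
  have hκ0 : 0 ≤ κ := zero_le_one.trans hκ.one_le
  rw [← NNReal.coe_le_coe]
  push_cast
  rw [Real.coe_toNNReal _ (mul_nonneg (mul_nonneg hκ0 relVar_nonneg) hc)]
  have h2 : ∀ j, ((relWeight i j ^ 2).toNNReal : ℝ) * ((quad (𝒯.initCov m j) c).toNNReal : ℝ) ≤
      relWeight i j ^ 2 * (κ * 𝒯.σw ^ 2 * (c ⬝ᵥ c)) := by
    intro j
    rw [Real.coe_toNNReal _ (sq_nonneg _),
      Real.coe_toNNReal _ (quad_nonneg (h𝒯.initCov_posSemidef m j) c)]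
    have h3 := quad_le_of_sub_posSemidef (hκ.initCov_upper j) c
    rw [quad_smul_mat, quad_one] at h3
    exact mul_le_mul_of_nonneg_left h3 (sq_nonneg _)
  refine (Finset.sum_le_sum fun j _ => h2 j).trans_eq ?_
  rw [← Finset.sum_mul, sum_relWeight_sq, Team.relVar]
  ring

end IsTSDEMF

/-- The initial relative state and the relative noises, as one sequence. -/
noncomputable def relNoise (r : Run M n dx du Ω) (m : Fin M) (i : Fin n) (t : ℕ) (ω : Ω) :
    Fin dx → ℝ :=
  if t = 0 then r.xrel m i 1 ω else r.wrel m i t ω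

namespace IsTSDEMF

variable (hr : r.IsTSDEMF 𝒯 P) (h𝒯 : 𝒯.Assumptions)
include hr h𝒯

lemma measurable_xrel (m : Fin M) (i : Fin n) {t : ℕ} (ht : 1 ≤ t) : Measurable (r.xrel m i t) :=
  (hr.measurable_hist_xrel h𝒯 m i ht).mono (hr.hist_le m t t) le_rfl

omit h𝒯 in
lemma measurable_wrel (m : Fin M) (i : Fin n) (t : ℕ) : Measurable (r.wrel m i t) :=
  Run.measurable_wrel i fun j => hr.noise_measurable (Sum.inr (Sum.inl (m, j, t)))

lemma measurable_relNoise (m : Fin M) (i : Fin n) (t : ℕ) : Measurable (r.relNoise m i t) := by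
  unfold relNoise
  by_cases h : t = 0
  · simp only [h, if_true]
    exact hr.measurable_xrel h𝒯 m i le_rfl
  · simp only [h, if_false]
    exact hr.measurable_wrel m i t

lemma lintegral_exp_relNoise_le {m : Fin M} {κ : ℝ} (hκ : 𝒯.BoundedBy m κ)
    (hpos : 0 < 𝒯.relVar) (i : Fin n) (t : ℕ) (a : Fin dx) :
    ∫⁻ ω, ENNReal.ofReal (Real.exp (r.relNoise m i t ω a ^ 2 / (4 * (κ * 𝒯.relVar)))) ∂P ≤
      ENNReal.ofReal (Real.sqrt 2) := by
  have hκ0 : 0 < κ := zero_lt_one.trans_le hκ.one_le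
  have hm := hr.measurable_relNoise h𝒯 m i t
  have hlaw : ∃ v ≤ Real.toNNReal (κ * 𝒯.relVar),
      P.map (fun ω => r.relNoise m i t ω a) = gaussianReal 0 v := by
    have e : (Pi.single a 1 : Fin dx → ℝ) ⬝ᵥ Pi.single a 1 = 1 := by simp
    by_cases h : t = 0
    · obtain ⟨v, hv, hl⟩ := hr.map_dotProduct_xrel_one h𝒯 hκ i (Pi.single a 1)
      rw [e, mul_one] at hv
      refine ⟨v, hv, ?_⟩
      rw [← hl]
      simp [relNoise, h]
    · have hl := hr.map_dotProduct_wrel m i t (Pi.single a 1)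
      rw [e, mul_one] at hl
      refine ⟨Real.toNNReal 𝒯.relVar, Real.toNNReal_le_toNNReal (by nlinarith [hκ.one_le]), ?_⟩
      rw [← hl]
      simp [relNoise, h]
  obtain ⟨v, hv, hl⟩ := hlaw
  have h1 := lintegral_exp_sq_gaussian_le hv
  rw [← hl, lintegral_map (by fun_prop)
      (show Measurable fun ω => r.relNoise m i t ω a from (measurable_pi_apply a).comp hm),
    Real.coe_toNNReal _ (by positivity)] at h1
  exact h1

omit h𝒯 in
lemma measurable_noiseAt_wrel (m : Fin M) (i : Fin n) (t : ℕ) :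
    Measurable[r.noiseAt m t] (r.wrel m i t) := by
  refine Run.measurable_wrel i fun j => Measurable.of_comap_le ?_
  exact le_iSup₂_of_le (f := fun s (_ : s ∈ {s | ∃ i, s = Sum.inr (Sum.inl (m, i, t))}) =>
    MeasurableSpace.comap (r.noise s) inferInstance) (Sum.inr (Sum.inl (m, j, t))) ⟨j, rfl⟩ le_rfl

lemma indep_wrel_hist (m : Fin M) (i : Fin n) (t : ℕ) :
    Indep (MeasurableSpace.comap (r.wrel m i t) inferInstance) (r.hist m t (t + 1)) P :=
  indep_of_indep_of_le_left (hr.indep_noiseAt_hist h𝒯 m t)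
    (hr.measurable_noiseAt_wrel m i t).comap_le

/-! ### The support of the parameter and of the samples -/

omit [NeZero n] in
lemma ae_relParam_mem (m : Fin M) : ∀ᵐ ω ∂P, r.relParam m ω ∈ 𝒯.relSet m := by
  have hS : MeasurableSet (𝒯.relSet m) := (h𝒯.relSet_compact m).measurableSet
  have h1 : P.map (r.relParam m) (𝒯.relSet m)ᶜ = 0 := by
    rw [hr.relPrior m, truncGaussian, ProbabilityTheory.cond_apply hS]
    simp
  rw [Measure.map_apply (hr.measurable_relParam m) hS.compl] at h1
  exact h1

/-- A sample has the law of the parameter, so it has the same support. -/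
lemma ae_relSample_mem (m : Fin M) {t : ℕ} (ht : 1 ≤ t) :
    ∀ᵐ ω ∂P, r.relSample m t ω ∈ 𝒯.relSet m := by
  have hS : MeasurableSet (𝒯.relSet m) := (h𝒯.relSet_compact m).measurableSet
  have h1 := hr.map_prodMk_relSample h𝒯 m ht (I := fun _ => ()) measurable_const
  have h2 : P.map (r.relSample m t) = P.map (r.relParam m) := by
    have h3 := congrArg (fun μ => μ.map Prod.snd) h1
    rw [Measure.map_map measurable_snd (measurable_const.prodMk (hr.relSample_measurable m t)),
      Measure.map_map measurable_snd (measurable_const.prodMk (hr.measurable_relParam m))] at h3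
    exact h3
  have h3 : P (r.relParam m ⁻¹' (𝒯.relSet m)ᶜ) = 0 := hr.ae_relParam_mem h𝒯 m
  rw [← Measure.map_apply (hr.measurable_relParam m) hS.compl, ← h2,
    Measure.map_apply (hr.relSample_measurable m t) hS.compl] at h3
  exact h3

/-! ### The data of a relative actor -/

/-- The regressors of the selected agents and their successor states are known to the actor. -/
lemma measurable_relInfo_data (m : Fin M) {t s : ℕ} (h1 : 1 ≤ s) (h2 : s < t) :
    (Measurable[r.relInfo 𝒯 m t] fun ω => r.zrel m (r.j 𝒯 m s ω) s ω) ∧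
      Measurable[r.relInfo 𝒯 m t] fun ω => r.xrel m (r.j 𝒯 m s ω) (s + 1) ω := by
  have h : Measurable[r.relInfo 𝒯 m t] (fun ω => (r.xrel m (r.j 𝒯 m s ω) s ω,
      r.urel m (r.j 𝒯 m s ω) s ω, r.xrel m (r.j 𝒯 m s ω) (s + 1) ω)) :=
    Measurable.of_comap_le (le_iSup₂_of_le (f := fun s (_ : s ∈ Set.Ico 1 t) =>
      MeasurableSpace.comap (fun ω => (r.xrel m (r.j 𝒯 m s ω) s ω, r.urel m (r.j 𝒯 m s ω) s ω,
        r.xrel m (r.j 𝒯 m s ω) (s + 1) ω)) inferInstance) s ⟨h1, h2⟩ le_rfl)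
  exact ⟨measurable_sumElim (measurable_fst.comp h) (measurable_fst.comp (measurable_snd.comp h)),
    measurable_snd.comp (measurable_snd.comp h)⟩

lemma measurable_relInfo_relCovAt (m : Fin M) {t s : ℕ} (h1 : 1 ≤ s) (h2 : s ≤ t) :
    Measurable[r.relInfo 𝒯 m t] fun ω => r.relCovAt 𝒯 m ω s := by
  induction s, h1 using Nat.le_induction with
  | base => exact measurable_const
  | succ s h1 ih =>
    simp only [relCovAt_succ m _ h1]
    exact measurable_covUpdate (ih (by omega)) (hr.measurable_relInfo_data h𝒯 m h1 (by omega)).1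

lemma measurable_relInfo_relDet (m : Fin M) {t s : ℕ} (h2 : s ≤ t) :
    Measurable[r.relInfo 𝒯 m t] fun ω => r.relDet 𝒯 m ω s := by
  rcases Nat.eq_zero_or_pos s with rfl | h0
  · exact (measurable_const : Measurable[r.relInfo 𝒯 m t] fun _ => (𝒯.relCov m).det)
  · exact measurable_det (hr.measurable_relInfo_relCovAt h𝒯 m h0 h2)

omit hr [NeZero n] mΩ [IsProbabilityMeasure P] in
lemma _root_.MeanFieldTeam.Run.isCovSeq (m : Fin M) (hpos : 0 < 𝒯.relVar) (ω : Ω) :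
    IsCovSeq 𝒯.relVar (fun t => r.zrel m (r.j 𝒯 m t ω) t ω) (r.relCovAt 𝒯 m ω) :=
  isCovSeq_covSeq hpos (h𝒯.relCov_posDef m)
    (fun s S => r.zrel m (r.select 𝒯 m s S ω) s ω)

end IsTSDEMF

/-! ### The self-normalised process -/

/-- The precision-weighted estimate of column `l` of the parameter with prior mean zero: the sum of
the regressors weighted by the responses. -/
noncomputable def response (r : Run M n dx du Ω) (𝒯 : Team M n dx du) (m : Fin M) (l : Fin dx)
    (t : ℕ) (ω : Ω) : Fin dx ⊕ Fin du → ℝ :=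
  ∑ u ∈ Finset.Ico 1 t, (r.xrel m (r.j 𝒯 m u ω) (u + 1) ω l / 𝒯.relVar) •
    r.zrel m (r.j 𝒯 m u ω) u ω

/-- The precision-weighted error of that estimate if the parameter were `θ`. -/
noncomputable def score (r : Run M n dx du Ω) (𝒯 : Team M n dx du) (m : Fin M) (l : Fin dx)
    (t : ℕ) (θ : Param (Fin dx) (Fin du)) (ω : Ω) : Fin dx ⊕ Fin du → ℝ :=
  r.response 𝒯 m l t ω - (r.relCovAt 𝒯 m ω t)⁻¹ *ᵥ fun q => θ q l

/-- The exponential of the self-normalised error, compensated by the shrinkage of the determinant;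
at the true parameter this is a nonnegative martingale. -/
noncomputable def expScore (r : Run M n dx du Ω) (𝒯 : Team M n dx du) (m : Fin M) (l : Fin dx)
    (t : ℕ) (θ : Param (Fin dx) (Fin du)) (ω : Ω) : ℝ :=
  Real.exp (quad (r.relCovAt 𝒯 m ω t) (r.score 𝒯 m l t θ ω) / 2) *
    Real.sqrt ((r.relCovAt 𝒯 m ω t).det / (r.relCovAt 𝒯 m ω 1).det)

omit [NeZero n] mΩ in
lemma expScore_pos (h𝒯 : 𝒯.Assumptions) (hpos : 0 < 𝒯.relVar) (m : Fin M) (l : Fin dx) {t : ℕ}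
    (ht : 1 ≤ t) (θ : Param (Fin dx) (Fin du)) (ω : Ω) : 0 < r.expScore 𝒯 m l t θ ω := by
  have hc := Run.isCovSeq (r := r) h𝒯 m hpos ω
  have h1 := (hc.posDef ht).det_pos
  have h2 := hc.posDef_one.det_pos
  unfold expScore
  positivity

omit [NeZero n] mΩ in
/-- The self-normalised error in terms of the exponential process. -/
lemma quad_score_eq (h𝒯 : 𝒯.Assumptions) (hpos : 0 < 𝒯.relVar) (m : Fin M) (l : Fin dx) {t : ℕ}
    (ht : 1 ≤ t) (θ : Param (Fin dx) (Fin du)) (ω : Ω) :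
    quad (r.relCovAt 𝒯 m ω t) (r.score 𝒯 m l t θ ω) =
      logDetGain (r.relCovAt 𝒯 m ω) t + 2 * Real.log (r.expScore 𝒯 m l t θ ω) := by
  have hc := Run.isCovSeq (r := r) h𝒯 m hpos ω
  have h1 := (hc.posDef ht).det_pos
  have h2 := hc.posDef_one.det_pos
  unfold expScore logDetGain
  rw [Real.log_mul (Real.exp_pos _).ne' (Real.sqrt_pos.2 (by positivity)).ne', Real.log_exp,
    Real.log_sqrt (by positivity), Real.log_div h1.ne' h2.ne', Real.log_div h2.ne' h1.ne']
  ring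

namespace IsTSDEMF

variable (hr : r.IsTSDEMF 𝒯 P) (h𝒯 : 𝒯.Assumptions)
include hr h𝒯

lemma measurable_relInfo_response (m : Fin M) (l : Fin dx) (t : ℕ) :
    Measurable[r.relInfo 𝒯 m t] (r.response 𝒯 m l t) := by
  have h : ∀ u ∈ Finset.Ico 1 t, Measurable[r.relInfo 𝒯 m t] fun ω =>
      (r.xrel m (r.j 𝒯 m u ω) (u + 1) ω l / 𝒯.relVar) • r.zrel m (r.j 𝒯 m u ω) u ω := by
    intro u hu
    obtain ⟨h1, h2⟩ := Finset.mem_Ico.1 hu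
    obtain ⟨h3, h4⟩ := hr.measurable_relInfo_data h𝒯 m h1 h2
    exact (((measurable_pi_apply l).comp h4).div_const _).smul h3
  exact Finset.measurable_fun_sum _ h

omit h𝒯 in
lemma score_succ (hpos : 0 < 𝒯.relVar) (h𝒯 : 𝒯.Assumptions) (m : Fin M) (l : Fin dx) {t : ℕ}
    (ht : 1 ≤ t) (ω : Ω) :
    r.score 𝒯 m l (t + 1) (r.relParam m ω) ω = r.score 𝒯 m l t (r.relParam m ω) ω +
      (r.wrel m (r.j 𝒯 m t ω) t ω l / 𝒯.relVar) • r.zrel m (r.j 𝒯 m t ω) t ω := by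
  have hc := Run.isCovSeq (r := r) h𝒯 m hpos ω
  unfold score response
  rw [relCovAt_succ m ω ht, inv_covUpdate_mulVec hpos (hc.posDef ht), Finset.sum_Ico_succ_top ht,
    hr.xrel_succ m _ ht ω]
  have h : ((r.relParam m ω)ᵀ *ᵥ r.zrel m (r.j 𝒯 m t ω) t ω) l =
      r.zrel m (r.j 𝒯 m t ω) t ω ⬝ᵥ fun q => r.relParam m ω q l := by
    simp only [mulVec, dotProduct, transpose_apply]
    exact Finset.sum_congr rfl fun q _ => mul_comm _ _
  rw [Pi.add_apply, h, add_div, add_smul]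
  abel

/-- The martingale property. Regressor, covariance and selection are determined by the history up to
`t`, and the noise of the selected agent is integrated out; its Gaussian integral
cancels the change of the determinant factor. -/
lemma lintegral_expScore_succ (hpos : 0 < 𝒯.relVar) (m : Fin M) (l : Fin dx) {t : ℕ}
    (ht : 1 ≤ t) :
    ∫⁻ ω, ENNReal.ofReal (r.expScore 𝒯 m l (t + 1) (r.relParam m ω) ω) ∂P =
      ∫⁻ ω, ENNReal.ofReal (r.expScore 𝒯 m l t (r.relParam m ω) ω) ∂P := by
  set s := 𝒯.relVar with hs
  -- the data of the step: the current value, and the two coefficients of the noise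
  let z : Ω → Fin dx ⊕ Fin du → ℝ := fun ω => r.zrel m (r.j 𝒯 m t ω) t ω
  let F : Ω → ℝ := fun ω => r.expScore 𝒯 m l t (r.relParam m ω) ω
  let c : Ω → ℝ := fun ω =>
    z ω ⬝ᵥ (r.relCovAt 𝒯 m ω t *ᵥ r.score 𝒯 m l t (r.relParam m ω) ω)
  let h : Ω → ℝ := fun ω => quad (r.relCovAt 𝒯 m ω t) (z ω)
  have hle := hist_mono (r := r) m le_rfl (Nat.le_succ t) (t := t)
  have hScov : Measurable[r.hist m t (t + 1)] fun ω => r.relCovAt 𝒯 m ω t :=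
    (hr.measurable_hist_relCovAt h𝒯 m ht).mono hle le_rfl
  have hj := hr.measurable_hist_j h𝒯 m ht
  have hz : Measurable[r.hist m t (t + 1)] z :=
    measurable_eval_finite (f := fun i => r.zrel m i t) hj
      fun i => hr.measurable_hist_zrel h𝒯 m i ht
  have hθ : Measurable[r.hist m t (t + 1)] (r.relParam m) := measurable_hist_param m _ _
  have hθl : Measurable[r.hist m t (t + 1)] fun ω q => r.relParam m ω q l :=
    measurable_column l hθ
  have hscore : Measurable[r.hist m t (t + 1)] fun ω => r.score 𝒯 m l t (r.relParam m ω) ω :=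
    ((hr.measurable_relInfo_response h𝒯 m l t).mono
      ((hr.relInfo_le_hist h𝒯 m t).trans hle) le_rfl).sub
      (measurable_mulVec (measurable_matrix_inv hScov) hθl)
  have hF : Measurable[r.hist m t (t + 1)] F :=
    (Real.measurable_exp.comp ((measurable_quad hScov hscore).div_const 2)).mul
      ((measurable_det hScov).div_const (𝒯.relCov m).det).sqrt
  have hc : Measurable[r.hist m t (t + 1)] c :=
    measurable_dotProduct hz (measurable_mulVec hScov hscore)
  have hh : Measurable[r.hist m t (t + 1)] h := measurable_quad hScov hz
  let φ : (ℝ × ℝ × ℝ) × ℝ → ENNReal := fun p =>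
    ENNReal.ofReal (p.1.1 * (Real.sqrt (1 + p.1.2.2 / s))⁻¹) *
      ENNReal.ofReal (Real.exp ((p.2 ^ 2 / s - (p.2 - p.1.2.1) ^ 2 / (s + p.1.2.2)) / 2))
  have hφ : Measurable φ := by fun_prop
  have hcov := fun ω => Run.isCovSeq (r := r) h𝒯 m hpos ω
  have hh0 : ∀ ω, 0 ≤ h ω := fun ω => quad_nonneg ((hcov ω).posDef ht).posSemidef _
  have hstep : ∀ ω, ENNReal.ofReal (r.expScore 𝒯 m l (t + 1) (r.relParam m ω) ω) =
      φ ((F ω, c ω, h ω), r.wrel m (r.j 𝒯 m t ω) t ω l) := by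
    intro ω
    have hFpos : 0 < F ω := expScore_pos h𝒯 hpos m l ht _ ω
    have h0 := hh0 ω
    simp only [φ]
    rw [← ENNReal.ofReal_mul (by positivity)]
    congr 1
    have hdet := (hcov ω).det_succ ht
    have hq : quad (r.relCovAt 𝒯 m ω t) (r.zrel m (r.j 𝒯 m t ω) t ω) = h ω := rfl
    rw [hq] at hdet
    have hp1 : 0 < 1 + h ω / 𝒯.relVar := by positivity
    unfold expScore
    rw [hr.score_succ hpos h𝒯 m l ht, relCovAt_succ m ω ht,
      quad_covUpdate_add_smul hpos ((hcov ω).posDef ht), ← relCovAt_succ m ω ht,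
      eq_div_of_mul_eq hp1.ne' hdet, div_right_comm, Real.sqrt_div' _ hp1.le]
    have e : (quad (r.relCovAt 𝒯 m ω t) (r.score 𝒯 m l t (r.relParam m ω) ω) +
        r.wrel m (r.j 𝒯 m t ω) t ω l ^ 2 / 𝒯.relVar -
        (r.wrel m (r.j 𝒯 m t ω) t ω l - r.zrel m (r.j 𝒯 m t ω) t ω ⬝ᵥ
          (r.relCovAt 𝒯 m ω t *ᵥ r.score 𝒯 m l t (r.relParam m ω) ω)) ^ 2 /
          (𝒯.relVar + quad (r.relCovAt 𝒯 m ω t) (r.zrel m (r.j 𝒯 m t ω) t ω))) / 2 =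
        quad (r.relCovAt 𝒯 m ω t) (r.score 𝒯 m l t (r.relParam m ω) ω) / 2 +
        (r.wrel m (r.j 𝒯 m t ω) t ω l ^ 2 / s -
          (r.wrel m (r.j 𝒯 m t ω) t ω l - c ω) ^ 2 / (s + h ω)) / 2 := by
      simp only [c, h, z, hs]
      ring
    rw [e, Real.exp_add]
    simp only [F, expScore]
    rw [div_eq_mul_inv]
    ring
  have hlaw : ∀ i, P.map (fun ω => r.wrel m i t ω l) = gaussianReal 0 (Real.toNNReal s) := by
    intro i
    have h1 := hr.map_dotProduct_wrel m i t (Pi.single l 1)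
    have e : (Pi.single l 1 : Fin dx → ℝ) ⬝ᵥ Pi.single l 1 = 1 := by simp
    rw [e, mul_one] at h1
    rw [← h1]
    simp
  have hind : ∀ i, Indep (MeasurableSpace.comap (fun ω => r.wrel m i t ω l) inferInstance)
      (r.hist m t (t + 1)) P := by
    intro i
    refine indep_of_indep_of_le_left (hr.indep_wrel_hist h𝒯 m i t) ?_
    rintro _ ⟨S, hS, rfl⟩
    exact ⟨(fun f => f l) ⁻¹' S, measurable_pi_apply l hS, rfl⟩
  rw [lintegral_congr hstep,
    lintegral_select_of_indep (hr.hist_le m t (t + 1)) (X := fun ω => (F ω, c ω, h ω))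
      (hF.prodMk (hc.prodMk hh)) hj (W := fun i ω => r.wrel m i t ω l)
      (fun i => (measurable_pi_apply l).comp (hr.measurable_wrel m i t)) hlaw hind hφ]
  refine lintegral_congr fun ω => ?_
  have h0 := hh0 ω
  have hspos : 0 < Real.toNNReal s := Real.toNNReal_pos.2 hpos
  have hint := lintegral_exp_gaussian hspos h0 (c ω)
  rw [Real.coe_toNNReal _ hpos.le] at hint
  simp only [φ]
  rw [lintegral_const_mul _ (by fun_prop), hint, ← ENNReal.ofReal_mul
    (mul_nonneg (expScore_pos h𝒯 hpos m l ht _ ω).le (by positivity)), mul_assoc,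
    inv_mul_cancel₀ (Real.sqrt_pos.2 (by positivity)).ne', mul_one]

/-- The initial value is bounded on the support of the prior, because `Σ₁⁻¹ ≤ κ` and `‖θ‖ ≤ κ`. -/
lemma lintegral_expScore_le {m : Fin M} {κ : ℝ} (hκ : 𝒯.BoundedBy m κ) (hpos : 0 < 𝒯.relVar)
    (l : Fin dx) {t : ℕ} (ht : 1 ≤ t) :
    ∫⁻ ω, ENNReal.ofReal (r.expScore 𝒯 m l t (r.relParam m ω) ω) ∂P ≤
      ENNReal.ofReal (Real.exp (κ ^ 3 / 2)) := by
  induction t, ht using Nat.le_induction with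
  | succ t ht ih => rw [hr.lintegral_expScore_succ h𝒯 hpos m l ht]; exact ih
  | base =>
    have hκ0 : 0 < κ := zero_lt_one.trans_le hκ.one_le
    have hlow : ∀ v, v ⬝ᵥ v ≤ κ * quad (𝒯.relCov m) v := by
      intro v
      have h1 := quad_le_of_sub_posSemidef hκ.cov_lower v
      rw [quad_smul_mat, quad_one, inv_mul_le_iff₀ hκ0] at h1
      exact h1
    have hS := h𝒯.relCov_posDef m
    have h1 : ∀ᵐ ω ∂P, ENNReal.ofReal (r.expScore 𝒯 m l 1 (r.relParam m ω) ω) ≤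
        ENNReal.ofReal (Real.exp (κ ^ 3 / 2)) := by
      filter_upwards [hr.ae_relParam_mem h𝒯 m] with ω hω
      refine ENNReal.ofReal_le_ofReal ?_
      unfold expScore score response
      rw [relCovAt_one, div_self hS.det_pos.ne', Real.sqrt_one, mul_one, Finset.Ico_self,
        Finset.sum_empty, zero_sub]
      refine Real.exp_le_exp.2 (div_le_div_of_nonneg_right ?_ zero_le_two)
      set θ := r.relParam m ω
      have e : -((𝒯.relCov m)⁻¹ *ᵥ fun q => θ q l) =
          (-1 : ℝ) • ((𝒯.relCov m)⁻¹ *ᵥ fun q => θ q l) := by simp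
      rw [e, quad_smul_vec, quad_inv_mulVec hS]
      have h2 := quad_inv_le_of_le_quad hS hlow fun q => θ q l
      have h3 := dotProduct_mulVec_self_le_of_norm_le θ (hκ.norm_param θ hω) (Pi.single l 1)
      have h4 : θ *ᵥ Pi.single l 1 = fun q => θ q l := by
        ext q; simp
      rw [h4] at h3
      have h5 : (Pi.single l 1 : Fin dx → ℝ) ⬝ᵥ Pi.single l 1 = 1 := by simp
      rw [h5, mul_one] at h3
      nlinarith
    calc _ ≤ ∫⁻ _, ENNReal.ofReal (Real.exp (κ ^ 3 / 2)) ∂P := lintegral_mono_ae h1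
      _ = _ := by simp

/-- A sample from the posterior satisfies the same exponential bound. -/
lemma lintegral_expScore_sample (m : Fin M) (l : Fin dx) {t : ℕ} (ht : 1 ≤ t) :
    ∫⁻ ω, ENNReal.ofReal (r.expScore 𝒯 m l t (r.relSample m t ω) ω) ∂P =
      ∫⁻ ω, ENNReal.ofReal (r.expScore 𝒯 m l t (r.relParam m ω) ω) ∂P := by
  let φ : (Matrix (Fin dx ⊕ Fin du) (Fin dx ⊕ Fin du) ℝ × (Fin dx ⊕ Fin du → ℝ)) ×
      Param (Fin dx) (Fin du) → ENNReal := fun p =>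
    ENNReal.ofReal (Real.exp (quad p.1.1 (p.1.2 - (p.1.1)⁻¹ *ᵥ fun q => p.2 q l) / 2) *
      Real.sqrt (p.1.1.det / (𝒯.relCov m).det))
  have hS : Measurable fun p : (Matrix (Fin dx ⊕ Fin du) (Fin dx ⊕ Fin du) ℝ ×
      (Fin dx ⊕ Fin du → ℝ)) × Param (Fin dx) (Fin du) => p.1.1 :=
    measurable_fst.comp measurable_fst
  have hθl : Measurable fun (p : (Matrix (Fin dx ⊕ Fin du) (Fin dx ⊕ Fin du) ℝ ×
      (Fin dx ⊕ Fin du → ℝ)) × Param (Fin dx) (Fin du)) q => p.2 q l :=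
    measurable_column l measurable_snd
  have hφ : Measurable φ := by
    refine ENNReal.measurable_ofReal.comp (Measurable.mul ?_ ?_)
    · exact Real.measurable_exp.comp ((measurable_quad hS ((measurable_snd.comp
        measurable_fst).sub (measurable_mulVec (measurable_matrix_inv hS) hθl))).div_const 2)
    · exact ((measurable_det hS).div_const _).sqrt
  have hI : Measurable[r.relInfo 𝒯 m t] fun ω => (r.relCovAt 𝒯 m ω t, r.response 𝒯 m l t ω) :=
    (hr.measurable_relInfo_relCovAt h𝒯 m ht le_rfl).prodMk
      (hr.measurable_relInfo_response h𝒯 m l t)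
  have hI' := hI.mono ((hr.relInfo_le_hist h𝒯 m t).trans (hr.hist_le m t t)) le_rfl
  have h1 := hr.map_prodMk_relSample h𝒯 m ht hI
  have h2 := congrArg (fun μ => ∫⁻ p, φ p ∂μ) h1
  rw [lintegral_map hφ (hI'.prodMk (hr.relSample_measurable m t)),
    lintegral_map hφ (hI'.prodMk (hr.measurable_relParam m))] at h2
  exact h2

end IsTSDEMF

end Run

/-! ### Pathwise bounds on the states -/

/-- Young's inequality with weights adding up to one. -/
lemma dotProduct_add_self_le {α : Type} [Fintype α] {δ : ℝ} (h0 : 0 < δ) (h1 : δ < 1)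
    (a b : α → ℝ) : (a + b) ⬝ᵥ (a + b) ≤ δ⁻¹ * (a ⬝ᵥ a) + (1 - δ)⁻¹ * (b ⬝ᵥ b) := by
  simp only [dotProduct, Finset.mul_sum, ← Finset.sum_add_distrib, Pi.add_apply]
  refine Finset.sum_le_sum fun q _ => ?_
  have h2 : 0 < 1 - δ := sub_pos.2 h1
  have h3 : δ⁻¹ * (a q * a q) + (1 - δ)⁻¹ * (b q * b q) - (a q + b q) * (a q + b q) =
      ((1 - δ) * a q - δ * b q) ^ 2 / (δ * (1 - δ)) := by
    field_simp
    ring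
  have h4 : 0 ≤ ((1 - δ) * a q - δ * b q) ^ 2 / (δ * (1 - δ)) := by positivity
  linarith

namespace Run

variable {M n dx du : ℕ} {Ω : Type*} {r : Run M n dx du Ω} {𝒯 : Team M n dx du}

/-- The parameter and all samples of the relative actor lie in the support of the prior. -/
def InSupport (r : Run M n dx du Ω) (𝒯 : Team M n dx du) (m : Fin M) (ω : Ω) : Prop :=
  r.relParam m ω ∈ 𝒯.relSet m ∧ ∀ t, 1 ≤ t → r.relSample m t ω ∈ 𝒯.relSet m

lemma InSupport.relCurrent_mem {m : Fin M} {ω : Ω} (h : r.InSupport 𝒯 m ω) {t : ℕ} (ht : 1 ≤ t) :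
    r.relCurrent 𝒯 m t ω ∈ 𝒯.relSet m :=
  h.2 _ (one_le_episode_start ht)

variable [mΩ : MeasurableSpace Ω] {P : Measure Ω} [NeZero n]

namespace IsTSDEMF

section

variable [IsProbabilityMeasure P] (hr : r.IsTSDEMF 𝒯 P) (h𝒯 : 𝒯.Assumptions)
include hr h𝒯

lemma ae_inSupport (m : Fin M) : ∀ᵐ ω ∂P, r.InSupport 𝒯 m ω := by
  have h : ∀ᵐ ω ∂P, ∀ t, 1 ≤ t → r.relSample m t ω ∈ 𝒯.relSet m :=
    ae_all_iff.2 fun t => by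
      by_cases ht : 1 ≤ t
      · filter_upwards [hr.ae_relSample_mem h𝒯 m ht] with ω hω _ using hω
      · exact Filter.Eventually.of_forall fun ω h' => absurd h' ht
  filter_upwards [hr.ae_relParam_mem h𝒯 m, h] with ω h1 h2 using ⟨h1, h2⟩

end

variable (hr : r.IsTSDEMF 𝒯 P)
include hr

lemma relParam_mulVec_zrel (m : Fin M) (i : Fin n) {t : ℕ} (ht : 1 ≤ t)
    (θ : Param (Fin dx) (Fin du))
    (ω : Ω) : θᵀ *ᵥ r.zrel m i t ω =
      (θ.A + θ.B * 𝒯.relL m (r.relCurrent 𝒯 m t ω)) *ᵥ r.xrel m i t ω := by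
  rw [Run.zrel, param_transpose_mulVec, hr.urel_eq m i ht, add_mulVec, mulVec_mulVec]

lemma zrel_dotProduct_self_le {m : Fin M} {κ : ℝ} (hκ : 𝒯.BoundedBy m κ) {ω : Ω}
    (hω : r.InSupport 𝒯 m ω) (i : Fin n) {t : ℕ} (ht : 1 ≤ t) :
    r.zrel m i t ω ⬝ᵥ r.zrel m i t ω ≤ κ ^ 2 * (r.xrel m i t ω ⬝ᵥ r.xrel m i t ω) := by
  rw [hr.zrel_eq m i ht]
  exact dotProduct_mulVec_self_le_of_norm_le _ (hκ.norm_L _ (hω.relCurrent_mem ht)) _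

lemma xrel_succ_dotProduct_self_le (h𝒯 : 𝒯.Assumptions) {m : Fin M} {κ : ℝ}
    (hκ : 𝒯.BoundedBy m κ) {ω : Ω}
    (hω : r.InSupport 𝒯 m ω) (i : Fin n) {t : ℕ} (ht : 1 ≤ t) :
    r.xrel m i (t + 1) ω ⬝ᵥ r.xrel m i (t + 1) ω ≤
      𝒯.δ * (r.xrel m i t ω ⬝ᵥ r.xrel m i t ω) + κ * (r.wrel m i t ω ⬝ᵥ r.wrel m i t ω) := by
  have h0 := h𝒯.δ_pos
  rw [hr.xrel_succ m i ht, hr.relParam_mulVec_zrel m i ht]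
  refine (dotProduct_add_self_le h0 h𝒯.δ_lt_one _ _).trans (add_le_add ?_ ?_)
  · have h1 := (h𝒯.rel_stable m).contraction hω.1 (hω.relCurrent_mem ht) (r.xrel m i t ω)
    refine (mul_le_mul_of_nonneg_left h1 (inv_nonneg.2 h0.le)).trans_eq ?_
    field_simp
  · refine mul_le_mul_of_nonneg_right ?_ (dotProduct_self_nonneg' _)
    rw [← one_div]
    exact hκ.margin

/-- Uniform stability turns a uniform bound on the noises into one on the states. -/
lemma xrel_dotProduct_self_le (h𝒯 : 𝒯.Assumptions) {m : Fin M} {κ : ℝ} (hκ : 𝒯.BoundedBy m κ)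
    {ω : Ω} (hω : r.InSupport 𝒯 m ω) (i : Fin n) {e : ℝ} {t : ℕ} (ht : 1 ≤ t)
    (he : ∀ s < t, r.relNoise m i s ω ⬝ᵥ r.relNoise m i s ω ≤ e) :
    r.xrel m i t ω ⬝ᵥ r.xrel m i t ω ≤ κ ^ 2 * e := by
  have hκ1 := hκ.one_le
  have he0 : 0 ≤ e := (dotProduct_self_nonneg' _).trans (he 0 ht)
  induction t, ht using Nat.le_induction with
  | base =>
    have h1 := he 0 zero_lt_one
    simp only [relNoise, if_true] at h1
    exact h1.trans (le_mul_of_one_le_left he0 (one_le_pow₀ hκ1))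
  | succ t ht ih =>
    have h1 := hr.xrel_succ_dotProduct_self_le h𝒯 hκ hω i ht
    have h2 := ih fun s hs => he s (by omega)
    have h3 := he t (Nat.lt_succ_self t)
    simp only [relNoise, Nat.ne_of_gt ht, if_false] at h3
    have h4 : 1 ≤ κ * (1 - 𝒯.δ) := (div_le_iff₀ (sub_pos.2 h𝒯.δ_lt_one)).1 hκ.margin
    have h5 := mul_le_mul_of_nonneg_left h2 h𝒯.δ_pos.le
    have h6 := mul_le_mul_of_nonneg_left h3 (zero_le_one.trans hκ1)
    have h7 : 0 ≤ κ * e * (κ * (1 - 𝒯.δ) - 1) :=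
      mul_nonneg (mul_nonneg (zero_le_one.trans hκ1) he0) (sub_nonneg.2 h4)
    nlinarith

end IsTSDEMF

/-- The state dimension is bounded in terms of `κ`, since `κ⁻¹ ≤ S` and the trace of `S` is at
most `κ`. -/
lemma InSupport.dim_le (h𝒯 : 𝒯.Assumptions) {m : Fin M} {κ : ℝ} (hκ : 𝒯.BoundedBy m κ) {ω : Ω}
    (hω : r.InSupport 𝒯 m ω) : (dx : ℝ) ≤ κ ^ 2 := by
  have hκ0 : 0 < κ := zero_lt_one.trans_le hκ.one_le
  have hD := (h𝒯.rel_stable m).isDARE (h𝒯.Q_posDef m) (h𝒯.R_posDef m) h𝒯.δ_pos h𝒯.δ_lt_one hω.1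
  have h1 := hκ.trace_S _ hω.1
  rw [trace_eq_sum_quad] at h1
  have h2 : ∀ a : Fin dx, κ⁻¹ ≤ quad (𝒯.relS m (r.relParam m ω)) (Pi.single a 1) := by
    intro a
    have h3 := quad_le_of_sub_posSemidef hκ.Q_lower (Pi.single a 1)
    rw [quad_smul_mat, quad_one] at h3
    have h4 := hD.quad_closedLoop (h𝒯.R_posDef m) (Pi.single a 1)
    have h5 : (Pi.single a 1 : Fin dx → ℝ) ⬝ᵥ Pi.single a 1 = 1 := by simp
    rw [h5, mul_one] at h3
    have h6 := quad_nonneg (h𝒯.R_posDef m).posSemidef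
      (optGain (r.relParam m ω).A (r.relParam m ω).B (𝒯.R m)
        (riccati (𝒯.Q m) (𝒯.R m) (r.relParam m ω)) *ᵥ Pi.single a 1)
    have h7 := quad_nonneg hD.1 (((r.relParam m ω).A + (r.relParam m ω).B *
      optGain (r.relParam m ω).A (r.relParam m ω).B (𝒯.R m)
        (riccati (𝒯.Q m) (𝒯.R m) (r.relParam m ω))) *ᵥ Pi.single a 1)
    unfold Team.relS
    linarith
  have h3 : (dx : ℝ) * κ⁻¹ ≤ κ := by
    calc (dx : ℝ) * κ⁻¹ = ∑ _a : Fin dx, κ⁻¹ := by simp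
      _ ≤ _ := Finset.sum_le_sum fun a _ => h2 a
      _ ≤ κ := h1
  rw [← div_eq_mul_inv, div_le_iff₀ hκ0] at h3
  nlinarith

/-! ### The regret terms as sums over time -/

omit mΩ [NeZero n] in
lemma regretPath₀_eq (m : Fin M) (T : ℕ) (ω : Ω) :
    r.regretPath₀ 𝒯 m T ω = ∑ t ∈ Finset.Icc 1 T, 𝒯.relJ m (r.relCurrent 𝒯 m t ω) -
      T * 𝒯.relJ m (r.relParam m ω) := by
  unfold regretPath₀
  congr 1
  exact sum_episodes_length T fun s => 𝒯.relJ m (r.relSample m s ω)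

omit mΩ [NeZero n] in
lemma regretPath₁_eq (m : Fin M) (i : Fin n) (T : ℕ) (ω : Ω) :
    r.regretPath₁ 𝒯 m i T ω = ∑ t ∈ Finset.Icc 1 T,
      (quad (𝒯.relS m (r.relCurrent 𝒯 m t ω)) (r.xrel m i t ω) -
        quad (𝒯.relS m (r.relCurrent 𝒯 m t ω)) (r.xrel m i (t + 1) ω)) :=
  sum_episodes T fun s t => quad (𝒯.relS m (r.relSample m s ω)) (r.xrel m i t ω) -
    quad (𝒯.relS m (r.relSample m s ω)) (r.xrel m i (t + 1) ω)

omit mΩ [NeZero n] in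
lemma regretPath₂_eq (m : Fin M) (i : Fin n) (T : ℕ) (ω : Ω) :
    r.regretPath₂ 𝒯 m i T ω = ∑ t ∈ Finset.Icc 1 T,
      (quad (𝒯.relS m (r.relCurrent 𝒯 m t ω)) ((r.relParam m ω)ᵀ *ᵥ r.zrel m i t ω) -
        quad (𝒯.relS m (r.relCurrent 𝒯 m t ω))
          ((r.relCurrent 𝒯 m t ω)ᵀ *ᵥ r.zrel m i t ω)) :=
  sum_episodes T fun s t =>
    quad (𝒯.relS m (r.relSample m s ω)) ((r.relParam m ω)ᵀ *ᵥ r.zrel m i t ω) -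
      quad (𝒯.relS m (r.relSample m s ω)) ((r.relSample m s ω)ᵀ *ᵥ r.zrel m i t ω)

/-- The part of a step of the cost-to-go that is due to the noise, centred. -/
noncomputable def noiseTerm (r : Run M n dx du Ω) (𝒯 : Team M n dx du) (m : Fin M) (i : Fin n)
    (t : ℕ) (ω : Ω) : ℝ :=
  2 * (r.wrel m i t ω ⬝ᵥ (𝒯.relS m (r.relCurrent 𝒯 m t ω) *ᵥ
      ((r.relParam m ω)ᵀ *ᵥ r.zrel m i t ω))) +
    quad (𝒯.relS m (r.relCurrent 𝒯 m t ω)) (r.wrel m i t ω) -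
    𝒯.relVar * (𝒯.relS m (r.relCurrent 𝒯 m t ω)).trace

namespace IsTSDEMF

variable (hr : r.IsTSDEMF 𝒯 P)
include hr

/-- The Bellman equation of the sampled model expresses the cost of a step. -/
lemma relCost_eq (h𝒯 : 𝒯.Assumptions) {m : Fin M} {ω : Ω}
    (hω : r.InSupport 𝒯 m ω) (i : Fin n) {t : ℕ} (ht : 1 ≤ t) :
    r.relCost 𝒯 m i t ω = quad (𝒯.relS m (r.relCurrent 𝒯 m t ω)) (r.xrel m i t ω) -
      quad (𝒯.relS m (r.relCurrent 𝒯 m t ω))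
        ((r.relCurrent 𝒯 m t ω)ᵀ *ᵥ r.zrel m i t ω) := by
  have hD := (h𝒯.rel_stable m).isDARE (h𝒯.Q_posDef m) (h𝒯.R_posDef m) h𝒯.δ_pos h𝒯.δ_lt_one
    (hω.relCurrent_mem ht)
  have h1 := hD.quad_closedLoop (h𝒯.R_posDef m) (r.xrel m i t ω)
  rw [← gain_eq_optGain] at h1
  rw [hr.relParam_mulVec_zrel m i ht, relCost, hr.urel_eq m i ht]
  unfold Team.relS Team.relL
  linarith

lemma quad_xrel_succ (m : Fin M) (i : Fin n) {t : ℕ} (ht : 1 ≤ t) (ω : Ω) :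
    quad (𝒯.relS m (r.relCurrent 𝒯 m t ω)) (r.xrel m i (t + 1) ω) =
      quad (𝒯.relS m (r.relCurrent 𝒯 m t ω)) ((r.relParam m ω)ᵀ *ᵥ r.zrel m i t ω) +
      𝒯.relJ m (r.relCurrent 𝒯 m t ω) + r.noiseTerm 𝒯 m i t ω := by
  have hs : (𝒯.relS m (r.relCurrent 𝒯 m t ω))ᵀ = 𝒯.relS m (r.relCurrent 𝒯 m t ω) :=
    transpose_eq_of_posSemidef (posSemidef_riccati _)
  rw [hr.xrel_succ m i ht, add_comm, quad_add_vec hs]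
  unfold noiseTerm Team.relJ
  ring

/-- The regret is the sum of its three terms up to centred noise. -/
lemma regretPath_eq (h𝒯 : 𝒯.Assumptions) {m : Fin M} {ω : Ω}
    (hω : r.InSupport 𝒯 m ω) (i : Fin n) (T : ℕ) :
    r.regretPath 𝒯 m i T ω = r.regretPath₀ 𝒯 m T ω + r.regretPath₁ 𝒯 m i T ω +
      r.regretPath₂ 𝒯 m i T ω + ∑ t ∈ Finset.Icc 1 T, r.noiseTerm 𝒯 m i t ω := by
  rw [regretPath, regretPath₀_eq, regretPath₁_eq, regretPath₂_eq]
  have h : ∑ t ∈ Finset.Icc 1 T, r.relCost 𝒯 m i t ω = ∑ t ∈ Finset.Icc 1 T,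
      (𝒯.relJ m (r.relCurrent 𝒯 m t ω) +
      (quad (𝒯.relS m (r.relCurrent 𝒯 m t ω)) (r.xrel m i t ω) -
        quad (𝒯.relS m (r.relCurrent 𝒯 m t ω)) (r.xrel m i (t + 1) ω)) +
      (quad (𝒯.relS m (r.relCurrent 𝒯 m t ω)) ((r.relParam m ω)ᵀ *ᵥ r.zrel m i t ω) -
        quad (𝒯.relS m (r.relCurrent 𝒯 m t ω))
          ((r.relCurrent 𝒯 m t ω)ᵀ *ᵥ r.zrel m i t ω)) + r.noiseTerm 𝒯 m i t ω) := by
    refine Finset.sum_congr rfl fun t ht => ?_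
    have ht1 := (Finset.mem_Icc.1 ht).1
    rw [hr.relCost_eq h𝒯 hω i ht1, hr.quad_xrel_succ m i ht1]
    ring
  rw [h, Finset.sum_add_distrib, Finset.sum_add_distrib, Finset.sum_add_distrib]
  ring

end IsTSDEMF

end Run

namespace Run

variable {M n dx du : ℕ} {Ω : Type*} {r : Run M n dx du Ω} {𝒯 : Team M n dx du}

/-! ### Pathwise bounds on the regret terms -/

/-- The event, for a horizon `T`, on which the relative states of agent `i`, the information gain
and the self-normalised errors of the true parameter and of the samples are all controlled by `b`,
up to a factor `c` and their natural scales. -/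
structure PathBound (r : Run M n dx du Ω) (𝒯 : Team M n dx du) (m : Fin M) (i : Fin n) (T : ℕ)
    (c b : ℝ) (ω : Ω) : Prop where
  inSupport : r.InSupport 𝒯 m ω
  one_le : 1 ≤ b
  state_le : ∀ t, 1 ≤ t → t ≤ T + 1 → r.xrel m i t ω ⬝ᵥ r.xrel m i t ω ≤ c * (𝒯.relVar * b)
  gain_le : logDetGain (r.relCovAt 𝒯 m ω) (T + 1) ≤ c * ((dx + du) * b)
  score_param_le : ∀ t, 1 ≤ t → t ≤ T → ∀ l,
    quad (r.relCovAt 𝒯 m ω t) (r.score 𝒯 m l t (r.relParam m ω) ω) ≤ c * ((dx + du) * b)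
  score_sample_le : ∀ t, 1 ≤ t → t ≤ T → ∀ l,
    quad (r.relCovAt 𝒯 m ω t) (r.score 𝒯 m l t (r.relSample m t ω) ω) ≤ c * ((dx + du) * b)

lemma quad_sub_vec_le {α : Type} [Fintype α] {S : Matrix α α ℝ} (hS : S.PosSemidef) (v w : α → ℝ) :
    quad S (v - w) ≤ 2 * (quad S v + quad S w) := by
  have hs := transpose_eq_of_posSemidef hS
  have h := quad_nonneg hS (v + w)
  rw [quad_add_vec hs] at h
  rw [quad_sub_vec hs]
  linarith

/-- Two parameters with small self-normalised errors are close in the precision-weighted norm. -/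
lemma column_sub_dotProduct_sq_le (h𝒯 : 𝒯.Assumptions) (hpos : 0 < 𝒯.relVar) (m : Fin M)
    (l : Fin dx) {t : ℕ} (ht : 1 ≤ t) (θ φ : Param (Fin dx) (Fin du)) (ω : Ω)
    (v : Fin dx ⊕ Fin du → ℝ) :
    (((θ - φ)ᵀ *ᵥ v) l) ^ 2 ≤ 2 * (quad (r.relCovAt 𝒯 m ω t) (r.score 𝒯 m l t φ ω) +
      quad (r.relCovAt 𝒯 m ω t) (r.score 𝒯 m l t θ ω)) * quad (r.relCovAt 𝒯 m ω t) v := by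
  have hS := (Run.isCovSeq (r := r) h𝒯 m hpos ω).posDef ht
  have hunit : IsUnit (r.relCovAt 𝒯 m ω t).det := hS.det_pos.ne'.isUnit
  have h1 : r.relCovAt 𝒯 m ω t *ᵥ (r.score 𝒯 m l t φ ω - r.score 𝒯 m l t θ ω) =
      fun q => θ q l - φ q l := by
    unfold score
    rw [sub_sub_sub_cancel_left, ← mulVec_sub, mulVec_mulVec, mul_nonsing_inv _ hunit, one_mulVec]
    rfl
  have h2 : ((θ - φ)ᵀ *ᵥ v) l = v ⬝ᵥ (r.relCovAt 𝒯 m ω t *ᵥ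
      (r.score 𝒯 m l t φ ω - r.score 𝒯 m l t θ ω)) := by
    rw [h1]
    simp only [mulVec, dotProduct, transpose_apply, Matrix.sub_apply]
    exact Finset.sum_congr rfl fun q _ => mul_comm _ _
  rw [h2]
  refine (dotProduct_mulVec_sq_le hS.posSemidef _ _).trans ?_
  rw [mul_comm]
  exact mul_le_mul_of_nonneg_right (quad_sub_vec_le hS.posSemidef _ _)
    (quad_nonneg hS.posSemidef _)

lemma relDet_pos (h𝒯 : 𝒯.Assumptions) (hpos : 0 < 𝒯.relVar) (m : Fin M) (ω : Ω) (t : ℕ) :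
    0 < r.relDet 𝒯 m ω t := by
  rcases Nat.eq_zero_or_pos t with rfl | h0
  · exact (h𝒯.relCov_posDef m).det_pos
  · exact ((Run.isCovSeq (r := r) h𝒯 m hpos ω).posDef h0).det_pos

/-- Within an episode the weighted norm at its start exceeds the current one at most by a factor
two. -/
lemma quad_start_le (h𝒯 : 𝒯.Assumptions) (hpos : 0 < 𝒯.relVar) (m : Fin M)
    {t : ℕ} (ht : 1 ≤ t) (ω : Ω) (v : Fin dx ⊕ Fin du → ℝ) :
    quad (r.relCovAt 𝒯 m ω (episode (r.relDet 𝒯 m ω) t).start) v ≤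
      2 * quad (r.relCovAt 𝒯 m ω t) v := by
  have hc := Run.isCovSeq (r := r) h𝒯 m hpos ω
  set s := (episode (r.relDet 𝒯 m ω) t).start
  have hs1 : 1 ≤ s := one_le_episode_start ht
  have h1 := hc.det_mul_quad_le hs1 (episode_start_le t) v
  have h2 : (1 / 2) * (r.relCovAt 𝒯 m ω s).det ≤ (r.relCovAt 𝒯 m ω t).det :=
    half_mul_start_le (relDet_pos h𝒯 hpos m ω) t
  have h3 := (hc.posDef ht).det_pos
  have h4 := quad_nonneg (hc.posDef ht).posSemidef v
  refine le_of_mul_le_mul_left ?_ h3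
  nlinarith

lemma relDet_antitone (h𝒯 : 𝒯.Assumptions) (hpos : 0 < 𝒯.relVar) (m : Fin M) (ω : Ω) :
    Antitone (r.relDet 𝒯 m ω) := by
  refine antitone_nat_of_succ_le fun t => ?_
  rcases Nat.eq_zero_or_pos t with rfl | h0
  · exact le_refl (𝒯.relCov m).det
  · exact (Run.isCovSeq (r := r) h𝒯 m hpos ω).det_succ_le h0

lemma one_le_dim (hdx : dx ≠ 0) : (1 : ℝ) ≤ (dx : ℝ) + du := by
  have h : (1 : ℝ) ≤ dx := by exact_mod_cast Nat.one_le_iff_ne_zero.2 hdx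
  have h' : (0 : ℝ) ≤ du := Nat.cast_nonneg _
  linarith

section Bounds

variable {m : Fin M} {i : Fin n} {T : ℕ} {κ c b : ℝ} {ω : Ω}

lemma PathBound.numEpisodes_le (h𝒯 : 𝒯.Assumptions) (hpos : 0 < 𝒯.relVar) (hdx : dx ≠ 0)
    (hT : 1 ≤ T) (hc : 1 ≤ c) (h : r.PathBound 𝒯 m i T c b ω) :
    (r.K 𝒯 m T ω : ℝ) ≤ 9 * c * b * Real.sqrt (((dx : ℝ) + du) * T) := by
  have hseq := Run.isCovSeq (r := r) h𝒯 m hpos ω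
  have hd := one_le_dim (du := du) hdx
  have hb := h.one_le
  set d : ℝ := (dx : ℝ) + du with hd'
  have h1 : Real.log (r.relDet 𝒯 m ω 0 / r.relDet 𝒯 m ω T) ≤ c * (d * b) :=
    (hseq.logDetGain_le_succ hT).trans h.gain_le
  refine (MeanFieldTeam.numEpisodes_le (relDet_antitone h𝒯 hpos m ω) (relDet_pos h𝒯 hpos m ω)
    hT h1).trans ?_
  have hdb : 1 ≤ c * (d * b) :=
    one_le_mul_of_one_le_of_one_le hc (one_le_mul_of_one_le_of_one_le hd hb)
  have hcb : 1 ≤ c * b := one_le_mul_of_one_le_of_one_le hc hb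
  have h2 : (T : ℝ) * (1 + 2 * (c * (d * b))) ≤ (3 * (c * b)) ^ 2 * (d * T) := by
    have h3 : (T : ℝ) * (1 + 2 * (c * (d * b))) ≤ T * (3 * (c * (d * b))) :=
      mul_le_mul_of_nonneg_left (by linarith) (Nat.cast_nonneg _)
    have h4 : 0 ≤ (d * T) * (c * b) := by positivity
    nlinarith
  calc 3 * Real.sqrt (T * (1 + 2 * (c * (d * b))))
      ≤ 3 * Real.sqrt ((3 * (c * b)) ^ 2 * (d * T)) :=
        mul_le_mul_of_nonneg_left (Real.sqrt_le_sqrt h2) (by norm_num)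
    _ = 9 * c * b * Real.sqrt (d * T) := by
        rw [Real.sqrt_mul (sq_nonneg _), Real.sqrt_sq (by positivity)]
        ring

lemma relS_posSemidef (m : Fin M) (θ : Param (Fin dx) (Fin du)) : (𝒯.relS m θ).PosSemidef :=
  posSemidef_riccati θ

lemma PathBound.quad_xrel_le (hκ : 𝒯.BoundedBy m κ) (h : r.PathBound 𝒯 m i T c b ω)
    {θ : Param (Fin dx) (Fin du)} (hθ : θ ∈ 𝒯.relSet m) {t : ℕ} (ht : 1 ≤ t) (htT : t ≤ T + 1) :
    quad (𝒯.relS m θ) (r.xrel m i t ω) ≤ κ * (c * (𝒯.relVar * b)) :=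
  (quad_le_of_norm_le _ (hκ.norm_S _ hθ) _).trans
    (mul_le_mul_of_nonneg_left (h.state_le t ht htT) (zero_le_one.trans hκ.one_le))

/-- Within an episode the sum telescopes, so it is at most the number of episodes times a bound on
the cost-to-go. -/
lemma PathBound.regretPath₁_le (h𝒯 : 𝒯.Assumptions) (hκ : 𝒯.BoundedBy m κ) (hpos : 0 < 𝒯.relVar)
    (hdx : dx ≠ 0) (hT : 1 ≤ T) (hc : 1 ≤ c) (h : r.PathBound 𝒯 m i T c b ω) :
    r.regretPath₁ 𝒯 m i T ω ≤
      9 * κ * c ^ 2 * b ^ 2 * (𝒯.relVar * Real.sqrt (((dx : ℝ) + du) * T)) := by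
  rw [regretPath₁_eq]
  have h1 := sum_telescope_le (d := r.relDet 𝒯 m ω)
    (g := fun s t => quad (𝒯.relS m (r.relSample m s ω)) (r.xrel m i t ω))
    (c := κ * (c * (𝒯.relVar * b))) (fun s t => quad_nonneg (relS_posSemidef m _) _) hT
    (fun t h1 h2 => h.quad_xrel_le hκ (h.inSupport.2 t h1) h1 (by omega))
  refine h1.trans ?_
  have h2 := h.numEpisodes_le h𝒯 hpos hdx hT hc
  have hb := h.one_le
  have hκ1 := hκ.one_le
  refine (mul_le_mul_of_nonneg_right h2 (by positivity)).trans_eq ?_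
  ring

end Bounds

section Mismatch

variable [mΩ : MeasurableSpace Ω] {P : Measure Ω} [NeZero n]
variable {m : Fin M} {i : Fin n} {T : ℕ} {κ c b : ℝ} {ω : Ω}

lemma IsTSDEMF.closedLoop_dotProduct_self_le (hr : r.IsTSDEMF 𝒯 P) (h𝒯 : 𝒯.Assumptions)
    (hω : r.InSupport 𝒯 m ω) {θ : Param (Fin dx) (Fin du)} (hθ : θ ∈ 𝒯.relSet m)
    {t : ℕ} (ht : 1 ≤ t) :
    (θᵀ *ᵥ r.zrel m i t ω) ⬝ᵥ (θᵀ *ᵥ r.zrel m i t ω) ≤ r.xrel m i t ω ⬝ᵥ r.xrel m i t ω := by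
  rw [hr.relParam_mulVec_zrel m i ht]
  refine ((h𝒯.rel_stable m).contraction hθ (hω.relCurrent_mem ht) _).trans ?_
  refine mul_le_of_le_one_left (dotProduct_self_nonneg' _) ?_
  exact pow_le_one₀ h𝒯.δ_pos.le h𝒯.δ_lt_one.le

/-- The regressor of an agent is no more informative than that of the selected agent. -/
lemma PathBound.quad_zrel_le (hr : r.IsTSDEMF 𝒯 P) (h𝒯 : 𝒯.Assumptions)
    (hκ : 𝒯.BoundedBy m κ) (hpos : 0 < 𝒯.relVar) (hc : 1 ≤ c) (h : r.PathBound 𝒯 m i T c b ω)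
    {t : ℕ} (ht : 1 ≤ t) (htT : t ≤ T) :
    quad (r.relCovAt 𝒯 m ω t) (r.zrel m i t ω) ≤ 𝒯.relVar * (κ ^ 3 * c * b) *
      min 1 (quad (r.relCovAt 𝒯 m ω t) (r.zrel m (r.j 𝒯 m t ω) t ω) / 𝒯.relVar) := by
  have hseq := Run.isCovSeq (r := r) h𝒯 m hpos ω
  have hκ1 := hκ.one_le
  have hb := h.one_le
  have hG : 1 ≤ κ ^ 3 * c * b :=
    one_le_mul_of_one_le_of_one_le (one_le_mul_of_one_le_of_one_le (one_le_pow₀ hκ1) hc) hb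
  have h1 : quad (r.relCovAt 𝒯 m ω t) (r.zrel m i t ω) ≤
      quad (r.relCovAt 𝒯 m ω t) (r.zrel m (r.j 𝒯 m t ω) t ω) :=
    h𝒯.argmax_spec (fun i => quad (r.relCovAt 𝒯 m ω t) (r.zrel m i t ω)) i
  have h2 : quad (r.relCovAt 𝒯 m ω t) (r.zrel m i t ω) ≤ 𝒯.relVar * (κ ^ 3 * c * b) := by
    have h3 := hseq.quad_mono le_rfl ht (r.zrel m i t ω)
    have h4 := quad_le_of_sub_posSemidef hκ.cov_upper (r.zrel m i t ω)
    rw [quad_smul_mat, quad_one] at h4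
    have h5 := hr.zrel_dotProduct_self_le hκ h.inSupport i ht
    have h6 := h.state_le t ht (by omega)
    rw [relCovAt_one] at h3
    calc _ ≤ κ * (r.zrel m i t ω ⬝ᵥ r.zrel m i t ω) := h3.trans h4
      _ ≤ κ * (κ ^ 2 * (c * (𝒯.relVar * b))) := by gcongr; exact h5.trans (by gcongr)
      _ = _ := by ring
  rcases le_total 1 (quad (r.relCovAt 𝒯 m ω t) (r.zrel m (r.j 𝒯 m t ω) t ω) / 𝒯.relVar)
    with h3 | h3
  · rwa [min_eq_left h3, mul_one]
  · rw [min_eq_right h3, mul_assoc, mul_comm, mul_assoc, div_mul_cancel₀ _ hpos.ne']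
    exact h1.trans (le_mul_of_one_le_left (quad_nonneg (hseq.posDef ht).posSemidef _) hG)

/-- The difference of the forms of the two predictions is bounded by the form of their difference
times the form of their sum. The first is small by the self-normalised errors and the monitored
uncertainty of the selected agent, the second is bounded by stability. -/
lemma PathBound.mismatch_sq_le (hr : r.IsTSDEMF 𝒯 P) (h𝒯 : 𝒯.Assumptions)
    (hκ : 𝒯.BoundedBy m κ) (hpos : 0 < 𝒯.relVar) (hc : 1 ≤ c) (h : r.PathBound 𝒯 m i T c b ω)
    {t : ℕ} (ht : 1 ≤ t) (htT : t ≤ T) :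
    (quad (𝒯.relS m (r.relCurrent 𝒯 m t ω)) ((r.relParam m ω)ᵀ *ᵥ r.zrel m i t ω) -
        quad (𝒯.relS m (r.relCurrent 𝒯 m t ω))
          ((r.relCurrent 𝒯 m t ω)ᵀ *ᵥ r.zrel m i t ω)) ^ 2 ≤
      32 * κ ^ 5 * c ^ 3 * b ^ 3 * (𝒯.relVar ^ 2 * ((dx : ℝ) * (dx + du))) *
        min 1 (quad (r.relCovAt 𝒯 m ω t) (r.zrel m (r.j 𝒯 m t ω) t ω) / 𝒯.relVar) := by
  have hκ1 := hκ.one_le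
  have hκ0 : 0 ≤ κ := zero_le_one.trans hκ1
  have hc0 : 0 ≤ c := zero_le_one.trans hc
  have hb := h.one_le
  have hb0 : 0 ≤ b := zero_le_one.trans hb
  set θ := r.relParam m ω with hθ
  set φ := r.relCurrent 𝒯 m t ω with hφ
  set z := r.zrel m i t ω with hz
  set s := (episode (r.relDet 𝒯 m ω) t).start with hs
  set μ := min 1 (quad (r.relCovAt 𝒯 m ω t) (r.zrel m (r.j 𝒯 m t ω) t ω) / 𝒯.relVar) with hμ
  have hs1 : 1 ≤ s := one_le_episode_start ht
  have hst : s ≤ t := episode_start_le t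
  have hφS := h.inSupport.relCurrent_mem ht
  have hS := relS_posSemidef (𝒯 := 𝒯) m φ
  have hμ0 : 0 ≤ μ := le_min zero_le_one
    ((Run.isCovSeq (r := r) h𝒯 m hpos ω).quad_div_nonneg ht)
  -- the difference of the two predictions
  have hdiff : quad (𝒯.relS m φ) (θᵀ *ᵥ z - φᵀ *ᵥ z) ≤
      κ * (dx * (4 * (c * ((dx + du) * b)) * (2 * (𝒯.relVar * (κ ^ 3 * c * b) * μ)))) := by
    refine (quad_le_of_norm_le _ (hκ.norm_S _ hφS) _).trans (mul_le_mul_of_nonneg_left ?_ hκ0)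
    rw [← sub_mulVec, ← transpose_sub]
    calc ((θ - φ)ᵀ *ᵥ z) ⬝ᵥ ((θ - φ)ᵀ *ᵥ z) = ∑ l, ((θ - φ)ᵀ *ᵥ z) l ^ 2 := by
          simp only [dotProduct, sq]
      _ ≤ ∑ _l : Fin dx, 4 * (c * ((dx + du) * b)) * (2 * (𝒯.relVar * (κ ^ 3 * c * b) * μ)) := by
          refine Finset.sum_le_sum fun l _ => ?_
          have h1 := column_sub_dotProduct_sq_le (r := r) h𝒯 hpos m l hs1 θ φ ω z
          have h2 := h.score_param_le s hs1 (hst.trans htT) l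
          have h3 : quad (r.relCovAt 𝒯 m ω s) (r.score 𝒯 m l s φ ω) ≤ c * ((dx + du) * b) :=
            h.score_sample_le s hs1 (hst.trans htT) l
          have h4 := (quad_start_le (r := r) h𝒯 hpos m ht ω z).trans
            (mul_le_mul_of_nonneg_left (h.quad_zrel_le hr h𝒯 hκ hpos hc ht htT) zero_le_two)
          have h5 := quad_nonneg ((Run.isCovSeq (r := r) h𝒯 m hpos ω).posDef hs1).posSemidef z
          refine h1.trans (mul_le_mul (by linarith) h4 h5 (by positivity))
      _ = _ := by simp
  have hsum : quad (𝒯.relS m φ) (θᵀ *ᵥ z + φᵀ *ᵥ z) ≤ κ * (4 * (c * (𝒯.relVar * b))) := by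
    refine (quad_le_of_norm_le _ (hκ.norm_S _ hφS) _).trans (mul_le_mul_of_nonneg_left ?_ hκ0)
    have h1 := quad_sub_vec_le (S := (1 : Matrix (Fin dx) (Fin dx) ℝ)) Matrix.PosSemidef.one
      (θᵀ *ᵥ z) (-(φᵀ *ᵥ z))
    rw [sub_neg_eq_add, quad_one, quad_one, quad_one, neg_dotProduct_neg] at h1
    have h2 := hr.closedLoop_dotProduct_self_le (i := i) h𝒯 h.inSupport h.inSupport.1 ht
    have h3 := hr.closedLoop_dotProduct_self_le (i := i) h𝒯 h.inSupport hφS ht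
    have h4 := h.state_le t ht (by omega)
    simp only [hz]
    linarith
  refine (quad_sub_quad_sq_le hS _ _).trans ((mul_le_mul hdiff hsum (quad_nonneg hS _)
    (by positivity)).trans_eq ?_)
  ring

/-- The Cauchy–Schwarz inequality over time and the elliptical potential. -/
lemma PathBound.regretPath₂_le (hr : r.IsTSDEMF 𝒯 P) (h𝒯 : 𝒯.Assumptions)
    (hκ : 𝒯.BoundedBy m κ) (hpos : 0 < 𝒯.relVar) (hc : 1 ≤ c) (h : r.PathBound 𝒯 m i T c b ω) :
    r.regretPath₂ 𝒯 m i T ω ≤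
      8 * κ ^ 3 * c ^ 2 * b ^ 2 * (𝒯.relVar * (((dx : ℝ) + du) * Real.sqrt ((dx : ℝ) * T))) := by
  have hκ1 := hκ.one_le
  have hb := h.one_le
  have hseq := Run.isCovSeq (r := r) h𝒯 m hpos ω
  rw [regretPath₂_eq]
  refine le_of_sq_le_sq ?_ (by positivity)
  refine (sq_sum_le_card_mul_sum_sq).trans ?_
  have h1 := Finset.sum_le_sum fun t (ht : t ∈ Finset.Icc 1 T) =>
    h.mismatch_sq_le hr h𝒯 hκ hpos hc (Finset.mem_Icc.1 ht).1 (Finset.mem_Icc.1 ht).2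
  rw [← Finset.mul_sum] at h1
  have h2 := (hseq.sum_min_one_le T).trans (mul_le_mul_of_nonneg_left h.gain_le zero_le_two)
  rw [Nat.card_Icc, Nat.add_sub_cancel]
  calc _ ≤ (T : ℝ) * (32 * κ ^ 5 * c ^ 3 * b ^ 3 * (𝒯.relVar ^ 2 * ((dx : ℝ) * (dx + du))) *
        (2 * (c * ((dx + du) * b)))) := by
        refine mul_le_mul_of_nonneg_left (h1.trans ?_) (Nat.cast_nonneg _)
        exact mul_le_mul_of_nonneg_left h2 (by positivity)
    _ = κ ^ 5 * (64 * c ^ 4 * b ^ 4 * (𝒯.relVar ^ 2 * ((dx + du) ^ 2 * ((dx : ℝ) * T)))) := by ring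
    _ ≤ κ ^ 6 * (64 * c ^ 4 * b ^ 4 * (𝒯.relVar ^ 2 * ((dx + du) ^ 2 * ((dx : ℝ) * T)))) := by
        refine mul_le_mul_of_nonneg_right (pow_le_pow_right₀ hκ1 (by norm_num)) (by positivity)
    _ = _ := by
        rw [mul_pow, mul_pow _ (_ * _), mul_pow _ (Real.sqrt _), Real.sq_sqrt (by positivity)]
        ring

end Mismatch

end Run

/-! ### Logarithmic bounds -/

lemma log_one_add_log_nonneg {n : ℕ} (hn : 1 ≤ n) : 0 ≤ Real.log (1 + Real.log n) := by
  have h : (1 : ℝ) ≤ n := by exact_mod_cast hn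
  exact Real.log_nonneg (by linarith [Real.log_nonneg h])

lemma log_add_one_le_logFactor {T n : ℕ} (hT : 1 ≤ T) (hn : 1 ≤ n) :
    Real.log (T + 1) ≤ logFactor T n := by
  have hT' : (1 : ℝ) ≤ T := by exact_mod_cast hT
  have h1 : Real.log (T + 1) ≤ Real.log (2 * T) := Real.log_le_log (by linarith) (by linarith)
  rw [Real.log_mul two_ne_zero (by linarith)] at h1
  have h2 : Real.log 2 ≤ 1 := by
    have := Real.log_le_sub_one_of_pos (zero_lt_two (α := ℝ))
    linarith
  have h3 := log_one_add_log_nonneg hn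
  unfold logFactor
  linarith

lemma one_le_logFactor {T n : ℕ} (hT : 1 ≤ T) (hn : 1 ≤ n) : 1 ≤ logFactor T n := by
  have hT' : (1 : ℝ) ≤ T := by exact_mod_cast hT
  have h1 := Real.log_nonneg hT'
  have h3 := log_one_add_log_nonneg hn
  unfold logFactor
  linarith

lemma log_add_log_le {T n : ℕ} (hT : 1 ≤ T) (hn : 1 ≤ n) {U : ℝ} (hU : 0 ≤ U) :
    Real.log (T + 1) + Real.log (1 + U) ≤ logFactor T n * (1 + Real.log (1 + U)) := by
  have h1 := log_add_one_le_logFactor hT hn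
  have h2 := one_le_logFactor hT hn
  have h3 : 0 ≤ Real.log (1 + U) := Real.log_nonneg (by linarith)
  nlinarith

lemma sq_le_of_exp_le {y v A : ℝ} (hv : 0 < v) (h : Real.exp (y ^ 2 / v) ≤ A) :
    y ^ 2 ≤ v * Real.log A := by
  have h1 := (Real.le_log_iff_exp_le ((Real.exp_pos _).trans_le h)).2 h
  rwa [div_le_iff₀' hv] at h1

lemma one_add_log_pow_three_le {U : ℝ} (hU : 0 ≤ U) :
    (1 + Real.log (1 + U)) ^ 3 ≤ 27 * (1 + U) := by
  -- `log y ≤ y - 1` at the cube root `y` of `1 + U`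
  set y : ℝ := (1 + U) ^ (1 / 3 : ℝ) with hy
  have h1 : 0 < 1 + U := by linarith
  have hy0 : 0 < y := Real.rpow_pos_of_pos h1 _
  have hy3 : y ^ 3 = 1 + U := by
    rw [hy, ← Real.rpow_natCast, ← Real.rpow_mul h1.le]
    norm_num
  have h2 : Real.log (1 + U) = 3 * Real.log y := by
    rw [← hy3, Real.log_pow]
    norm_num
  have h3 := Real.log_le_sub_one_of_pos hy0
  have h4 : 0 ≤ Real.log (1 + U) := Real.log_nonneg (by linarith)
  have h5 : (1 + Real.log (1 + U)) ^ 3 ≤ (3 * y) ^ 3 :=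
    pow_le_pow_left₀ (by linarith) (by linarith) 3
  rw [mul_pow, hy3] at h5
  linarith

namespace Run

variable {M n dx du : ℕ} {Ω : Type*} {r : Run M n dx du Ω} {𝒯 : Team M n dx du}

/-! ### Probability of the path bounds -/

section Deterministic

variable [mΩ : MeasurableSpace Ω] {P : Measure Ω} [NeZero n]
variable {m : Fin M} {i : Fin n} {T : ℕ} {κ : ℝ} {ω : Ω}

lemma IsTSDEMF.xrel_le_of_exp_le (hr : r.IsTSDEMF 𝒯 P) (h𝒯 : 𝒯.Assumptions)
    (hκ : 𝒯.BoundedBy m κ) (hpos : 0 < 𝒯.relVar) (hω : r.InSupport 𝒯 m ω) {A : ℝ}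
    (hA1 : 1 ≤ A)
    (hA : ∀ s ≤ T, ∀ a, Real.exp (r.relNoise m i s ω a ^ 2 / (4 * (κ * 𝒯.relVar))) ≤ A)
    {t : ℕ} (ht : 1 ≤ t) (htT : t ≤ T + 1) :
    r.xrel m i t ω ⬝ᵥ r.xrel m i t ω ≤ 4 * κ ^ 5 * (𝒯.relVar * Real.log A) := by
  have hκ0 : 0 < κ := zero_lt_one.trans_le hκ.one_le
  have hL : 0 ≤ Real.log A := Real.log_nonneg hA1
  have h1 : ∀ s < t, r.relNoise m i s ω ⬝ᵥ r.relNoise m i s ω ≤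
      4 * κ ^ 3 * (𝒯.relVar * Real.log A) := by
    intro s hs
    calc r.relNoise m i s ω ⬝ᵥ r.relNoise m i s ω = ∑ a, r.relNoise m i s ω a ^ 2 := by
          simp only [dotProduct, sq]
      _ ≤ ∑ _a : Fin dx, 4 * (κ * 𝒯.relVar) * Real.log A :=
          Finset.sum_le_sum fun a _ => sq_le_of_exp_le (by positivity) (hA s (by omega) a)
      _ = dx * (4 * (κ * 𝒯.relVar) * Real.log A) := by simp
      _ ≤ κ ^ 2 * (4 * (κ * 𝒯.relVar) * Real.log A) :=
          mul_le_mul_of_nonneg_right (hω.dim_le h𝒯 hκ) (by positivity)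
      _ = _ := by ring
  refine (hr.xrel_dotProduct_self_le h𝒯 hκ hω i ht h1).trans_eq ?_
  ring

/-- The regressor that enters the covariance is that of a random agent, so the noises of all agents
have to be bounded. The factor `n` allowed here costs only a term `log (1 + log n)`, as the
gain is logarithmic in the size of the regressors. -/
lemma IsTSDEMF.logDetGain_le_of_exp_le (hr : r.IsTSDEMF 𝒯 P) (h𝒯 : 𝒯.Assumptions)
    (hκ : 𝒯.BoundedBy m κ) (hpos : 0 < 𝒯.relVar) (hT : 1 ≤ T)
    (hω : r.InSupport 𝒯 m ω) {U : ℝ} (hU : 0 ≤ U)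
    (hA : ∀ i, ∀ s ≤ T, ∀ a, Real.exp (r.relNoise m i s ω a ^ 2 / (4 * (κ * 𝒯.relVar))) ≤
      n * ((T + 1) * U)) :
    logDetGain (r.relCovAt 𝒯 m ω) (T + 1) ≤
      9 * κ ^ 8 * ((dx + du) * (logFactor T n * (1 + Real.log (1 + U)))) := by
  have hκ1 := hκ.one_le
  have hκ0 : 0 < κ := zero_lt_one.trans_le hκ1
  have hn1 : 1 ≤ n := Nat.one_le_iff_ne_zero.2 (NeZero.ne n)
  have hn : (1 : ℝ) ≤ n := by exact_mod_cast hn1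
  have hT' : (1 : ℝ) ≤ T := by exact_mod_cast hT
  have hlogn := Real.log_nonneg hn
  have hseq := Run.isCovSeq (r := r) h𝒯 m hpos ω
  set Y := Real.log (n * ((T + 1) * (1 + U))) with hY
  have harg : 1 ≤ n * ((T + 1) * (1 + U)) :=
    one_le_mul_of_one_le_of_one_le hn (one_le_mul_of_one_le_of_one_le (by linarith) (by linarith))
  have hY0 : 0 ≤ Y := Real.log_nonneg harg
  have hYeq : Y = Real.log n + (Real.log (T + 1) + Real.log (1 + U)) := by
    rw [hY, Real.log_mul (by linarith) (by positivity),
      Real.log_mul (by positivity) (by positivity)]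
  have hz : ∀ t ∈ Finset.Ico 1 (T + 1),
      r.zrel m (r.j 𝒯 m t ω) t ω ⬝ᵥ r.zrel m (r.j 𝒯 m t ω) t ω ≤
        4 * κ ^ 7 * (𝒯.relVar * Y) := by
    intro t ht
    obtain ⟨h1, h2⟩ := Finset.mem_Ico.1 ht
    have h3 := hr.xrel_le_of_exp_le h𝒯 hκ hpos hω harg (i := r.j 𝒯 m t ω) (T := T)
      (fun s hs a => (hA _ s hs a).trans (by gcongr; linarith)) h1 h2.le
    refine (hr.zrel_dotProduct_self_le hκ hω _ h1).trans
      ((mul_le_mul_of_nonneg_left h3 (by positivity)).trans_eq ?_)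
    ring
  have hsum : (∑ t ∈ Finset.Ico 1 (T + 1),
      r.zrel m (r.j 𝒯 m t ω) t ω ⬝ᵥ r.zrel m (r.j 𝒯 m t ω) t ω) / 𝒯.relVar ≤
        4 * κ ^ 7 * (T * Y) := by
    rw [div_le_iff₀ hpos]
    refine (Finset.sum_le_sum hz).trans_eq ?_
    simp
    ring
  have hlow : ∀ v, v ⬝ᵥ v ≤ κ * quad (r.relCovAt 𝒯 m ω 1) v := by
    intro v
    have h1 := quad_le_of_sub_posSemidef hκ.cov_lower v
    rw [quad_smul_mat, quad_one, inv_mul_le_iff₀ hκ0] at h1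
    exact h1
  have hup : ∀ v, quad (r.relCovAt 𝒯 m ω 1) v ≤ κ * (v ⬝ᵥ v) := by
    intro v
    have h1 := quad_le_of_sub_posSemidef hκ.cov_upper v
    rwa [quad_smul_mat, quad_one] at h1
  have h1 := hseq.logDetGain_le hκ1 hlow hup (Nat.le_add_left 1 T)
  have hcard : (Fintype.card (Fin dx ⊕ Fin du) : ℝ) = dx + du := by simp
  rw [hcard] at h1
  refine h1.trans ?_
  rw [mul_left_comm]
  refine mul_le_mul_of_nonneg_left ?_ (by positivity)
  -- only the logarithm of the number of agents enters the bound on the regressors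
  set W : ℝ := (T + 1) * ((1 + Real.log n) * (1 + U)) with hW
  have hW1 : 1 ≤ W := one_le_mul_of_one_le_of_one_le (by linarith)
    (one_le_mul_of_one_le_of_one_le (by linarith) (by linarith))
  have hYW : Y ≤ W := by
    have e1 := Real.log_le_sub_one_of_pos (show (0 : ℝ) < T + 1 by linarith)
    have e2 := Real.log_le_sub_one_of_pos (show (0 : ℝ) < 1 + U by linarith)
    have e3 : 0 ≤ Real.log n * U := by positivity
    have e4 : 0 ≤ T * (Real.log n + U + Real.log n * U) := by positivity
    rw [hYeq, hW]
    nlinarith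
  have h2 : κ * (κ + (∑ t ∈ Finset.Ico 1 (T + 1),
      r.zrel m (r.j 𝒯 m t ω) t ω ⬝ᵥ r.zrel m (r.j 𝒯 m t ω) t ω) / 𝒯.relVar) ≤
      5 * κ ^ 8 * ((T + 1) * W) := by
    have e1 : κ * (κ + 4 * κ ^ 7 * (T * Y)) ≤ κ * (κ ^ 7 + 4 * κ ^ 7 * (T * W)) := by
      gcongr
      exact le_self_pow₀ hκ1 (by norm_num)
    have e2 : (1 : ℝ) ≤ (T + 1) * W := one_le_mul_of_one_le_of_one_le (by linarith) hW1
    calc _ ≤ κ * (κ + 4 * κ ^ 7 * (T * Y)) := by gcongr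
      _ ≤ κ ^ 8 * (1 + 4 * (T * W)) := e1.trans_eq (by ring)
      _ ≤ κ ^ 8 * (5 * ((T + 1) * W)) := by gcongr; nlinarith
      _ = _ := by ring
  have hpos' : 0 < κ * (κ + (∑ t ∈ Finset.Ico 1 (T + 1),
      r.zrel m (r.j 𝒯 m t ω) t ω ⬝ᵥ r.zrel m (r.j 𝒯 m t ω) t ω) / 𝒯.relVar) := by
    have : 0 ≤ ∑ t ∈ Finset.Ico 1 (T + 1),
      r.zrel m (r.j 𝒯 m t ω) t ω ⬝ᵥ r.zrel m (r.j 𝒯 m t ω) t ω :=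
      Finset.sum_nonneg fun t _ => dotProduct_self_nonneg' _
    positivity
  refine (Real.log_le_log hpos' h2).trans ?_
  have h3 : Real.log (5 * κ ^ 8 * ((T + 1) * W)) = Real.log (5 * κ ^ 8) +
      (Real.log (T + 1) + (Real.log (T + 1) + (Real.log (1 + Real.log n) + Real.log (1 + U)))) := by
    have e1 : 5 * κ ^ 8 ≠ 0 := by positivity
    have e2 : (T : ℝ) + 1 ≠ 0 := by positivity
    have e3 : 1 + Real.log n ≠ 0 := by positivity
    have e4 : 1 + U ≠ 0 := by positivity
    rw [hW, Real.log_mul e1 (by positivity), Real.log_mul e2 (by positivity),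
      Real.log_mul e2 (by positivity), Real.log_mul e3 e4]
  rw [h3]
  have h4 := Real.log_le_sub_one_of_pos (show 0 < 5 * κ ^ 8 by positivity)
  have h5 := log_add_one_le_logFactor hT hn1
  have h6 := one_le_logFactor hT hn1
  have h7 : Real.log (1 + Real.log n) ≤ logFactor T n - 1 := by
    have := Real.log_nonneg hT'
    unfold logFactor
    linarith
  have h8 : 0 ≤ Real.log (1 + U) := Real.log_nonneg (by linarith)
  set ℓ := logFactor T n
  set g := Real.log (1 + U)
  have hκ8 : 1 ≤ κ ^ 8 := one_le_pow₀ hκ1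
  have h9 : 1 ≤ ℓ * (1 + g) := one_le_mul_of_one_le_of_one_le h6 (by linarith)
  have h10 : ℓ ≤ ℓ * (1 + g) := le_mul_of_one_le_right (by linarith) (by linarith)
  have h11 : g ≤ ℓ * (1 + g) := by nlinarith
  have h12 : 5 * κ ^ 8 * 1 ≤ 5 * κ ^ 8 * (ℓ * (1 + g)) := by gcongr
  have h13 : 1 * (ℓ * (1 + g)) ≤ κ ^ 8 * (ℓ * (1 + g)) := by gcongr
  linarith

/-- Bounds on the exponentials of noises and self-normalised errors give the path bounds, with a
level logarithmic in those exponentials. -/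
lemma IsTSDEMF.pathBound_of_exp_le (hr : r.IsTSDEMF 𝒯 P) (h𝒯 : 𝒯.Assumptions)
    (hκ : 𝒯.BoundedBy m κ) (hpos : 0 < 𝒯.relVar) (hdx : dx ≠ 0) (hT : 1 ≤ T)
    (hω : r.InSupport 𝒯 m ω) {U : ℝ} (hU : 0 ≤ U)
    (h1 : ∀ s ≤ T, ∀ a, Real.exp (r.relNoise m i s ω a ^ 2 / (4 * (κ * 𝒯.relVar))) ≤ (T + 1) * U)
    (h2 : ∀ i, ∀ s ≤ T, ∀ a, Real.exp (r.relNoise m i s ω a ^ 2 / (4 * (κ * 𝒯.relVar))) ≤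
      n * ((T + 1) * U))
    (h3 : ∀ t, 1 ≤ t → t ≤ T → ∀ l, r.expScore 𝒯 m l t (r.relParam m ω) ω ≤ T * U ∧
      r.expScore 𝒯 m l t (r.relSample m t ω) ω ≤ T * U) :
    r.PathBound 𝒯 m i T (11 * κ ^ 8) (logFactor T n * (1 + Real.log (1 + U))) ω := by
  have hκ1 := hκ.one_le
  have hκ8 : 1 ≤ κ ^ 8 := one_le_pow₀ hκ1
  have hn1 : 1 ≤ n := Nat.one_le_iff_ne_zero.2 (NeZero.ne n)
  have hT' : (1 : ℝ) ≤ T := by exact_mod_cast hT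
  have hl := log_add_log_le hT hn1 hU
  have hd := one_le_dim (du := du) hdx
  have hb1 : 1 ≤ logFactor T n * (1 + Real.log (1 + U)) :=
    one_le_mul_of_one_le_of_one_le (one_le_logFactor hT hn1)
      (by linarith [Real.log_nonneg (show (1 : ℝ) ≤ 1 + U by linarith)])
  have hA1 : 1 ≤ ((T : ℝ) + 1) * (1 + U) :=
    one_le_mul_of_one_le_of_one_le (by linarith) (by linarith)
  have hlog : Real.log (((T : ℝ) + 1) * (1 + U)) ≤ logFactor T n * (1 + Real.log (1 + U)) := by
    rwa [Real.log_mul (by positivity) (by positivity)]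
  have hD := hr.logDetGain_le_of_exp_le h𝒯 hκ hpos hT hω hU h2
  set b := logFactor T n * (1 + Real.log (1 + U))
  have hscore : ∀ t, 1 ≤ t → t ≤ T → ∀ l θ, r.expScore 𝒯 m l t θ ω ≤ T * U →
      quad (r.relCovAt 𝒯 m ω t) (r.score 𝒯 m l t θ ω) ≤ 11 * κ ^ 8 * ((dx + du) * b) := by
    intro t ht htT l θ hle
    have hseq := Run.isCovSeq (r := r) h𝒯 m hpos ω
    rw [quad_score_eq h𝒯 hpos m l ht]
    have e1 := hseq.logDetGain_mono ht (show t ≤ T + 1 by omega)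
    have e2 : Real.log (r.expScore 𝒯 m l t θ ω) ≤ b := by
      refine (Real.log_le_log (expScore_pos h𝒯 hpos m l ht θ ω) (hle.trans ?_)).trans hlog
      gcongr <;> linarith
    have e3 : b ≤ (dx + du) * b := le_mul_of_one_le_left (by linarith) hd
    have e4 : (dx + du) * b ≤ κ ^ 8 * ((dx + du) * b) :=
      le_mul_of_one_le_left (by linarith) hκ8
    linarith
  refine ⟨hω, hb1, ?_, ?_, fun t ht htT l => hscore t ht htT l _ (h3 t ht htT l).1,
    fun t ht htT l => hscore t ht htT l _ (h3 t ht htT l).2⟩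
  · intro t ht htT
    refine (hr.xrel_le_of_exp_le h𝒯 hκ hpos hω hA1
      (fun s hs a => (h1 s hs a).trans (by gcongr; linarith)) ht htT).trans ?_
    have e1 : κ ^ 5 ≤ κ ^ 8 := pow_le_pow_right₀ hκ1 (by norm_num)
    have e2 : 4 * κ ^ 5 ≤ 11 * κ ^ 8 := by linarith [one_le_pow₀ hκ1 (n := 5)]
    have e3 : 0 ≤ Real.log (((T : ℝ) + 1) * (1 + U)) := Real.log_nonneg hA1
    gcongr
  · refine hD.trans ?_
    gcongr
    norm_num

end Deterministic

end Run

lemma integrable_of_lintegral_le {Ω : Type*} [MeasurableSpace Ω] {P : Measure Ω} {f : Ω → ℝ}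
    (hf : Measurable f) (h0 : ∀ ω, 0 ≤ f ω) {c : ℝ} (hc : 0 ≤ c)
    (h : ∫⁻ ω, ENNReal.ofReal (f ω) ∂P ≤ ENNReal.ofReal c) : Integrable f P ∧ ∫ ω, f ω ∂P ≤ c := by
  refine ⟨⟨hf.aestronglyMeasurable, ?_⟩, ?_⟩
  · rw [hasFiniteIntegral_iff_ofReal (Filter.Eventually.of_forall h0)]
    exact h.trans_lt ENNReal.ofReal_lt_top
  · rw [integral_eq_lintegral_of_nonneg_ae (Filter.Eventually.of_forall h0)
      hf.aestronglyMeasurable]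
    exact ENNReal.toReal_le_of_le_ofReal hc h

namespace Run

variable {M n dx du : ℕ} {Ω : Type*} {r : Run M n dx du Ω} {𝒯 : Team M n dx du}
variable [mΩ : MeasurableSpace Ω] {P : Measure Ω} [NeZero n] [IsProbabilityMeasure P]

lemma IsTSDEMF.measurable_expScore (hr : r.IsTSDEMF 𝒯 P) (h𝒯 : 𝒯.Assumptions) (m : Fin M)
    (l : Fin dx) {t : ℕ} (ht : 1 ≤ t) {θ : Ω → Param (Fin dx) (Fin du)} (hθ : Measurable θ) :
    Measurable fun ω => r.expScore 𝒯 m l t (θ ω) ω := by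
  have hle := (hr.relInfo_le_hist h𝒯 m t).trans (hr.hist_le m t t)
  have hS : Measurable fun ω => r.relCovAt 𝒯 m ω t :=
    (hr.measurable_relInfo_relCovAt h𝒯 m ht le_rfl).mono hle le_rfl
  have hb : Measurable (r.response 𝒯 m l t) :=
    (hr.measurable_relInfo_response h𝒯 m l t).mono hle le_rfl
  have hs : Measurable fun ω => r.score 𝒯 m l t (θ ω) ω :=
    hb.sub (measurable_mulVec (measurable_matrix_inv hS) (measurable_column l hθ))
  exact (Real.measurable_exp.comp ((measurable_quad hS hs).div_const 2)).mul
    ((measurable_det hS).div_const (𝒯.relCov m).det).sqrt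

/-- Almost surely the path bounds hold with a random level whose third moment is polylogarithmic. -/
lemma IsTSDEMF.exists_pathBound (hr : r.IsTSDEMF 𝒯 P) (h𝒯 : 𝒯.Assumptions) {m : Fin M} {κ : ℝ}
    (hκ : 𝒯.BoundedBy m κ) (hpos : 0 < 𝒯.relVar) (hdx : dx ≠ 0) (i : Fin n) {T : ℕ} (hT : 1 ≤ T) :
    ∃ b : Ω → ℝ, Integrable (fun ω => b ω ^ 3) P ∧
      ∫ ω, b ω ^ 3 ∂P ≤
        27 * (1 + κ ^ 2 * (4 + 2 * Real.exp (κ ^ 3 / 2))) * logFactor T n ^ 3 ∧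
      ∀ᵐ ω ∂P, r.PathBound 𝒯 m i T (11 * κ ^ 8) (b ω) ω := by
  have hn1 : 1 ≤ n := Nat.one_le_iff_ne_zero.2 (NeZero.ne n)
  have hn0 : (0 : ℝ) < n := by exact_mod_cast hn1
  have hT0 : (0 : ℝ) < T := by exact_mod_cast hT
  have hκ1 := hκ.one_le
  -- the exponential moments
  let N : Fin n → ℕ → Fin dx → Ω → ℝ := fun j s a ω =>
    Real.exp (r.relNoise m j s ω a ^ 2 / (4 * (κ * 𝒯.relVar)))
  let G : ℕ → Fin dx → Ω → ℝ := fun t l ω => r.expScore 𝒯 m l t (r.relParam m ω) ω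
  let H : ℕ → Fin dx → Ω → ℝ := fun t l ω => r.expScore 𝒯 m l t (r.relSample m t ω) ω
  have hNm : ∀ j s a, Measurable (N j s a) := by
    intro j s a
    have : Measurable fun ω => r.relNoise m j s ω a :=
      (measurable_pi_apply a).comp (hr.measurable_relNoise h𝒯 m j s)
    exact Real.measurable_exp.comp ((this.pow_const 2).div_const _)
  have hN : ∀ j s a, Integrable (N j s a) P ∧ ∫ ω, N j s a ω ∂P ≤ 2 := by
    intro j s a
    obtain ⟨h1, h2⟩ := integrable_of_lintegral_le (hNm j s a) (fun ω => (Real.exp_pos _).le)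
      (Real.sqrt_nonneg _) (hr.lintegral_exp_relNoise_le h𝒯 hκ hpos j s a)
    exact ⟨h1, h2.trans (Real.sqrt_le_iff.2 ⟨zero_le_two, by norm_num⟩)⟩
  have hG : ∀ t ∈ Finset.Icc 1 T, ∀ l, Integrable (G t l) P ∧
      ∫ ω, G t l ω ∂P ≤ Real.exp (κ ^ 3 / 2) := fun t ht l =>
    integrable_of_lintegral_le (hr.measurable_expScore h𝒯 m l (Finset.mem_Icc.1 ht).1
      (hr.measurable_relParam m))
      (fun ω => (expScore_pos h𝒯 hpos m l (Finset.mem_Icc.1 ht).1 _ ω).le)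
      (Real.exp_pos _).le (hr.lintegral_expScore_le h𝒯 hκ hpos l (Finset.mem_Icc.1 ht).1)
  have hH : ∀ t ∈ Finset.Icc 1 T, ∀ l, Integrable (H t l) P ∧
      ∫ ω, H t l ω ∂P ≤ Real.exp (κ ^ 3 / 2) := fun t ht l =>
    integrable_of_lintegral_le (hr.measurable_expScore h𝒯 m l (Finset.mem_Icc.1 ht).1
      (hr.relSample_measurable m t))
      (fun ω => (expScore_pos h𝒯 hpos m l (Finset.mem_Icc.1 ht).1 _ ω).le)
      (Real.exp_pos _).le ((hr.lintegral_expScore_sample h𝒯 m l (Finset.mem_Icc.1 ht).1).trans_le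
        (hr.lintegral_expScore_le h𝒯 hκ hpos l (Finset.mem_Icc.1 ht).1))
  -- `U` is the sum of the time averages for agent `i`, the mean of those over all agents, and the
  -- time average of the scores; each exponential is at most `U` times the number of terms averaged
  let V : Fin n → Ω → ℝ := fun j ω => (∑ s ∈ Finset.range (T + 1), ∑ a, N j s a ω) / (T + 1)
  let U₃ : Ω → ℝ := fun ω => (∑ t ∈ Finset.Icc 1 T, ∑ l, (G t l ω + H t l ω)) / T
  let U : Ω → ℝ := fun ω => V i ω + (∑ j, V j ω) / n + U₃ ω
  have hV0 : ∀ j ω, 0 ≤ V j ω := fun j ω => div_nonneg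
    (Finset.sum_nonneg fun s _ => Finset.sum_nonneg fun a _ => (Real.exp_pos _).le) (by positivity)
  have hGH0 : ∀ t ∈ Finset.Icc 1 T, ∀ l ω, 0 ≤ G t l ω ∧ 0 ≤ H t l ω := fun t ht l ω =>
    ⟨(expScore_pos h𝒯 hpos m l (Finset.mem_Icc.1 ht).1 _ ω).le,
      (expScore_pos h𝒯 hpos m l (Finset.mem_Icc.1 ht).1 _ ω).le⟩
  have hU₃0 : ∀ ω, 0 ≤ U₃ ω := fun ω => div_nonneg
    (Finset.sum_nonneg fun t ht => Finset.sum_nonneg fun l _ =>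
      add_nonneg (hGH0 t ht l ω).1 (hGH0 t ht l ω).2) hT0.le
  have hVs0 : ∀ ω, 0 ≤ (∑ j, V j ω) / n := fun ω =>
    div_nonneg (Finset.sum_nonneg fun j _ => hV0 j ω) hn0.le
  have hU0 : ∀ ω, 0 ≤ U ω := fun ω => add_nonneg (add_nonneg (hV0 i ω) (hVs0 ω)) (hU₃0 ω)
  have hVi : ∀ j, Integrable (V j) P := fun j =>
    (integrable_finsetSum _ fun s _ => integrable_finsetSum _ fun a _ => (hN j s a).1).div_const _
  have hVE : ∀ j, ∫ ω, V j ω ∂P ≤ 2 * dx := by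
    intro j
    simp only [V]
    rw [integral_div, integral_finsetSum _ fun s _ => integrable_finsetSum _ fun a _ =>
      (hN j s a).1, div_le_iff₀ (by positivity)]
    calc _ ≤ ∑ _s ∈ Finset.range (T + 1), ∑ _a : Fin dx, (2 : ℝ) := by
          refine Finset.sum_le_sum fun s _ => ?_
          rw [integral_finsetSum _ fun a _ => (hN j s a).1]
          exact Finset.sum_le_sum fun a _ => (hN j s a).2
      _ = _ := by simp; ring
  have hGHi : ∀ t ∈ Finset.Icc 1 T, ∀ l, Integrable (fun ω => G t l ω + H t l ω) P :=
    fun t ht l => (hG t ht l).1.add (hH t ht l).1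
  have hU₃i : Integrable U₃ P :=
    (integrable_finsetSum _ fun t ht => integrable_finsetSum _ fun l _ =>
      hGHi t ht l).div_const _
  have hU₃E : ∫ ω, U₃ ω ∂P ≤ dx * (2 * Real.exp (κ ^ 3 / 2)) := by
    simp only [U₃]
    rw [integral_div, integral_finsetSum _ fun t ht => integrable_finsetSum _ fun l _ =>
      hGHi t ht l, div_le_iff₀ hT0]
    calc _ ≤ ∑ _t ∈ Finset.Icc 1 T, ∑ _l : Fin dx, (2 * Real.exp (κ ^ 3 / 2)) := by
          refine Finset.sum_le_sum fun t ht => ?_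
          rw [integral_finsetSum _ fun l _ => hGHi t ht l]
          refine Finset.sum_le_sum fun l _ => ?_
          rw [integral_add (hG t ht l).1 (hH t ht l).1]
          linarith [(hG t ht l).2, (hH t ht l).2]
      _ = _ := by simp; ring
  have hVsi : Integrable (fun ω => (∑ j, V j ω) / n) P :=
    (integrable_finsetSum _ fun j _ => hVi j).div_const _
  have hVsE : ∫ ω, (∑ j, V j ω) / n ∂P ≤ 2 * dx := by
    rw [integral_div, integral_finsetSum _ fun j _ => hVi j, div_le_iff₀ hn0]
    calc _ ≤ ∑ _j : Fin n, (2 * dx : ℝ) := Finset.sum_le_sum fun j _ => hVE j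
      _ = _ := by simp; ring
  have hVVi : Integrable (fun ω => V i ω + (∑ j, V j ω) / n) P := (hVi i).add hVsi
  have hUi : Integrable U P := hVVi.add hU₃i
  obtain ⟨ω₀, hω₀⟩ := (hr.ae_inSupport h𝒯 m).exists
  have hdim := hω₀.dim_le h𝒯 hκ
  have hUE : ∫ ω, U ω ∂P ≤ κ ^ 2 * (4 + 2 * Real.exp (κ ^ 3 / 2)) := by
    have e1 : ∫ ω, U ω ∂P = ∫ ω, V i ω ∂P + ∫ ω, (∑ j, V j ω) / n ∂P + ∫ ω, U₃ ω ∂P := by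
      simp only [U]
      rw [integral_add hVVi hU₃i, integral_add (hVi i) hVsi]
    have e2 : (dx : ℝ) * (4 + 2 * Real.exp (κ ^ 3 / 2)) ≤
        κ ^ 2 * (4 + 2 * Real.exp (κ ^ 3 / 2)) := by gcongr
    rw [e1]
    linarith [hVE i]
  have hUm : Measurable U := by
    have hVm : ∀ j, Measurable (V j) := fun j =>
      (Finset.measurable_fun_sum _ fun s _ => Finset.measurable_fun_sum _ fun a _ =>
        hNm j s a).div_const _
    have hU₃m : Measurable U₃ :=
      (Finset.measurable_fun_sum _ fun t ht => Finset.measurable_fun_sum _ fun l _ =>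
        (hr.measurable_expScore h𝒯 m l (Finset.mem_Icc.1 ht).1 (hr.measurable_relParam m)).add
        (hr.measurable_expScore h𝒯 m l (Finset.mem_Icc.1 ht).1
          (hr.relSample_measurable m t))).div_const _
    exact ((hVm i).add ((Finset.measurable_fun_sum _ fun j _ => hVm j).div_const _)).add hU₃m
  have hbm : Measurable fun ω => logFactor T n * (1 + Real.log (1 + U ω)) := by fun_prop
  have hℓ := one_le_logFactor hT hn1
  have hlog0 : ∀ ω, 0 ≤ Real.log (1 + U ω) := fun ω => Real.log_nonneg (by linarith [hU0 ω])
  have hb3 : ∀ ω, (logFactor T n * (1 + Real.log (1 + U ω))) ^ 3 ≤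
      27 * logFactor T n ^ 3 * (1 + U ω) := by
    intro ω
    rw [mul_pow]
    refine (mul_le_mul_of_nonneg_left (one_add_log_pow_three_le (hU0 ω))
      (by positivity)).trans_eq ?_
    ring
  have hdom : Integrable (fun ω => 27 * logFactor T n ^ 3 * (1 + U ω)) P :=
    ((integrable_const 1).add hUi).const_mul _
  have hint : Integrable (fun ω => (logFactor T n * (1 + Real.log (1 + U ω))) ^ 3) P := by
    refine hdom.mono' (hbm.pow_const 3).aestronglyMeasurable
      (Filter.Eventually.of_forall fun ω => ?_)
    have := hlog0 ω
    rw [Real.norm_of_nonneg (by positivity)]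
    exact hb3 ω
  refine ⟨fun ω => logFactor T n * (1 + Real.log (1 + U ω)), hint, ?_, ?_⟩
  · refine (integral_mono hint hdom hb3).trans ?_
    rw [integral_const_mul, integral_add (integrable_const 1) hUi]
    simp only [integral_const, probReal_univ, smul_eq_mul, mul_one]
    calc _ ≤ 27 * logFactor T n ^ 3 * (1 + κ ^ 2 * (4 + 2 * Real.exp (κ ^ 3 / 2))) := by gcongr
      _ = _ := by ring
  · filter_upwards [hr.ae_inSupport h𝒯 m] with ω hω
    have hNV : ∀ j, ∀ s ≤ T, ∀ a, N j s a ω ≤ (T + 1) * V j ω := by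
      intro j s hs a
      have e : (T + 1) * V j ω = ∑ s ∈ Finset.range (T + 1), ∑ a, N j s a ω := by
        simp only [V]
        field_simp
      rw [e]
      calc N j s a ω ≤ ∑ a, N j s a ω :=
            Finset.single_le_sum (f := fun a => N j s a ω) (fun a _ => (Real.exp_pos _).le)
              (Finset.mem_univ a)
        _ ≤ _ := Finset.single_le_sum (f := fun s => ∑ a, N j s a ω)
            (fun s _ => Finset.sum_nonneg fun a _ => (Real.exp_pos _).le)
            (Finset.mem_range.2 (by omega))
    refine hr.pathBound_of_exp_le h𝒯 hκ hpos hdx hT hω (hU0 ω) ?_ ?_ ?_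
    · intro s hs a
      refine (hNV i s hs a).trans ?_
      gcongr
      simp only [U]
      linarith [hVs0 ω, hU₃0 ω]
    · intro j s hs a
      refine (hNV j s hs a).trans ?_
      have e1 : V j ω ≤ n * ((∑ j, V j ω) / n) := by
        rw [mul_div_cancel₀ _ hn0.ne']
        exact Finset.single_le_sum (f := fun j => V j ω) (fun j _ => hV0 j ω) (Finset.mem_univ j)
      have e2 : n * ((∑ j, V j ω) / n) ≤ n * U ω := by
        gcongr
        simp only [U]
        linarith [hV0 i ω, hU₃0 ω]
      calc _ ≤ ((T : ℝ) + 1) * (n * U ω) := by gcongr; exact e1.trans e2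
        _ = _ := by ring
    · intro t ht htT l
      have htm : t ∈ Finset.Icc 1 T := Finset.mem_Icc.2 ⟨ht, htT⟩
      have e1 : G t l ω + H t l ω ≤ T * U₃ ω := by
        have e : T * U₃ ω = ∑ t ∈ Finset.Icc 1 T, ∑ l, (G t l ω + H t l ω) := by
          simp only [U₃]
          field_simp
        rw [e]
        calc _ ≤ ∑ l, (G t l ω + H t l ω) :=
              Finset.single_le_sum (f := fun l => G t l ω + H t l ω)
                (fun l _ => add_nonneg (hGH0 t htm l ω).1 (hGH0 t htm l ω).2) (Finset.mem_univ l)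
          _ ≤ _ := Finset.single_le_sum (f := fun t => ∑ l, (G t l ω + H t l ω))
              (fun t ht => Finset.sum_nonneg fun l _ =>
                add_nonneg (hGH0 t ht l ω).1 (hGH0 t ht l ω).2) htm
      have e2 : T * U₃ ω ≤ T * U ω := by
        gcongr
        simp only [U]
        linarith [hV0 i ω, hVs0 ω]
      have e3 := hGH0 t htm l ω
      exact ⟨by linarith [e3.2, show r.expScore 𝒯 m l t (r.relParam m ω) ω = G t l ω from rfl],
        by linarith [e3.1, show r.expScore 𝒯 m l t (r.relSample m t ω) ω = H t l ω from rfl]⟩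

end Run

/-! ### Moments of the noise in a quadratic form -/

section Moments

variable {Ω : Type*} {𝓗 : MeasurableSpace Ω} [mΩ : MeasurableSpace Ω] {P : Measure Ω}
  [IsProbabilityMeasure P]

lemma integrable_of_map_gaussian {Y : Ω → ℝ} (hY : Measurable Y) {v : NNReal}
    (h : P.map Y = gaussianReal 0 v) :
    Integrable Y P ∧ ∫ ω, Y ω ∂P = 0 ∧ Integrable (fun ω => Y ω ^ 2) P ∧
      ∫ ω, Y ω ^ 2 ∂P = v := by
  have h1 : MemLp id 2 (gaussianReal 0 v) := memLp_id_gaussianReal 2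
  have h2 : MemLp Y 2 P := by
    rw [← h] at h1
    exact (memLp_map_measure_iff aestronglyMeasurable_id hY.aemeasurable).1 h1
  have h3 : ∫ ω, Y ω ∂P = 0 := by
    have e := integral_map (μ := P) hY.aemeasurable (f := fun x : ℝ => x)
      aestronglyMeasurable_id
    rw [h, integral_id_gaussianReal] at e
    exact e.symm
  refine ⟨h2.integrable one_le_two, h3, h2.integrable_sq, ?_⟩
  have e := integral_map (μ := P) hY.aemeasurable (f := fun x : ℝ => x ^ 2)
    (by fun_prop)
  rw [h] at e
  rw [← e]
  have h4 := variance_fun_id_gaussianReal (μ := 0) (v := v)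
  rwa [variance_of_integral_eq_zero (by fun_prop) (by rw [integral_id_gaussianReal])] at h4

/-- Moments of order two of a vector, given the laws of its linear combinations. -/
lemma integral_mul_of_map_gaussian {ι : Type} [Fintype ι] [DecidableEq ι] {W : Ω → ι → ℝ}
    (hW : Measurable W) {s : ℝ} (hs : 0 ≤ s)
    (hlaw : ∀ c : ι → ℝ, P.map (fun ω => c ⬝ᵥ W ω) = gaussianReal 0 (Real.toNNReal (s * (c ⬝ᵥ c))))
    (a b : ι) :
    Integrable (fun ω => W ω a * W ω b) P ∧ ∫ ω, W ω a * W ω b ∂P = if a = b then s else 0 := by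
  have hm : ∀ c : ι → ℝ, Measurable fun ω => c ⬝ᵥ W ω := fun c =>
    measurable_dotProduct measurable_const hW
  obtain ⟨-, -, hi1, he1⟩ := integrable_of_map_gaussian (hm (Pi.single a 1 + Pi.single b 1))
    (hlaw (Pi.single a 1 + Pi.single b 1))
  obtain ⟨-, -, hi2, he2⟩ := integrable_of_map_gaussian (hm (Pi.single a 1 - Pi.single b 1))
    (hlaw (Pi.single a 1 - Pi.single b 1))
  have e : (fun ω => W ω a * W ω b) = fun ω =>
      (((Pi.single a 1 + Pi.single b 1 : ι → ℝ) ⬝ᵥ W ω) ^ 2 -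
        ((Pi.single a 1 - Pi.single b 1 : ι → ℝ) ⬝ᵥ W ω) ^ 2) / 4 := by
    ext ω
    simp only [add_dotProduct, sub_dotProduct, single_one_dotProduct]
    ring
  rw [e]
  refine ⟨(hi1.sub hi2).div_const _, ?_⟩
  rw [integral_div, integral_sub hi1 hi2, he1, he2,
    Real.coe_toNNReal _ (mul_nonneg hs (dotProduct_self_nonneg' _)),
    Real.coe_toNNReal _ (mul_nonneg hs (dotProduct_self_nonneg' _))]
  simp only [add_dotProduct, sub_dotProduct, single_one_dotProduct, Pi.add_apply, Pi.sub_apply]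
  by_cases hab : a = b
  · subst hab
    simp
    ring
  · simp [hab, Ne.symm hab]

/-- A centred quadratic polynomial of a Gaussian vector with coefficients independent of it has mean
zero. -/
lemma integral_noise_eq_zero {ι : Type} [Fintype ι] [DecidableEq ι] {W : Ω → ι → ℝ}
    (hW : Measurable W)
    (hind : Indep (MeasurableSpace.comap W inferInstance) 𝓗 P) {s : ℝ} (hs : 0 ≤ s)
    (hlaw : ∀ c : ι → ℝ, P.map (fun ω => c ⬝ᵥ W ω) = gaussianReal 0 (Real.toNNReal (s * (c ⬝ᵥ c))))
    {a : Ω → ι → ℝ} {S : Ω → Matrix ι ι ℝ} (ha : Measurable[𝓗] a) (hS : Measurable[𝓗] S)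
    (hai : ∀ l, Integrable (fun ω => a ω l) P) (hSi : ∀ l k, Integrable (fun ω => S ω l k) P) :
    Integrable (fun ω => 2 * (W ω ⬝ᵥ a ω) + quad (S ω) (W ω) - s * (S ω).trace) P ∧
      ∫ ω, (2 * (W ω ⬝ᵥ a ω) + quad (S ω) (W ω) - s * (S ω).trace) ∂P = 0 := by
  have hind' : ∀ {f : (ι → ℝ) → ℝ} (_ : Measurable f) {g : Ω → ℝ} (_ : Measurable[𝓗] g),
      IndepFun (fun ω => f (W ω)) g P := by
    intro f hf g hg
    rw [IndepFun_iff_Indep]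
    refine indep_of_indep_of_le_left (indep_of_indep_of_le_right hind hg.comap_le) ?_
    rintro _ ⟨A, hA, rfl⟩
    exact ⟨f ⁻¹' A, hf hA, rfl⟩
  have hal : ∀ l, Measurable[𝓗] fun ω => a ω l := fun l => (measurable_pi_apply l).comp ha
  have hSl : ∀ l k, Measurable[𝓗] fun ω => S ω l k := fun l k =>
    (measurable_pi_apply k).comp ((measurable_pi_apply l).comp hS)
  have hW1 : ∀ l, Integrable (fun ω => W ω l) P ∧ ∫ ω, W ω l ∂P = 0 := by
    intro l
    have h := integrable_of_map_gaussian (measurable_dotProduct measurable_const hW)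
      (hlaw (Pi.single l 1))
    simp only [single_one_dotProduct] at h
    exact ⟨h.1, h.2.1⟩
  have hW2 := integral_mul_of_map_gaussian hW hs hlaw
  have h1 : ∀ l, Integrable (fun ω => W ω l * a ω l) P ∧ ∫ ω, W ω l * a ω l ∂P = 0 := by
    intro l
    have hi := hind' (measurable_pi_apply l) (hal l)
    refine ⟨hi.integrable_mul (hW1 l).1 (hai l), ?_⟩
    have h := hi.integral_fun_mul_eq_mul_integral (hW1 l).1.aestronglyMeasurable
      (hai l).aestronglyMeasurable
    rw [h, (hW1 l).2, zero_mul]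
  have h2 : ∀ l k, Integrable (fun ω => W ω l * W ω k * S ω l k) P ∧
      ∫ ω, W ω l * W ω k * S ω l k ∂P = (if l = k then s else 0) * ∫ ω, S ω l k ∂P := by
    intro l k
    have hi := hind' (f := fun w => w l * w k)
      ((measurable_pi_apply l).mul (measurable_pi_apply k)) (hSl l k)
    refine ⟨hi.integrable_mul (hW2 l k).1 (hSi l k), ?_⟩
    have h := hi.integral_fun_mul_eq_mul_integral (hW2 l k).1.aestronglyMeasurable
      (hSi l k).aestronglyMeasurable
    rw [h, (hW2 l k).2]
  have e : ∀ ω, 2 * (W ω ⬝ᵥ a ω) + quad (S ω) (W ω) - s * (S ω).trace =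
      2 * (∑ l, W ω l * a ω l) + (∑ l, ∑ k, W ω l * W ω k * S ω l k) - s * ∑ l, S ω l l := by
    intro ω
    simp only [quad, dotProduct, mulVec, Matrix.trace, Matrix.diag, Finset.mul_sum]
    congr 2
    refine Finset.sum_congr rfl fun l _ => Finset.sum_congr rfl fun k _ => ?_
    ring
  have i1 : Integrable (fun ω => 2 * (∑ l, W ω l * a ω l)) P :=
    (integrable_finsetSum _ fun l _ => (h1 l).1).const_mul 2
  have i2 : Integrable (fun ω => ∑ l, ∑ k, W ω l * W ω k * S ω l k) P :=
    integrable_finsetSum _ fun l _ => integrable_finsetSum _ fun k _ => (h2 l k).1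
  have i3 : Integrable (fun ω => s * ∑ l, S ω l l) P :=
    (integrable_finsetSum _ fun l _ => hSi l l).const_mul s
  have i12 : Integrable (fun ω => 2 * (∑ l, W ω l * a ω l) +
      ∑ l, ∑ k, W ω l * W ω k * S ω l k) P := i1.add i2
  simp only [e]
  refine ⟨i12.sub i3, ?_⟩
  rw [integral_sub i12 i3, integral_add i1 i2, integral_const_mul, integral_const_mul,
    integral_finsetSum _ fun l _ => (h1 l).1, integral_finsetSum _ fun l _ => hSi l l,
    integral_finsetSum _ fun l _ => integrable_finsetSum _ fun k _ => (h2 l k).1]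
  have e2 : ∀ l, ∫ ω, ∑ k, W ω l * W ω k * S ω l k ∂P = s * ∫ ω, S ω l l ∂P := by
    intro l
    rw [integral_finsetSum _ fun k _ => (h2 l k).1]
    simp [(h2 l _).2]
  simp [(h1 _).2, e2, Finset.mul_sum]

end Moments

namespace Run

variable {M n dx du : ℕ} {Ω : Type*} {r : Run M n dx du Ω} {𝒯 : Team M n dx du}
variable [mΩ : MeasurableSpace Ω] {P : Measure Ω} [NeZero n] [IsProbabilityMeasure P]
variable {m : Fin M} {i : Fin n} {T : ℕ} {κ c : ℝ} {b : Ω → ℝ}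

/-! ### Integrability -/

lemma relJ_nonneg (m : Fin M) (θ : Param (Fin dx) (Fin du)) : 0 ≤ 𝒯.relJ m θ := by
  refine mul_nonneg relVar_nonneg ?_
  rw [trace_eq_sum_quad]
  exact Finset.sum_nonneg fun a _ => quad_nonneg (relS_posSemidef m θ) _

lemma relJ_le (hκ : 𝒯.BoundedBy m κ) {θ : Param (Fin dx) (Fin du)} (hθ : θ ∈ 𝒯.relSet m) :
    𝒯.relJ m θ ≤ κ * 𝒯.relVar := by
  rw [mul_comm]
  exact mul_le_mul_of_nonneg_left (hκ.trace_S θ hθ) relVar_nonneg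

omit mΩ [NeZero n] in
lemma relS_apply_abs_le (hκ : 𝒯.BoundedBy m κ) {θ : Param (Fin dx) (Fin du)}
    (hθ : θ ∈ 𝒯.relSet m) (l k : Fin dx) : |𝒯.relS m θ l k| ≤ κ := by
  have h1 := dotProduct_mulVec_sq_le (relS_posSemidef (𝒯 := 𝒯) m θ) (Pi.single l 1) (Pi.single k 1)
  have h2 : ∀ a : Fin dx, quad (𝒯.relS m θ) (Pi.single a 1) ≤ κ := by
    intro a
    have := quad_le_of_norm_le _ (hκ.norm_S _ hθ) (Pi.single a 1)
    simpa using this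
  have h3 : (Pi.single l 1 : Fin dx → ℝ) ⬝ᵥ (𝒯.relS m θ *ᵥ Pi.single k 1) = 𝒯.relS m θ l k := by
    simp
  rw [h3] at h1
  have hκ0 : 0 ≤ κ := zero_le_one.trans hκ.one_le
  refine abs_le_of_sq_le_sq (h1.trans ?_) hκ0
  rw [sq κ]
  exact mul_le_mul (h2 l) (h2 k) (quad_nonneg (relS_posSemidef m θ) _) hκ0

omit mΩ [NeZero n] in
lemma measurable_relS (h𝒯 : 𝒯.Assumptions) (m : Fin M) : Measurable (𝒯.relS m) :=
  measurable_riccati (h𝒯.Q_posDef m) (h𝒯.R_posDef m)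

omit mΩ [NeZero n] in
lemma measurable_relJ (h𝒯 : 𝒯.Assumptions) (m : Fin M) : Measurable (𝒯.relJ m) := by
  have h := measurable_relS h𝒯 m
  have h' : Measurable fun θ => (𝒯.relS m θ).trace :=
    Finset.measurable_fun_sum _ fun a _ =>
      (measurable_pi_apply a).comp ((measurable_pi_apply a).comp h)
  exact h'.const_mul _

namespace IsTSDEMF

variable (hr : r.IsTSDEMF 𝒯 P) (h𝒯 : 𝒯.Assumptions)
include hr h𝒯

lemma measurable_zrel (m : Fin M) (i : Fin n) {t : ℕ} (ht : 1 ≤ t) : Measurable (r.zrel m i t) :=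
  (hr.measurable_hist_zrel h𝒯 m i ht).mono (hr.hist_le m t (t + 1)) le_rfl

lemma measurable_relCurrent (m : Fin M) {t : ℕ} (ht : 1 ≤ t) : Measurable (r.relCurrent 𝒯 m t) :=
  (hr.measurable_hist_relCurrent h𝒯 m ht).mono (hr.hist_le m t (t + 1)) le_rfl

lemma integrable_relJ (hκ : 𝒯.BoundedBy m κ) {θ : Ω → Param (Fin dx) (Fin du)}
    (hθ : Measurable θ) (hmem : ∀ᵐ ω ∂P, θ ω ∈ 𝒯.relSet m) :
    Integrable (fun ω => 𝒯.relJ m (θ ω)) P := by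
  refine (integrable_const (κ * 𝒯.relVar)).mono'
    ((measurable_relJ h𝒯 m).comp hθ).aestronglyMeasurable ?_
  filter_upwards [hmem] with ω hω
  rw [Real.norm_of_nonneg (relJ_nonneg m _)]
  exact relJ_le hκ hω

lemma ae_relCurrent_mem (m : Fin M) {t : ℕ} (ht : 1 ≤ t) :
    ∀ᵐ ω ∂P, r.relCurrent 𝒯 m t ω ∈ 𝒯.relSet m := by
  filter_upwards [hr.ae_inSupport h𝒯 m] with ω hω using hω.relCurrent_mem ht

lemma integrable_quad_relS (hκ : 𝒯.BoundedBy m κ) {θ : Ω → Param (Fin dx) (Fin du)}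
    (hθ : Measurable θ) (hmem : ∀ᵐ ω ∂P, θ ω ∈ 𝒯.relSet m) {v : Ω → Fin dx → ℝ}
    (hv : Measurable v) {g : Ω → ℝ} (hg : Integrable g P) (hvg : ∀ᵐ ω ∂P, v ω ⬝ᵥ v ω ≤ g ω) :
    Integrable (fun ω => quad (𝒯.relS m (θ ω)) (v ω)) P := by
  refine (hg.const_mul κ).mono'
    (measurable_quad ((measurable_relS h𝒯 m).comp hθ) hv).aestronglyMeasurable ?_
  filter_upwards [hmem, hvg] with ω h1 h2
  rw [Real.norm_of_nonneg (quad_nonneg (relS_posSemidef m _) _)]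
  exact (quad_le_of_norm_le _ (hκ.norm_S _ h1) _).trans
    (mul_le_mul_of_nonneg_left h2 (zero_le_one.trans hκ.one_le))

lemma integrable_regretPath₀ (hκ : 𝒯.BoundedBy m κ) (T : ℕ) :
    Integrable (r.regretPath₀ 𝒯 m T) P := by
  have h : Integrable (fun ω => ∑ t ∈ Finset.Icc 1 T, 𝒯.relJ m (r.relCurrent 𝒯 m t ω) -
      T * 𝒯.relJ m (r.relParam m ω)) P :=
    (integrable_finsetSum _ fun t ht => hr.integrable_relJ h𝒯 hκ
      (hr.measurable_relCurrent h𝒯 m (Finset.mem_Icc.1 ht).1)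
      (hr.ae_relCurrent_mem h𝒯 m (Finset.mem_Icc.1 ht).1)).sub
      ((hr.integrable_relJ h𝒯 hκ (hr.measurable_relParam m) (hr.ae_relParam_mem h𝒯 m)).const_mul _)
  exact h.congr (Filter.Eventually.of_forall fun ω => (regretPath₀_eq m T ω).symm)

section

variable (hκ : 𝒯.BoundedBy m κ) (hc : 1 ≤ c)
  (hb : Integrable (fun ω => b ω ^ 3) P)
  (hbound : ∀ᵐ ω ∂P, r.PathBound 𝒯 m i T c (b ω) ω)
include hκ hc hb hbound

omit hr h𝒯 hκ hb in
lemma ae_xrel_le {t : ℕ} (ht : 1 ≤ t) (htT : t ≤ T + 1) :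
    ∀ᵐ ω ∂P, r.xrel m i t ω ⬝ᵥ r.xrel m i t ω ≤ c * (𝒯.relVar * b ω ^ 3) := by
  filter_upwards [hbound] with ω hω
  refine (hω.state_le t ht htT).trans ?_
  have h1 : b ω ≤ b ω ^ 3 := le_self_pow₀ hω.one_le (by norm_num)
  have := relVar_nonneg (𝒯 := 𝒯)
  gcongr

lemma integrable_regretPath₁ : Integrable (r.regretPath₁ 𝒯 m i T) P := by
  have h : ∀ t ∈ Finset.Icc 1 T, ∀ t', 1 ≤ t' → t' ≤ T + 1 →
      Integrable (fun ω => quad (𝒯.relS m (r.relCurrent 𝒯 m t ω)) (r.xrel m i t' ω)) P :=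
    fun t ht t' h1 h2 => hr.integrable_quad_relS h𝒯 hκ
      (hr.measurable_relCurrent h𝒯 m (Finset.mem_Icc.1 ht).1)
      (hr.ae_relCurrent_mem h𝒯 m (Finset.mem_Icc.1 ht).1) (hr.measurable_xrel h𝒯 m i h1)
      ((hb.const_mul _).const_mul _) (ae_xrel_le hc hbound h1 h2)
  have h' : Integrable (fun ω => ∑ t ∈ Finset.Icc 1 T,
      (quad (𝒯.relS m (r.relCurrent 𝒯 m t ω)) (r.xrel m i t ω) -
        quad (𝒯.relS m (r.relCurrent 𝒯 m t ω)) (r.xrel m i (t + 1) ω))) P := by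
    refine integrable_finsetSum _ fun t ht => ?_
    obtain ⟨h1, h2⟩ := Finset.mem_Icc.1 ht
    exact (h t ht t h1 (by omega)).sub (h t ht (t + 1) (by omega) (by omega))
  exact h'.congr (Filter.Eventually.of_forall fun ω => (regretPath₁_eq m i T ω).symm)

omit hκ in
lemma ae_closedLoop_le {θ : Ω → Param (Fin dx) (Fin du)}
    (hmem : ∀ᵐ ω ∂P, θ ω ∈ 𝒯.relSet m) {t : ℕ} (ht : 1 ≤ t) (htT : t ≤ T) :
    ∀ᵐ ω ∂P, ((θ ω)ᵀ *ᵥ r.zrel m i t ω) ⬝ᵥ ((θ ω)ᵀ *ᵥ r.zrel m i t ω) ≤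
      c * (𝒯.relVar * b ω ^ 3) := by
  filter_upwards [hmem, hr.ae_inSupport h𝒯 m,
    ae_xrel_le hc hbound ht (by omega : t ≤ T + 1)] with ω h1 h2 h3
  exact (hr.closedLoop_dotProduct_self_le h𝒯 h2 h1 ht).trans h3

lemma integrable_regretPath₂ : Integrable (r.regretPath₂ 𝒯 m i T) P := by
  have h : ∀ t ∈ Finset.Icc 1 T, ∀ θ : Ω → Param (Fin dx) (Fin du), Measurable θ →
      (∀ᵐ ω ∂P, θ ω ∈ 𝒯.relSet m) → Integrable (fun ω =>
        quad (𝒯.relS m (r.relCurrent 𝒯 m t ω)) ((θ ω)ᵀ *ᵥ r.zrel m i t ω)) P :=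
    fun t ht θ hθ hmem => hr.integrable_quad_relS h𝒯 hκ
      (hr.measurable_relCurrent h𝒯 m (Finset.mem_Icc.1 ht).1)
      (hr.ae_relCurrent_mem h𝒯 m (Finset.mem_Icc.1 ht).1)
      (measurable_mulVec (measurable_matrix_transpose hθ)
        (hr.measurable_zrel h𝒯 m i (Finset.mem_Icc.1 ht).1))
      ((hb.const_mul _).const_mul _) (hr.ae_closedLoop_le h𝒯 hc hb hbound hmem
        (Finset.mem_Icc.1 ht).1 (Finset.mem_Icc.1 ht).2)
  have h' : Integrable (fun ω => ∑ t ∈ Finset.Icc 1 T,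
      (quad (𝒯.relS m (r.relCurrent 𝒯 m t ω)) ((r.relParam m ω)ᵀ *ᵥ r.zrel m i t ω) -
        quad (𝒯.relS m (r.relCurrent 𝒯 m t ω))
          ((r.relCurrent 𝒯 m t ω)ᵀ *ᵥ r.zrel m i t ω))) P := by
    refine integrable_finsetSum _ fun t ht => ?_
    exact (h t ht _ (hr.measurable_relParam m) (hr.ae_relParam_mem h𝒯 m)).sub
      (h t ht _ (hr.measurable_relCurrent h𝒯 m (Finset.mem_Icc.1 ht).1)
        (hr.ae_relCurrent_mem h𝒯 m (Finset.mem_Icc.1 ht).1))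
  exact h'.congr (Filter.Eventually.of_forall fun ω => (regretPath₂_eq m i T ω).symm)

lemma integral_noiseTerm {t : ℕ} (ht : 1 ≤ t) (htT : t ≤ T) :
    Integrable (r.noiseTerm 𝒯 m i t) P ∧ ∫ ω, r.noiseTerm 𝒯 m i t ω ∂P = 0 := by
  have hκ0 : 0 ≤ κ := zero_le_one.trans hκ.one_le
  have hle := hr.hist_le m t (t + 1)
  have hS : Measurable[r.hist m t (t + 1)] fun ω => 𝒯.relS m (r.relCurrent 𝒯 m t ω) :=
    (measurable_relS h𝒯 m).comp (hr.measurable_hist_relCurrent h𝒯 m ht)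
  have ha : Measurable[r.hist m t (t + 1)] fun ω => 𝒯.relS m (r.relCurrent 𝒯 m t ω) *ᵥ
      ((r.relParam m ω)ᵀ *ᵥ r.zrel m i t ω) :=
    measurable_mulVec hS (measurable_mulVec
      (measurable_matrix_transpose (measurable_hist_param m _ _))
      (hr.measurable_hist_zrel h𝒯 m i ht))
  refine integral_noise_eq_zero (hr.measurable_wrel m i t) (hr.indep_wrel_hist h𝒯 m i t)
    relVar_nonneg (hr.map_dotProduct_wrel m i t) ha hS ?_ ?_
  · intro l
    have hmeas : Measurable fun ω => (𝒯.relS m (r.relCurrent 𝒯 m t ω) *ᵥ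
        ((r.relParam m ω)ᵀ *ᵥ r.zrel m i t ω)) l :=
      (measurable_pi_apply l).comp (ha.mono hle le_rfl)
    refine ((integrable_const (1 : ℝ)).add
      ((hb.const_mul (c * 𝒯.relVar)).const_mul (κ ^ 2))).mono' hmeas.aestronglyMeasurable ?_
    filter_upwards [hr.ae_relCurrent_mem h𝒯 m ht, hr.ae_closedLoop_le h𝒯 hc hb hbound
      (hr.ae_relParam_mem h𝒯 m) ht htT] with ω h1 h2
    have h3 := dotProduct_mulVec_self_le_of_norm_le _ (hκ.norm_S _ h1)
      ((r.relParam m ω)ᵀ *ᵥ r.zrel m i t ω)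
    set y := 𝒯.relS m (r.relCurrent 𝒯 m t ω) *ᵥ ((r.relParam m ω)ᵀ *ᵥ r.zrel m i t ω)
    have h4 : y l * y l ≤ y ⬝ᵥ y :=
      Finset.single_le_sum (f := fun l => y l * y l) (fun l _ => mul_self_nonneg _)
        (Finset.mem_univ l)
    have h5 : |y l| ≤ 1 + y l * y l := by
      rw [← abs_mul_abs_self (y l)]
      nlinarith [sq_nonneg (|y l| - 1), abs_nonneg (y l)]
    have h6 := mul_le_mul_of_nonneg_left h2 (sq_nonneg κ)
    simp only [Real.norm_eq_abs, Pi.add_apply]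
    linarith
  · intro l k
    refine (integrable_const κ).mono' ((measurable_pi_apply k).comp ((measurable_pi_apply l).comp
      (hS.mono hle le_rfl))).aestronglyMeasurable ?_
    filter_upwards [hr.ae_relCurrent_mem h𝒯 m ht] with ω h1
    exact relS_apply_abs_le hκ h1 l k

lemma integrable_regretPath_and_regret_eq : Integrable (r.regretPath 𝒯 m i T) P ∧
    r.regret 𝒯 P m i T = r.regret₀ 𝒯 P m T + r.regret₁ 𝒯 P m i T + r.regret₂ 𝒯 P m i T := by
  have h0 := hr.integrable_regretPath₀ h𝒯 hκ T
  have h1 := hr.integrable_regretPath₁ h𝒯 hκ hc hb hbound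
  have h2 := hr.integrable_regretPath₂ h𝒯 hκ hc hb hbound
  have h3 : ∀ t ∈ Finset.Icc 1 T, Integrable (r.noiseTerm 𝒯 m i t) P ∧
      ∫ ω, r.noiseTerm 𝒯 m i t ω ∂P = 0 := fun t ht =>
    hr.integral_noiseTerm h𝒯 hκ hc hb hbound (Finset.mem_Icc.1 ht).1 (Finset.mem_Icc.1 ht).2
  have h4 : Integrable (fun ω => ∑ t ∈ Finset.Icc 1 T, r.noiseTerm 𝒯 m i t ω) P :=
    integrable_finsetSum _ fun t ht => (h3 t ht).1
  have h01 : Integrable (fun ω => r.regretPath₀ 𝒯 m T ω + r.regretPath₁ 𝒯 m i T ω) P := h0.add h1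
  have h012 : Integrable (fun ω => r.regretPath₀ 𝒯 m T ω + r.regretPath₁ 𝒯 m i T ω +
      r.regretPath₂ 𝒯 m i T ω) P := h01.add h2
  have he : r.regretPath 𝒯 m i T =ᵐ[P] fun ω => r.regretPath₀ 𝒯 m T ω + r.regretPath₁ 𝒯 m i T ω +
      r.regretPath₂ 𝒯 m i T ω + ∑ t ∈ Finset.Icc 1 T, r.noiseTerm 𝒯 m i t ω := by
    filter_upwards [hr.ae_inSupport h𝒯 m] with ω hω using hr.regretPath_eq h𝒯 hω i T
  refine ⟨(h012.add h4).congr he.symm, ?_⟩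
  unfold regret regret₀ regret₁ regret₂
  rw [integral_congr_ae he, integral_add h012 h4, integral_add h01 h2, integral_add h0 h1,
    integral_finsetSum _ fun t ht => (h3 t ht).1, Finset.sum_eq_zero fun t ht => (h3 t ht).2,
    add_zero]

end

end IsTSDEMF

end Run

namespace Run

variable {M n dx du : ℕ} {Ω : Type*} {r : Run M n dx du Ω} {𝒯 : Team M n dx du}
variable [mΩ : MeasurableSpace Ω] {P : Measure Ω} [NeZero n] [IsProbabilityMeasure P]
variable {m : Fin M} {i : Fin n} {T : ℕ} {κ c : ℝ} {b : Ω → ℝ}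

/-! ### The sampling error -/

/-- The number of time steps charged to an episode that starts at time `s`: one more than the length
of the episode before it. It vanishes if no episode starts at `s`. -/
noncomputable def episodeCharge (r : Run M n dx du Ω) (𝒯 : Team M n dx du) (m : Fin M) (s : ℕ)
    (ω : Ω) : ℕ :=
  if (episode (r.relDet 𝒯 m ω) s).start = s then (episode (r.relDet 𝒯 m ω) s).prevLen + 1 else 0

omit mΩ [NeZero n] in
lemma sum_episodeCharge (m : Fin M) (T : ℕ) (ω : Ω) :
    ∑ s ∈ Finset.Icc 1 T, r.episodeCharge 𝒯 m s ω =
      (episode (r.relDet 𝒯 m ω) T).start + r.K 𝒯 m T ω :=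
  sum_prevLen_add_one T

omit mΩ [NeZero n] in
lemma episodeCharge_le (m : Fin M) {s T : ℕ} (hs : s ∈ Finset.Icc 1 T) (ω : Ω) :
    r.episodeCharge 𝒯 m s ω ≤ 2 * T := by
  have h1 := Finset.single_le_sum (f := fun s => r.episodeCharge 𝒯 m s ω)
    (fun _ _ => Nat.zero_le _) hs
  have h2 := sum_episodeCharge (r := r) (𝒯 := 𝒯) m T ω
  have h3 := episode_start_le (d := r.relDet 𝒯 m ω) T
  have h4 : r.K 𝒯 m T ω ≤ T := episode_k_le T
  omega

namespace IsTSDEMF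

variable (hr : r.IsTSDEMF 𝒯 P) (h𝒯 : 𝒯.Assumptions)
include hr h𝒯

lemma measurable_relInfo_episodeCharge (m : Fin M) (s : ℕ) :
    Measurable[r.relInfo 𝒯 m s] (r.episodeCharge 𝒯 m s) := by
  obtain ⟨-, h1, h2⟩ := measurable_episode (_mΩ := r.relInfo 𝒯 m s) (d := r.relDet 𝒯 m) (t := s)
    fun u hu => hr.measurable_relInfo_relDet h𝒯 m hu
  have h : Measurable fun p : ℕ × ℕ => if p.1 = s then p.2 + 1 else 0 := Measurable.of_discrete
  exact h.comp (h1.prodMk h2)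

/-- Given the data up to the start of an episode, its sample has the law of the true parameter. -/
lemma integral_episodeCharge_mul_relJ (m : Fin M) {s : ℕ} (hs : 1 ≤ s) :
    ∫ ω, (r.episodeCharge 𝒯 m s ω : ℝ) * 𝒯.relJ m (r.relSample m s ω) ∂P =
      ∫ ω, (r.episodeCharge 𝒯 m s ω : ℝ) * 𝒯.relJ m (r.relParam m ω) ∂P := by
  have hI := hr.measurable_relInfo_episodeCharge h𝒯 m s
  have hI' : Measurable (r.episodeCharge 𝒯 m s) :=
    hI.mono ((hr.relInfo_le_hist h𝒯 m s).trans (hr.hist_le m s s)) le_rfl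
  have hf : Measurable fun p : ℕ × Param (Fin dx) (Fin du) => (p.1 : ℝ) * 𝒯.relJ m p.2 :=
    ((Measurable.of_discrete (f := fun k : ℕ => (k : ℝ))).comp measurable_fst).mul
      ((measurable_relJ h𝒯 m).comp measurable_snd)
  have h1 := congrArg (fun μ => ∫ p, (p.1 : ℝ) * 𝒯.relJ m p.2 ∂μ)
    (hr.map_prodMk_relSample h𝒯 m hs hI)
  rwa [integral_map (hI'.prodMk (hr.relSample_measurable m s)).aemeasurable
      hf.aestronglyMeasurable,
    integral_map (hI'.prodMk (hr.measurable_relParam m)).aemeasurable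
      hf.aestronglyMeasurable] at h1

/-- The sampling error is at most the optimal performance times the number of episodes. -/
lemma regret₀_le (hκ : 𝒯.BoundedBy m κ) {g : Ω → ℝ} (hg : Integrable g P)
    (hK : ∀ᵐ ω ∂P, (r.K 𝒯 m T ω : ℝ) ≤ g ω) :
    r.regret₀ 𝒯 P m T ≤ κ * 𝒯.relVar * ∫ ω, g ω ∂P := by
  have hκ0 : 0 ≤ κ * 𝒯.relVar := mul_nonneg (zero_le_one.trans hκ.one_le) relVar_nonneg
  have hI' : ∀ s, Measurable fun ω => (r.episodeCharge 𝒯 m s ω : ℝ) := fun s =>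
    (Measurable.of_discrete (f := fun k : ℕ => (k : ℝ))).comp
      ((hr.measurable_relInfo_episodeCharge h𝒯 m s).mono
        ((hr.relInfo_le_hist h𝒯 m s).trans (hr.hist_le m s s)) le_rfl)
  have hi : ∀ s ∈ Finset.Icc 1 T, ∀ θ : Ω → Param (Fin dx) (Fin du), Measurable θ →
      (∀ᵐ ω ∂P, θ ω ∈ 𝒯.relSet m) →
      Integrable (fun ω => (r.episodeCharge 𝒯 m s ω : ℝ) * 𝒯.relJ m (θ ω)) P := by
    intro s hs θ hθ hmem
    refine ((hr.integrable_relJ h𝒯 hκ hθ hmem).const_mul (2 * T : ℝ)).mono'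
      ((hI' s).mul ((measurable_relJ h𝒯 m).comp hθ)).aestronglyMeasurable
      (Filter.Eventually.of_forall fun ω => ?_)
    have h0 := relJ_nonneg (𝒯 := 𝒯) m (θ ω)
    rw [Real.norm_of_nonneg (by positivity)]
    exact mul_le_mul_of_nonneg_right (by exact_mod_cast episodeCharge_le m hs ω) h0
  have hiS : ∀ s ∈ Finset.Icc 1 T, Integrable
      (fun ω => (r.episodeCharge 𝒯 m s ω : ℝ) * 𝒯.relJ m (r.relSample m s ω)) P := fun s hs =>
    hi s hs _ (hr.relSample_measurable m s) (hr.ae_relSample_mem h𝒯 m (Finset.mem_Icc.1 hs).1)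
  have hiP : ∀ s ∈ Finset.Icc 1 T, Integrable
      (fun ω => (r.episodeCharge 𝒯 m s ω : ℝ) * 𝒯.relJ m (r.relParam m ω)) P := fun s hs =>
    hi s hs _ (hr.measurable_relParam m) (hr.ae_relParam_mem h𝒯 m)
  have hiT : Integrable (fun ω => T * 𝒯.relJ m (r.relParam m ω)) P :=
    (hr.integrable_relJ h𝒯 hκ (hr.measurable_relParam m) (hr.ae_relParam_mem h𝒯 m)).const_mul _
  have hsumS := integrable_finsetSum (Finset.Icc 1 T) hiS
  have hsumP := integrable_finsetSum (Finset.Icc 1 T) hiP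
  calc r.regret₀ 𝒯 P m T
      ≤ ∫ ω, (∑ s ∈ Finset.Icc 1 T, (r.episodeCharge 𝒯 m s ω : ℝ) * 𝒯.relJ m (r.relSample m s ω) -
          T * 𝒯.relJ m (r.relParam m ω)) ∂P := by
        refine integral_mono (hr.integrable_regretPath₀ h𝒯 hκ T) (hsumS.sub hiT) fun ω => ?_
        rw [regretPath₀_eq]
        refine sub_le_sub_right ?_ _
        refine (sum_start_le (d := r.relDet 𝒯 m ω) (g := fun s => 𝒯.relJ m (r.relSample m s ω))
          fun s _ => relJ_nonneg m _).trans_eq (Finset.sum_congr rfl fun s _ => ?_)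
        unfold episodeCharge
        split_ifs <;> simp
    _ = ∫ ω, (∑ s ∈ Finset.Icc 1 T, (r.episodeCharge 𝒯 m s ω : ℝ) * 𝒯.relJ m (r.relParam m ω) -
          T * 𝒯.relJ m (r.relParam m ω)) ∂P := by
        rw [integral_sub hsumS hiT, integral_sub hsumP hiT, integral_finsetSum _ hiS,
          integral_finsetSum _ hiP]
        congr 1
        exact Finset.sum_congr rfl fun s hs =>
          hr.integral_episodeCharge_mul_relJ h𝒯 m (Finset.mem_Icc.1 hs).1
    _ ≤ ∫ ω, κ * 𝒯.relVar * g ω ∂P := by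
        refine integral_mono_ae (hsumP.sub hiT) (hg.const_mul _) ?_
        filter_upwards [hK, hr.ae_relParam_mem h𝒯 m] with ω h1 h2
        have h0 := relJ_nonneg (𝒯 := 𝒯) m (r.relParam m ω)
        rw [← Finset.sum_mul, ← sub_mul]
        have h3 : ((∑ s ∈ Finset.Icc 1 T, (r.episodeCharge 𝒯 m s ω : ℝ)) - T) ≤ r.K 𝒯 m T ω := by
          have h4 := sum_episodeCharge (r := r) (𝒯 := 𝒯) m T ω
          have h5 := episode_start_le (d := r.relDet 𝒯 m ω) T
          have h6 : ∑ s ∈ Finset.Icc 1 T, r.episodeCharge 𝒯 m s ω ≤ T + r.K 𝒯 m T ω := by omega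
          have h7 : ∑ s ∈ Finset.Icc 1 T, (r.episodeCharge 𝒯 m s ω : ℝ) ≤
              (T : ℝ) + r.K 𝒯 m T ω := by exact_mod_cast h6
          linarith
        calc _ ≤ (r.K 𝒯 m T ω : ℝ) * 𝒯.relJ m (r.relParam m ω) :=
              mul_le_mul_of_nonneg_right h3 h0
          _ ≤ g ω * (κ * 𝒯.relVar) :=
              mul_le_mul h1 (relJ_le hκ h2) h0 ((Nat.cast_nonneg _).trans h1)
          _ = _ := mul_comm _ _
    _ = _ := integral_const_mul _ _

/-! ### Regret bounds -/

omit hr h𝒯 in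
lemma integral_le_of_ae_le {f g : Ω → ℝ} {C : ℝ} (hf : Integrable f P) (hg : Integrable g P)
    (h : ∀ᵐ ω ∂P, f ω ≤ C * g ω) : ∫ ω, f ω ∂P ≤ C * ∫ ω, g ω ∂P := by
  rw [← integral_const_mul]
  exact integral_mono_ae hf (hg.const_mul C) h

end IsTSDEMF

end Run

/-- The constant in the regret bounds: a common bound for the factors in the pathwise bounds, times
the constant in the third moment of the random level. -/
noncomputable def regretConst (κ : ℝ) : ℝ :=
  9 * κ ^ 3 * (11 * κ ^ 8) ^ 2 * (27 * (1 + κ ^ 2 * (4 + 2 * Real.exp (κ ^ 3 / 2))))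

lemma regretConst_nonneg {κ : ℝ} (hκ : 1 ≤ κ) : 0 ≤ regretConst κ := by
  unfold regretConst
  positivity

namespace Run

variable {M n dx du : ℕ} {Ω : Type*} {r : Run M n dx du Ω} {𝒯 : Team M n dx du}
variable [mΩ : MeasurableSpace Ω] {P : Measure Ω} [NeZero n] [IsProbabilityMeasure P]
variable {m : Fin M} {T : ℕ} {κ : ℝ}

namespace IsTSDEMF

variable (hr : r.IsTSDEMF 𝒯 P) (h𝒯 : 𝒯.Assumptions)
include hr h𝒯

lemma regret_bounds (hκ : 𝒯.BoundedBy m κ) (hpos : 0 < 𝒯.relVar) (hdx : dx ≠ 0) (i : Fin n)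
    (hT : 1 ≤ T) :
    r.regret₀ 𝒯 P m T ≤ regretConst κ * logFactor T n ^ 3 *
        (𝒯.relVar * Real.sqrt (((dx : ℝ) + du) * T)) ∧
      r.regret₁ 𝒯 P m i T ≤ regretConst κ * logFactor T n ^ 3 *
        (𝒯.relVar * Real.sqrt (((dx : ℝ) + du) * T)) ∧
      r.regret₂ 𝒯 P m i T ≤ regretConst κ * logFactor T n ^ 3 *
        (𝒯.relVar * (((dx : ℝ) + du) * Real.sqrt ((dx : ℝ) * T))) := by
  obtain ⟨b, hb, hbE, hbound⟩ := hr.exists_pathBound h𝒯 hκ hpos hdx i hT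
  have hκ1 := hκ.one_le
  have hc : 1 ≤ 11 * κ ^ 8 := by linarith [one_le_pow₀ hκ1 (n := 8)]
  set c := 11 * κ ^ 8 with hcdef
  have hd : (0 : ℝ) ≤ (dx : ℝ) + du := by positivity
  -- powers of the level below the third are dominated by its cube
  have hcube : ∀ᵐ ω ∂P, 1 ≤ b ω ∧ b ω ≤ b ω ^ 3 ∧ b ω ^ 2 ≤ b ω ^ 3 := by
    filter_upwards [hbound] with ω hω
    exact ⟨hω.one_le, le_self_pow₀ hω.one_le (by norm_num),
      pow_le_pow_right₀ hω.one_le (by norm_num)⟩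
  have hfinal : ∀ {a f : ℝ}, 0 ≤ a → 0 ≤ f → a ≤ 9 * κ ^ 3 * c ^ 2 →
      a * f * ∫ ω, b ω ^ 3 ∂P ≤ regretConst κ * logFactor T n ^ 3 * f := by
    intro a f ha hf hle
    have hL : 0 ≤ logFactor T n := zero_le_one.trans
      (one_le_logFactor hT (Nat.one_le_iff_ne_zero.2 (NeZero.ne n)))
    calc a * f * ∫ ω, b ω ^ 3 ∂P ≤ a * f *
          (27 * (1 + κ ^ 2 * (4 + 2 * Real.exp (κ ^ 3 / 2))) * logFactor T n ^ 3) := by gcongr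
      _ ≤ 9 * κ ^ 3 * c ^ 2 * f *
          (27 * (1 + κ ^ 2 * (4 + 2 * Real.exp (κ ^ 3 / 2))) * logFactor T n ^ 3) := by gcongr
      _ = _ := by
          unfold regretConst
          rw [← hcdef]
          ring
  have hv := hpos.le
  refine ⟨?_, ?_, ?_⟩
  · have h1 := hr.regret₀_le (T := T) h𝒯 hκ
      (g := fun ω => 9 * c * Real.sqrt (((dx : ℝ) + du) * T) * b ω ^ 3) (hb.const_mul _) (by
        filter_upwards [hbound, hcube] with ω h1 h2
        refine (h1.numEpisodes_le h𝒯 hpos hdx hT hc).trans ?_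
        calc _ = 9 * c * Real.sqrt (((dx : ℝ) + du) * T) * b ω := by ring
          _ ≤ _ := by gcongr; exact h2.2.1)
    rw [integral_const_mul] at h1
    refine h1.trans (le_trans (le_of_eq ?_) (hfinal (a := 9 * κ * c)
      (f := 𝒯.relVar * Real.sqrt (((dx : ℝ) + du) * T)) (by positivity) (by positivity) ?_))
    · ring
    · have e1 : κ ≤ κ ^ 3 := le_self_pow₀ hκ1 (by norm_num)
      have e2 : c ≤ c ^ 2 := le_self_pow₀ hc (by norm_num)
      gcongr
  · refine (integral_le_of_ae_le (C := 9 * κ * c ^ 2 *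
      (𝒯.relVar * Real.sqrt (((dx : ℝ) + du) * T)))
      (hr.integrable_regretPath₁ h𝒯 hκ hc hb hbound) hb ?_).trans
      (hfinal (by positivity) (by positivity) ?_)
    · filter_upwards [hbound, hcube] with ω h1 h2
      refine (h1.regretPath₁_le h𝒯 hκ hpos hdx hT hc).trans ?_
      calc _ = 9 * κ * c ^ 2 * (𝒯.relVar * Real.sqrt (((dx : ℝ) + du) * T)) * b ω ^ 2 := by ring
        _ ≤ _ := by gcongr ?_ * ?_; exact h2.2.2
    · have e1 : κ ≤ κ ^ 3 := le_self_pow₀ hκ1 (by norm_num)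
      gcongr
  · refine (integral_le_of_ae_le (C := 8 * κ ^ 3 * c ^ 2 *
      (𝒯.relVar * (((dx : ℝ) + du) * Real.sqrt ((dx : ℝ) * T))))
      (hr.integrable_regretPath₂ h𝒯 hκ hc hb hbound) hb ?_).trans
      (hfinal (by positivity) (by positivity) ?_)
    · filter_upwards [hbound, hcube] with ω h1 h2
      refine (h1.regretPath₂_le hr h𝒯 hκ hpos hc).trans ?_
      calc _ = 8 * κ ^ 3 * c ^ 2 * (𝒯.relVar * (((dx : ℝ) + du) * Real.sqrt ((dx : ℝ) * T))) *
            b ω ^ 2 := by ring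
        _ ≤ _ := by gcongr ?_ * ?_; exact h2.2.2
    · gcongr
      norm_num

omit [IsProbabilityMeasure P] in
/-- With one agent, or in dimension zero, the relative system is trivial. -/
lemma regretPath_eq_zero (hdeg : n = 1 ∨ dx = 0) (m : Fin M) (i : Fin n) (T : ℕ) :
    r.regretPath 𝒯 m i T = 0 ∧ r.regretPath₀ 𝒯 m T = 0 ∧ r.regretPath₁ 𝒯 m i T = 0 ∧
      r.regretPath₂ 𝒯 m i T = 0 := by
  have hx : ∀ t ω, r.xrel m i t ω = 0 := by
    intro t ω
    rcases hdeg with rfl | rfl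
    · have h := sum_xrel (r := r) m t ω
      rw [Fin.sum_univ_one] at h
      rwa [Subsingleton.elim i 0]
    · exact Subsingleton.elim _ _
  have hJ : ∀ θ, 𝒯.relJ m θ = 0 := by
    intro θ
    rcases hdeg with rfl | rfl
    · simp [Team.relJ, Team.relVar]
    · simp [Team.relJ, Matrix.trace]
  have hu : ∀ t, 1 ≤ t → ∀ ω, r.urel m i t ω = 0 := by
    intro t ht ω
    rw [hr.urel_eq m i ht, hx, mulVec_zero]
  have hz : ∀ t, 1 ≤ t → ∀ ω, r.zrel m i t ω = 0 := by
    intro t ht ω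
    rw [hr.zrel_eq m i ht, hx, mulVec_zero]
  refine ⟨?_, ?_, ?_, ?_⟩ <;> ext ω
  · rw [regretPath, hJ, Finset.sum_eq_zero]
    · simp
    · intro t ht
      rw [relCost, hx, hu t (Finset.mem_Icc.1 ht).1, quad_zero_vec, quad_zero_vec, add_zero]
  · simp [regretPath₀_eq, hJ]
  · simp [regretPath₁_eq, hx, quad_zero_vec]
  · rw [regretPath₂_eq]
    refine Finset.sum_eq_zero fun t ht => ?_
    rw [hz t (Finset.mem_Icc.1 ht).1, mulVec_zero, mulVec_zero, sub_self]

end IsTSDEMF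

end Run

end MeanFieldTeam

theorem lemma3 :
    ∃ (p : ℕ) (C : ℝ → ℝ), ∀ (M n dx du : ℕ) (𝒯 : MeanFieldTeam.Team M n dx du),
      𝒯.Assumptions →
      (∀ m : Fin M, ∃ κ : ℝ, 𝒯.BoundedBy m κ) ∧
      ∀ (Ω : Type*) [MeasurableSpace Ω] (P : MeasureTheory.Measure Ω)
        [MeasureTheory.IsProbabilityMeasure P] (r : MeanFieldTeam.Run M n dx du Ω),
        r.IsTSDEMF 𝒯 P →
        ∀ (m : Fin M) (i : Fin n) (T : ℕ), 1 ≤ T →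
          (MeasureTheory.Integrable (r.regretPath 𝒯 m i T) P ∧
            MeasureTheory.Integrable (r.regretPath₀ 𝒯 m T) P ∧
            MeasureTheory.Integrable (r.regretPath₁ 𝒯 m i T) P ∧
            MeasureTheory.Integrable (r.regretPath₂ 𝒯 m i T) P) ∧
          r.regret 𝒯 P m i T =
            r.regret₀ 𝒯 P m T + r.regret₁ 𝒯 P m i T + r.regret₂ 𝒯 P m i T ∧
          ∀ κ : ℝ, 𝒯.BoundedBy m κ →
            r.regret₀ 𝒯 P m T ≤ C κ * MeanFieldTeam.logFactor T n ^ p *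
              (𝒯.relVar * Real.sqrt (((dx : ℝ) + du) * T)) ∧
            r.regret₁ 𝒯 P m i T ≤ C κ * MeanFieldTeam.logFactor T n ^ p *
              (𝒯.relVar * Real.sqrt (((dx : ℝ) + du) * T)) ∧
            r.regret₂ 𝒯 P m i T ≤ C κ * MeanFieldTeam.logFactor T n ^ p *
              (𝒯.relVar * (((dx : ℝ) + du) * Real.sqrt ((dx : ℝ) * T))) := by
  refine ⟨3, MeanFieldTeam.regretConst, fun M n dx du 𝒯 h𝒯 => ⟨h𝒯.exists_boundedBy, ?_⟩⟩
  intro Ω _ P _ r hr m i T hT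
  have : NeZero n := ⟨fun h => by subst h; exact i.elim0⟩
  have hn1 : 1 ≤ n := Nat.one_le_iff_ne_zero.2 (NeZero.ne n)
  by_cases hdeg : n = 1 ∨ dx = 0
  · obtain ⟨h, h0, h1, h2⟩ := hr.regretPath_eq_zero h𝒯 hdeg m i T
    have hL : 0 ≤ MeanFieldTeam.logFactor T n :=
      zero_le_one.trans (MeanFieldTeam.one_le_logFactor hT hn1)
    have hv : 0 ≤ 𝒯.relVar := MeanFieldTeam.Run.relVar_nonneg
    simp only [MeanFieldTeam.Run.regret, MeanFieldTeam.Run.regret₀, MeanFieldTeam.Run.regret₁,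
      MeanFieldTeam.Run.regret₂, h, h0, h1, h2]
    refine ⟨⟨integrable_zero _ _ _, integrable_zero _ _ _, integrable_zero _ _ _,
      integrable_zero _ _ _⟩, by simp, fun κ hκ => ?_⟩
    have hC := MeanFieldTeam.regretConst_nonneg hκ.one_le
    simp only [Pi.zero_apply, integral_zero]
    exact ⟨by positivity, by positivity, by positivity⟩
  · rw [not_or] at hdeg
    have hpos : 0 < 𝒯.relVar := by
      have h1 : (1 : ℝ) < n := by exact_mod_cast lt_of_le_of_ne hn1 (Ne.symm hdeg.1)
      have h2 := h𝒯.σw_pos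
      exact mul_pos (sub_pos.2 ((div_lt_one (by linarith)).2 h1)) (by positivity)
    obtain ⟨κ, hκ⟩ := h𝒯.exists_boundedBy m
    obtain ⟨b, hb, -, hbound⟩ := hr.exists_pathBound h𝒯 hκ hpos hdeg.2 i hT
    have hc : 1 ≤ 11 * κ ^ 8 := by linarith [one_le_pow₀ hκ.one_le (n := 8)]
    obtain ⟨h, heq⟩ := hr.integrable_regretPath_and_regret_eq h𝒯 hκ hc hb hbound
    exact ⟨⟨h, hr.integrable_regretPath₀ h𝒯 hκ T, hr.integrable_regretPath₁ h𝒯 hκ hc hb hbound,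
      hr.integrable_regretPath₂ h𝒯 hκ hc hb hbound⟩, heq,
      fun κ hκ => hr.regret_bounds h𝒯 hκ hpos hdeg.2 i hT⟩
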